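/- Let $d\ge 1$ be an integer, $H\in(1/2,1)$, $\alpha\in[0,d)$ with $0<d-\alpha<4H$, let $T>0$, $t_0\in(0,T]$, $M>0$ and $k_1,k_2>0$. Write $|\cdot|$ for the Euclidean norm and $\mathcal F\varphi(\xi)=\int_{\mathbb R^d}e^{ix\cdot\xi}\varphi(x)\,dx$. Let $\Lambda$ be a non-negative tempered measure on $\mathbb R^d$ (for instance $\Lambda(dx)=f(x)\,dx$, or $\Lambda=\delta_0$ when $\alpha=0$) with a spectral measure $\mu$, that is, $\mu$ is a non-negative tempered measure such that $\int\varphi\,d\Lambda=(2\pi)^{-d}\int\mathcal F\varphi\,d\mu$ for all Schwartz functions $\varphi$, and suppose that for all measurable $h\ge 0$ $$k_1\int_{\mathbb R^d}h(\xi)|\xi|^{-\alpha}\,d\xi\le\int_{\mathbb R^d}h\,d\mu\le k_2\int_{\mathbb R^d}h(\xi)|\xi|^{-\alpha}\,d\xi .$$ Let $W=\{W(t,A)\}$, $t\in[0,T]$, $A\subset\mathbb R^d$ bounded Borel, be a centred Gaussian field on a probability space with $$E\big(W(t,A)W(s,B)\big)=\tfrac12\big(t^{2H}+s^{2H}-|t-s|^{2H}\big)\int_A\Lambda(z-B)\,dz$$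 (so the spatial factor is $\int_A\int_B f(z-w)\,dw\,dz$ if $\Lambda(dx)=f(x)\,dx$, and the Lebesgue measure $|A\cap B|$ if $\Lambda=\delta_0$). Let $u$ be the random field solution of $\partial_t u=\Delta u+\dot W$, $u(0,\cdot)=0$, i.e. for $(t,x)\in[0,T]\times\mathbb R^d$ $$u(t,x)=\int_0^t\int_{\mathbb R^d}G(t-s,x-y)\,W(ds,dy),\qquad G(t,x)=\frac{1}{(4\pi t)^{d/2}}e^{-|x|^2/(4t)}\quad(t>0).$$ This is a Wiener integral: the integral of $1_{(a,b]}(s)1_A(y)$ is $W(b,A)-W(a,A)$, extended linearly, and the integral of $\varphi$ is the $L^2(\Omega)$-limit of the integrals of linear combinations $\varphi_n$ of such indicators for which $N(\varphi_n-\varphi)\to0$, where $$N(\varphi)=H(2H-1)\int_{\mathbb R}\int_{\mathbb R}|r-s|^{2H-2}\int_{\mathbb R^d}\int_{\mathbb R^d}|\varphi(r,z)|\,|\varphi(s,z-v)|\,\Lambda(dv)\,dz\,ds\,dr .$$ For $t,s\in[0,T]$ and $x,y\in[-M,M]^d$ put $$\Delta(t,x;s,y)=|t-s|^{2H-\frac{d-\alpha}{2}}+\Big(\log\frac{2e\sqrt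 d\,M}{|x-y|}\Big)^{\beta}|x-y|^{2\wedge(4H-(d-\alpha))},$$ where $\beta=1$ if $4H-(d-\alpha)=2$ and $\beta=0$ otherwise, and the second summand is $0$ when $x=y$. Then there are constants $c_5,c_6>0$, depending only on $\alpha,d,t_0,H,M,T$ and on $k_1,k_2$, such that $$c_5\,\Delta(t,x;s,y)\le\|u(t,x)-u(s,y)\|_{L^2(\Omega)}^2\qquad\text{for all }t,s\in[t_0,T],\ x,y\in[-M,M]^d,$$ $$\|u(t,x)-u(s,y)\|_{L^2(\Omega)}^2\le c_6\,\Delta(t,x;s,y)\qquad\text{for all }t,s\in[0,T],\ x,y\in[-M,M]^d .$$ -/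

import Mathlib

open MeasureTheory ProbabilityTheory Filter Topology

noncomputable section

namespace FractionalHeat

/-- The Euclidean space `ℝᵈ`. -/
abbrev Space (d : ℕ) : Type := EuclideanSpace ℝ (Fin d)

/-- The cube `[-M, M]ᵈ`. -/
def cube (d : ℕ) (M : ℝ) : Set (Space d) := {x | ∀ i, x i ∈ Set.Icc (-M) M}

/-- The Fourier transform with the convention `∫ e^{i x·ξ} φ(x) dx`. -/
def fourierTransform {d : ℕ} (φ : Space d → ℂ) (ξ : Space d) : ℂ :=
  ∫ x, Complex.exp (Complex.I * ((inner ℝ x ξ : ℝ) : ℂ)) * φ x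

/-- `μ` is the spectral measure of the tempered non-negative measure `Λ` on `ℝᵈ`: both measures
define tempered distributions, and `∫ φ dΛ = (2π)⁻ᵈ ∫ 𝓕φ dμ` for all Schwartz functions `φ`.
For `Λ = δ₀` the spectral measure is Lebesgue measure. -/
structure IsSpectralMeasure {d : ℕ} (Λ μ : Measure (Space d)) : Prop where
  temperate_cov : Λ.HasTemperateGrowth
  temperate_spec : μ.HasTemperateGrowth
  integral_eq : ∀ φ : SchwartzMap (Space d) ℂ,
    ∫ x, φ x ∂Λ = (((2 * Real.pi) ^ d)⁻¹ : ℂ) * ∫ ξ, fourierTransform φ ξ ∂μ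

/-- `k₁ |ξ|^{-α} dξ ≤ μ(dξ) ≤ k₂ |ξ|^{-α} dξ`, tested on non-negative measurable functions. -/
def RieszComparable {d : ℕ} (α k₁ k₂ : ℝ) (μ : Measure (Space d)) : Prop :=
  ∀ h : Space d → ENNReal, Measurable h →
    ENNReal.ofReal k₁ * ∫⁻ ξ, h ξ * ENNReal.ofReal (‖ξ‖ ^ (-α)) ≤ ∫⁻ ξ, h ξ ∂μ ∧
    ∫⁻ ξ, h ξ ∂μ ≤ ENNReal.ofReal k₂ * ∫⁻ ξ, h ξ * ENNReal.ofReal (‖ξ‖ ^ (-α))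

/-- The covariance `R_H` of fractional Brownian motion with Hurst index `H`. -/
def fbmCov (H t s : ℝ) : ℝ :=
  (t ^ (2 * H) + s ^ (2 * H) - |t - s| ^ (2 * H)) / 2

/-- The spatial covariance of the noise: `∫_A ∫_B f(z - w) dw dz` if `Λ(dx) = f(x) dx`, and the
Lebesgue measure of `A ∩ B` if `Λ = δ₀`. -/
def spatialCov {d : ℕ} (Λ : Measure (Space d)) (A B : Set (Space d)) : ℝ :=
  (∫⁻ z in A, Λ {v | z - v ∈ B}).toReal

/-- The index set of the noise: times in `[0, T]` and bounded Borel sets. -/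
abbrev NoiseIndex (d : ℕ) (T : ℝ) : Type :=
  {p : ℝ × Set (Space d) //
    p.1 ∈ Set.Icc 0 T ∧ MeasurableSet p.2 ∧ Bornology.IsBounded p.2}

/-- `W` is a centred Gaussian field on `[0, T] × {bounded Borel sets}`, fractional in time with
Hurst index `H` and with spatial covariance given by `Λ`. -/
structure IsFractionalNoise {d : ℕ} {Ω : Type*} [MeasurableSpace Ω] (P : Measure Ω)
    (T H : ℝ) (Λ : Measure (Space d)) (W : NoiseIndex d T → Ω → ℝ) : Prop where
  gaussian : IsGaussianProcess W P
  centred : ∀ p, ∫ ω, W p ω ∂P = 0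
  covariance : ∀ p q, ∫ ω, W p ω * W q ω ∂P =
    fbmCov H p.1.1 q.1.1 * spatialCov Λ p.1.2 q.1.2

/-- An elementary integrand `∑ᵢ cᵢ 1_{(aᵢ, bᵢ]}(s) 1_{Aᵢ}(y)` on `[0, T] × ℝᵈ`. -/
structure Elementary (d : ℕ) (T : ℝ) where
  n : ℕ
  c : Fin n → ℝ
  a : Fin n → ℝ
  b : Fin n → ℝ
  A : Fin n → Set (Space d)
  a_nonneg : ∀ i, 0 ≤ a i
  a_le_b : ∀ i, a i ≤ b i
  b_le : ∀ i, b i ≤ T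
  measurableSet_A : ∀ i, MeasurableSet (A i)
  isBounded_A : ∀ i, Bornology.IsBounded (A i)

namespace Elementary

variable {d : ℕ} {T : ℝ}

/-- The elementary integrand as a function of time and space. -/
def toFun (e : Elementary d T) (s : ℝ) (y : Space d) : ℝ :=
  ∑ i, e.c i * (Set.Ioc (e.a i) (e.b i)).indicator 1 s * (e.A i).indicator 1 y

/-- The integral `∑ᵢ cᵢ (W(bᵢ, Aᵢ) - W(aᵢ, Aᵢ))` of an elementary integrand. -/
def integral {Ω : Type*} (e : Elementary d T) (W : NoiseIndex d T → Ω → ℝ) (ω : Ω) : ℝ :=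
  ∑ i, e.c i *
    (W ⟨(e.b i, e.A i), ⟨(e.a_nonneg i).trans (e.a_le_b i), e.b_le i⟩,
        e.measurableSet_A i, e.isBounded_A i⟩ ω -
      W ⟨(e.a i, e.A i), ⟨e.a_nonneg i, (e.a_le_b i).trans (e.b_le i)⟩,
        e.measurableSet_A i, e.isBounded_A i⟩ ω)

end Elementary

/-- The square of the norm of the space of integrands of the noise,
`H(2H-1) ∫∫ |r - s|^{2H-2} ∫∫ |φ(r, z)| |φ(s, z - v)| Λ(dv) dz ds dr`. -/
def energy {d : ℕ} (H : ℝ) (Λ : Measure (Space d)) (φ : ℝ → Space d → ℝ) : ENNReal :=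
  ENNReal.ofReal (H * (2 * H - 1)) *
    ∫⁻ r, ∫⁻ s, ENNReal.ofReal (|r - s| ^ (2 * H - 2)) *
      ∫⁻ z, ∫⁻ v, ‖φ r z‖ₑ * ‖φ s (z - v)‖ₑ ∂Λ

/-- `X` is the Wiener integral of `φ` with respect to the noise `W`: the limit in `L²(P)` of the
integrals of elementary integrands converging to `φ` in the norm of the space of integrands. -/
def IsWienerIntegral {d : ℕ} {Ω : Type*} [MeasurableSpace Ω] (P : Measure Ω)
    {T : ℝ} (H : ℝ) (Λ : Measure (Space d)) (W : NoiseIndex d T → Ω → ℝ)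
    (φ : ℝ → Space d → ℝ) (X : Ω → ℝ) : Prop :=
  MemLp X 2 P ∧ ∃ e : ℕ → Elementary d T,
    Tendsto (fun n => energy H Λ (fun s y => (e n).toFun s y - φ s y)) atTop (𝓝 0) ∧
    Tendsto (fun n => eLpNorm (fun ω => (e n).integral W ω - X ω) 2 P) atTop (𝓝 0)

/-- The heat kernel, the fundamental solution of `∂ₜ - Δ`. -/
def heatKernel {d : ℕ} (t : ℝ) (x : Space d) : ℝ :=
  if 0 < t then (4 * Real.pi * t) ^ (-(d : ℝ) / 2) * Real.exp (-‖x‖ ^ 2 / (4 * t)) else 0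

/-- `u` is the random field solution on `[0, T] × ℝᵈ` of the stochastic heat equation
`∂ₜ u = Δ u + Ẇ`, `u(0, ·) = 0`, i.e. `u(t, x) = ∫₀ᵗ ∫ G(t - s, x - y) W(ds, dy)`. -/
def IsHeatSolution {d : ℕ} {Ω : Type*} [MeasurableSpace Ω] (P : Measure Ω)
    {T : ℝ} (H : ℝ) (Λ : Measure (Space d)) (W : NoiseIndex d T → Ω → ℝ)
    (u : ℝ → Space d → Ω → ℝ) : Prop :=
  ∀ t ∈ Set.Icc 0 T, ∀ x : Space d,
    IsWienerIntegral P H Λ W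
      (fun s y => (Set.Ioc 0 t).indicator (fun r => heatKernel (t - r) (x - y)) s) (u t x)

/-- The gauge `|t-s|^{2H-(d-α)/2} + (log (2e√d M/|x-y|))^β |x-y|^{2 ∧ (4H-(d-α))}`, where
`β = 1` if `4H-(d-α) = 2` and `β = 0` otherwise. For `x = y` the second summand is `0`. -/
def gauge (d : ℕ) (α H M : ℝ) (t s : ℝ) (x y : Space d) : ℝ :=
  |t - s| ^ (2 * H - (d - α) / 2) +
    Real.log (2 * Real.exp 1 * √d * M / ‖x - y‖) ^
        (open Classical in if 4 * H - (d - α) = 2 then 1 else 0 : ℕ) *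
      ‖x - y‖ ^ min 2 (4 * H - (d - α))

end FractionalHeat

end

/-! The proof works in Fourier space. Put g_t(τ,ρ) = (e^{itτ} - e^{-tρ})/(ρ + iτ), the transform in
r of e^{-(t-r)ρ} on (0,t). The isometry of the Wiener integral becomes E|u(t,x) - u(s,y)|² = κ ∫∫
|τ|^{1-2H} |e^{ix·ξ} g_t(τ,|ξ|²) - e^{iy·ξ} g_s(τ,|ξ|²)|² dτ μ(dξ), with κ = `specConst d H`. The
integrand is non-negative, so at the cost of k₁ and k₂ the measure μ may be replaced by |ξ|^{-α} dξ
(`IsHeatSolution.variance_bounds`). What remains is to estimate the deterministic integral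
`rieszVariance`, in which neither Λ nor μ occurs; this is why the constants are uniform.

Isometry. For elementary integrands it is an identity of covariances. The time factor comes from ∫
(1 - cos tτ)|τ|^{-1-2H} dτ = c|t|^{2H}. The space factor is Parseval's identity for indicators:
smooth Λ by the heat kernel, which damps μ by e^{-t|ξ|²} and makes it finite, and let t → 0. To
extend the identity to limits, convergence in the energy N must force L² convergence of the
transforms; this is `lintegral_stFourier_le`. There |τ|^{1-2H} and |r-s|^{2H-2} are compared, up to
constants, with one mixture over ε of the Gaussian e^{-ετ²} and of its transform. A crude constant
suffices, since only convergence is drawn from it.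

Upper bound. One has |g_t - g_s| ≤ 3 min(|t-s|, 1/ρ, 1/|τ|), so integrating in τ gives a multiple of
min(|t-s|, |ξ|^{-2})^{2H}, whose integral against |ξ|^{-α} scales like |t-s|^{2H-(d-α)/2}. Changing
the point costs the factor min(4, |ξ|²|x-y|²). With r = |x-y| and θ = 4H-(d-α), the main radial
integral is r² ∫ ρ^{1-θ} dρ over (1/L, 1/r]. It is dominated by its upper end for θ < 2 and by its
lower end for θ > 2, and it is a logarithm for θ = 2.

Lower bound. The variance is bounded below by each summand of the gauge separately. For space,
averaging over ξ and -ξ eliminates u(s,y) and leaves sin²((x-y)·ξ)|g_t|², with no condition on s.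
For time, set h = t - s > 0 and compare the frequencies τ and τ + π/h: the relative phase of the two
exponentials is reversed, so the two numerators cannot both be small, whatever x and y are. This is
used on the shell |ξ|² ≈ 1/h, where the terms e^{-t|ξ|²} and e^{-s|ξ|²} are negligible. -/

open MeasureTheory ProbabilityTheory Filter Topology

noncomputable section

namespace FractionalHeat

/-! ### Gaussians, the heat kernel and tempered measures. -/

section

/-- Polynomials are dominated by Gaussians. -/
theorem one_add_pow_mul_exp_le {b : ℝ} (hb : 0 < b) (m : ℕ) {y : ℝ} (hy : 0 ≤ y) :
    (1 + y) ^ m * Real.exp (-b * y ^ 2) ≤ (2 / b) ^ m * m.factorial * Real.exp b := by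
  -- Here 1 + y ≤ 2 + 2y²; the power of b + by² is then absorbed by e^{b + by²}, whose factor
  -- e^{by²} cancels the Gaussian.
  have h1 : (1 + y) ^ m ≤ (2 / b) ^ m * (b + b * y ^ 2) ^ m := by
    rw [← mul_pow]
    refine pow_le_pow_left₀ (by positivity) ?_ m
    have : 2 / b * (b + b * y ^ 2) = 2 + 2 * y ^ 2 := by field_simp
    rw [this]
    nlinarith [sq_nonneg (y - 1)]
  have h2 : (b + b * y ^ 2) ^ m ≤ m.factorial * Real.exp (b + b * y ^ 2) := by
    have := Real.pow_div_factorial_le_exp (x := b + b * y ^ 2) (by positivity) m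
    rw [div_le_iff₀ (by positivity)] at this
    linarith
  calc (1 + y) ^ m * Real.exp (-b * y ^ 2)
      ≤ ((2 / b) ^ m * (m.factorial * Real.exp (b + b * y ^ 2))) * Real.exp (-b * y ^ 2) := by
        gcongr
        exact h1.trans (by gcongr)
    _ = (2 / b) ^ m * m.factorial * (Real.exp (b + b * y ^ 2) * Real.exp (-b * y ^ 2)) := by ring
    _ = _ := by rw [← Real.exp_add]; congr 2; ring

open scoped ContDiff in
/-- Translated Gaussians are Schwartz functions. -/
theorem exists_schwartzMap_gaussian {E : Type*} [NormedAddCommGroup E] [InnerProductSpace ℝ E]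
    {b : ℝ} (hb : 0 < b) (a : E) :
    ∃ φ : SchwartzMap E ℂ, ∀ x, φ x = (Real.exp (-b * ‖a - x‖ ^ 2) : ℂ) := by
  have hsub : (fun x : E => a - x).HasTemperateGrowth :=
    (Function.HasTemperateGrowth.const a).sub Function.HasTemperateGrowth.id'
  have hf : (fun x : E => -b * ‖a - x‖ ^ 2).HasTemperateGrowth :=
    (Function.HasTemperateGrowth.const (-b)).mul
      ((Function.hasTemperateGrowth_norm_sq E).comp hsub)
  have hsm : ContDiff ℝ ∞ (fun x : E => Real.exp (-b * ‖a - x‖ ^ 2)) :=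
    Real.contDiff_exp.comp hf.1
  refine ⟨⟨fun x => ((Real.exp (-b * ‖a - x‖ ^ 2) : ℝ) : ℂ),
    Complex.ofRealCLM.contDiff.comp hsm, fun k n => ?_⟩, fun x => rfl⟩
  obtain ⟨l, C, hC, hbd⟩ := hf.norm_iteratedFDeriv_le_uniform n
  refine ⟨(1 + ‖a‖) ^ (k + l * n) * ((n.factorial * (max C 1) ^ n) *
    ((2 / b) ^ (k + l * n) * (k + l * n).factorial * Real.exp b)), fun x => ?_⟩
  have h1 : ‖iteratedFDeriv ℝ n (fun x => ((Real.exp (-b * ‖a - x‖ ^ 2) : ℝ) : ℂ)) x‖ =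
      ‖iteratedFDeriv ℝ n (fun x => Real.exp (-b * ‖a - x‖ ^ 2)) x‖ :=
    Complex.ofRealLI.norm_iteratedFDeriv_comp_left hsm.contDiffAt (by exact_mod_cast le_top)
  have h2 : ‖iteratedFDeriv ℝ n (fun x => Real.exp (-b * ‖a - x‖ ^ 2)) x‖ ≤
      n.factorial * Real.exp (-b * ‖a - x‖ ^ 2) * (max C 1 * (1 + ‖x‖) ^ l) ^ n := by
    refine norm_iteratedFDeriv_comp_le (N := ∞) Real.contDiff_exp hf.1
      (by exact_mod_cast le_top) x (fun i _ => ?_) (fun i hi hin => ?_)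
    · rw [norm_iteratedFDeriv_eq_norm_iteratedDeriv, iteratedDeriv_eq_iterate,
        Real.iter_deriv_exp, Real.norm_eq_abs, Real.abs_exp]
    · refine (hbd i hin x).trans ?_
      have h1x : 1 ≤ (1 + ‖x‖) ^ l := one_le_pow₀ (by linarith [norm_nonneg x])
      -- The bound for derivatives of a composition asks for an i-th power; a base at least 1 is
      -- dominated by its i-th power for i ≥ 1, whence `max C 1` in place of `C`.
      have : (1 : ℝ) ≤ max C 1 * (1 + ‖x‖) ^ l := by
        nlinarith [le_max_right C 1]
      calc C * (1 + ‖x‖) ^ l ≤ max C 1 * (1 + ‖x‖) ^ l := by gcongr; exact le_max_left _ _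
        _ ≤ _ := le_self_pow₀ this (by omega)
  have h3 : (1 + ‖x‖) ≤ (1 + ‖a‖) * (1 + ‖a - x‖) := by
    have : ‖x‖ ≤ ‖a‖ + ‖a - x‖ := by
      calc ‖x‖ = ‖a - (a - x)‖ := by congr 1; abel
        _ ≤ _ := norm_sub_le _ _
    nlinarith [norm_nonneg a, norm_nonneg (a - x)]
  have h4 := one_add_pow_mul_exp_le hb (k + l * n) (norm_nonneg (a - x))
  change ‖x‖ ^ k * ‖iteratedFDeriv ℝ n (fun x => ((Real.exp (-b * ‖a - x‖ ^ 2) : ℝ) : ℂ)) x‖ ≤ _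
  rw [h1]
  calc ‖x‖ ^ k * ‖iteratedFDeriv ℝ n (fun x => Real.exp (-b * ‖a - x‖ ^ 2)) x‖
      ≤ (1 + ‖x‖) ^ k *
        (n.factorial * Real.exp (-b * ‖a - x‖ ^ 2) * (max C 1 * (1 + ‖x‖) ^ l) ^ n) := by
        gcongr
        linarith
    _ = (1 + ‖x‖) ^ (k + l * n) *
        ((n.factorial * (max C 1) ^ n) * Real.exp (-b * ‖a - x‖ ^ 2)) := by
        rw [mul_pow, ← pow_mul, pow_add]; ring
    _ ≤ ((1 + ‖a‖) * (1 + ‖a - x‖)) ^ (k + l * n) *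
        ((n.factorial * (max C 1) ^ n) * Real.exp (-b * ‖a - x‖ ^ 2)) := by
        gcongr
    _ = (1 + ‖a‖) ^ (k + l * n) * ((n.factorial * (max C 1) ^ n) *
        ((1 + ‖a - x‖) ^ (k + l * n) * Real.exp (-b * ‖a - x‖ ^ 2))) := by
        rw [mul_pow]; ring
    _ ≤ _ := by gcongr

variable {d : ℕ}

theorem heatKernel_of_pos {t : ℝ} (ht : 0 < t) (x : Space d) :
    heatKernel t x =
      (4 * Real.pi * t) ^ (-(d : ℝ) / 2) * Real.exp (-(1 / (4 * t)) * ‖x‖ ^ 2) := by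
  rw [heatKernel, if_pos ht]; congr 2; ring

theorem heatKernel_nonneg (t : ℝ) (x : Space d) : 0 ≤ heatKernel t x := by
  unfold heatKernel; split_ifs <;> positivity

theorem continuous_heatKernel {t : ℝ} (ht : 0 < t) :
    Continuous (heatKernel t : Space d → ℝ) := by
  rw [show (heatKernel t : Space d → ℝ) = fun x => _ from funext (heatKernel_of_pos ht)]
  fun_prop

/-- Both signs of the phase are needed: centring the kernel at `a` reflects the variable and turns i
into -i. Only c² enters the Gaussian integral. -/
theorem integral_cexp_mul_heatKernel {t : ℝ} (ht : 0 < t) {c : ℂ} (hc : c ^ 2 = -1)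
    (ξ : Space d) :
    ∫ x : Space d, Complex.exp (c * ((inner ℝ x ξ : ℝ) : ℂ)) * (heatKernel t x : ℂ) =
      (Real.exp (-t * ‖ξ‖ ^ 2) : ℂ) := by
  have hb : 0 < ((1 / (4 * t) : ℝ) : ℂ).re := by
    rw [Complex.ofReal_re]; positivity
  have key := GaussianFourier.integral_cexp_neg_mul_sq_norm_add hb c ξ
  have h1 : ∀ x : Space d, Complex.exp (c * ((inner ℝ x ξ : ℝ) : ℂ)) * (heatKernel t x : ℂ) =
      (((4 * Real.pi * t) ^ (-(d : ℝ) / 2) : ℝ) : ℂ) *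
      Complex.exp (-((1 / (4 * t) : ℝ) : ℂ) * ‖x‖ ^ 2 + c * (inner ℝ ξ x : ℝ)) := by
    intro x
    rw [heatKernel_of_pos ht, Complex.exp_add, real_inner_comm]
    push_cast
    ring
  simp_rw [h1]
  rw [integral_const_mul, key, ← mul_assoc]
  have h2 : ((Real.pi : ℂ) / ((1 / (4 * t) : ℝ) : ℂ)) ^ ((Module.finrank ℝ (Space d) : ℂ) / 2) =
      (((4 * Real.pi * t) ^ ((d : ℝ) / 2) : ℝ) : ℂ) := by
    rw [Complex.ofReal_cpow (by positivity), finrank_euclideanSpace_fin]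
    congr 1
    · push_cast; field_simp
    · push_cast; rfl
  rw [h2, ← Complex.ofReal_mul, ← Real.rpow_add (by positivity),
    show -(d : ℝ) / 2 + d / 2 = 0 by ring, Real.rpow_zero, Complex.ofReal_one, one_mul, hc]
  rw [Complex.ofReal_exp]
  congr 1
  push_cast
  have : (t : ℂ) ≠ 0 := by exact_mod_cast ht.ne'
  field_simp

theorem integrable_heatKernel {t : ℝ} (ht : 0 < t) :
    Integrable (heatKernel t : Space d → ℝ) := by
  have hb : 0 < ((1 / (4 * t) : ℝ) : ℂ).re := by
    rw [Complex.ofReal_re]; positivity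
  have := (GaussianFourier.integrable_cexp_neg_mul_sq_norm_add hb 0 (0 : Space d)).re.const_mul
    ((4 * Real.pi * t) ^ (-(d : ℝ) / 2))
  refine this.congr (ae_of_all _ fun x => ?_)
  simp only [heatKernel_of_pos ht]
  congr 1
  have : (-((1 / (4 * t) : ℝ) : ℂ) * (‖x‖ : ℂ) ^ 2 + 0 * ((inner ℝ (0 : Space d) x : ℝ) : ℂ)) =
      ((-(1 / (4 * t)) * ‖x‖ ^ 2 : ℝ) : ℂ) := by push_cast; ring
  rw [this, ← Complex.ofReal_exp]
  rfl

theorem integral_heatKernel {t : ℝ} (ht : 0 < t) : ∫ x : Space d, heatKernel t x = 1 := by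
  have := integral_cexp_mul_heatKernel ht Complex.I_sq (0 : Space d)
  simp only [inner_zero_right, Complex.ofReal_zero, mul_zero, Complex.exp_zero, one_mul,
    norm_zero, ne_eq, OfNat.ofNat_ne_zero, not_false_eq_true, zero_pow, Real.exp_zero,
    Complex.ofReal_one] at this
  rw [integral_complex_ofReal] at this
  exact_mod_cast this

/-- The Fourier transform of the heat kernel centred at `a`. -/
theorem fourierTransform_heatKernel {t : ℝ} (ht : 0 < t) (a ξ : Space d) :
    fourierTransform (fun x => (heatKernel t (a - x) : ℂ)) ξ =
      Complex.exp (Complex.I * ((inner ℝ a ξ : ℝ) : ℂ)) * (Real.exp (-t * ‖ξ‖ ^ 2) : ℂ) := by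
  rw [fourierTransform,
    ← integral_cexp_mul_heatKernel ht (c := -Complex.I) (by simp) ξ, ← integral_const_mul,
    ← integral_sub_left_eq_self _ volume a]
  congr 1
  ext x
  rw [sub_sub_cancel, inner_sub_left, ← mul_assoc, ← Complex.exp_add]
  congr 2
  push_cast
  ring

section Tempered

variable {Λ μ : Measure (Space d)}

theorem integrable_gaussian_of_temperate (hΛ : Λ.HasTemperateGrowth) {b : ℝ} (hb : 0 < b)
    (a : Space d) : Integrable (fun x => Real.exp (-b * ‖a - x‖ ^ 2)) Λ := by
  obtain ⟨φ, hφ⟩ := exists_schwartzMap_gaussian hb a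
  refine (φ.integrable (μ := Λ)).re.congr (ae_of_all _ fun x => ?_)
  simp only [hφ]
  exact Complex.ofReal_re _

/-- A Gaussian is integrable and bounded below on a compact set. The point is σ-finiteness, which
Tonelli's theorem requires throughout. -/
theorem isFiniteMeasureOnCompacts_of_temperate (hΛ : Λ.HasTemperateGrowth) :
    IsFiniteMeasureOnCompacts Λ := by
  refine ⟨fun K hK => ?_⟩
  have hint := integrable_gaussian_of_temperate hΛ one_pos (0 : Space d)
  obtain ⟨R, hR⟩ := hK.isBounded.exists_norm_le
  have hfin := hint.measure_norm_ge_lt_top (ε := Real.exp (-R ^ 2)) (by positivity)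
  refine lt_of_le_of_lt (measure_mono fun x hx => ?_) hfin
  simp only [Set.mem_ofPred_eq, zero_sub, norm_neg, Real.norm_eq_abs, Real.abs_exp]
  apply Real.exp_le_exp.2
  have := hR x hx
  nlinarith [norm_nonneg x]

theorem sigmaFinite_of_temperate (hΛ : Λ.HasTemperateGrowth) : SigmaFinite Λ := by
  have := isFiniteMeasureOnCompacts_of_temperate hΛ
  infer_instance

/-- The heat kernel smoothing of `Λ` is given by the damped spectral integral. -/
theorem IsSpectralMeasure.integral_heatKernel (h : IsSpectralMeasure Λ μ) {t : ℝ} (ht : 0 < t)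
    (a : Space d) :
    ((∫ v, heatKernel t (a - v) ∂Λ : ℝ) : ℂ) = (((2 * Real.pi) ^ d)⁻¹ : ℂ) *
      ∫ ξ, Complex.exp (Complex.I * ((inner ℝ a ξ : ℝ) : ℂ)) *
        (Real.exp (-t * ‖ξ‖ ^ 2) : ℂ) ∂μ := by
  obtain ⟨φ, hφ⟩ := exists_schwartzMap_gaussian (b := 1 / (4 * t)) (by positivity) a
  have key := h.integral_eq ((((4 * Real.pi * t) ^ (-(d : ℝ) / 2) : ℝ) : ℂ) • φ)
  have e : ∀ x, ((((4 * Real.pi * t) ^ (-(d : ℝ) / 2) : ℝ) : ℂ) • φ) x =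
      (heatKernel t (a - x) : ℂ) := by
    intro x
    rw [smul_apply, hφ, heatKernel_of_pos ht, smul_eq_mul, Complex.ofReal_mul]
  rw [funext e] at key
  rw [integral_complex_ofReal] at key
  rw [key]
  congr 1
  exact integral_congr_ae (ae_of_all _ fun ξ => fourierTransform_heatKernel ht a ξ)

end Tempered

end

/-! ### Quadratic forms of integral transforms; scaling; correlations of bounded functions. -/

section

open scoped ENNReal ComplexConjugate

section Fubini

variable {X Y : Type*} [MeasurableSpace X] [MeasurableSpace Y] {ρ : Measure X} [SFinite ρ]
  {m : Measure Y} [IsFiniteMeasure m] {k : X → Y → ℂ} {f g : X → ℂ}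

/-- The sesquilinear form of an integral transform with bounded kernel, as a double integral. -/
theorem integral_transform_mul_conj (hk : Measurable (Function.uncurry k))
    (hk1 : ∀ x y, ‖k x y‖ ≤ 1) (hf : Integrable f ρ) (hg : Integrable g ρ) :
    ∫ y, (∫ x, k x y * f x ∂ρ) * conj (∫ x, k x y * g x ∂ρ) ∂m =
      ∫ p, f p.1 * conj (g p.2) * (∫ y, k p.1 y * conj (k p.2 y) ∂m) ∂(ρ.prod ρ) := by
  have h1 : ∀ y, (∫ x, k x y * f x ∂ρ) * conj (∫ x, k x y * g x ∂ρ) =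
      ∫ p, (k p.1 y * f p.1) * conj (k p.2 y * g p.2) ∂(ρ.prod ρ) := by
    intro y
    rw [← integral_conj, ← integral_prod_mul]
  simp_rw [h1]
  have hprod : Integrable (fun p : X × X => f p.1 * g p.2) (ρ.prod ρ) := hf.mul_prod hg
  have hmeas : AEStronglyMeasurable (fun q : Y × X × X =>
      (k q.2.1 q.1 * f q.2.1) * conj (k q.2.2 q.1 * g q.2.2)) (m.prod (ρ.prod ρ)) := by
    have hf' : AEStronglyMeasurable (fun q : Y × X × X => f q.2.1) (m.prod (ρ.prod ρ)) :=
      (hf.aestronglyMeasurable.comp_fst (ν := ρ)).comp_snd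
    have hg' : AEStronglyMeasurable (fun q : Y × X × X => g q.2.2) (m.prod (ρ.prod ρ)) :=
      (hg.aestronglyMeasurable.comp_snd (μ := ρ)).comp_snd
    have k1 : Measurable fun q : Y × X × X => k q.2.1 q.1 :=
      hk.comp (measurable_snd.fst.prodMk measurable_fst)
    have k2 : Measurable fun q : Y × X × X => k q.2.2 q.1 :=
      hk.comp (measurable_snd.snd.prodMk measurable_fst)
    exact (k1.aestronglyMeasurable.mul hf').mul
      (Complex.continuous_conj.comp_aestronglyMeasurable (k2.aestronglyMeasurable.mul hg'))
  rw [integral_integral_swap (f := fun (y : Y) (p : X × X) =>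
      (k p.1 y * f p.1) * conj (k p.2 y * g p.2))]
  · refine integral_congr_ae (ae_of_all _ fun p => ?_)
    simp only
    rw [← integral_const_mul]
    congr 1
    ext y
    rw [map_mul]
    ring
  · refine Integrable.mono' (hprod.norm.comp_snd m) hmeas (ae_of_all _ fun q => ?_)
    simp only [Function.uncurry, norm_mul, RCLike.norm_conj]
    have a1 := hk1 q.2.1 q.1
    have a2 := hk1 q.2.2 q.1
    calc ‖k q.2.1 q.1‖ * ‖f q.2.1‖ * (‖k q.2.2 q.1‖ * ‖g q.2.2‖)
        ≤ 1 * ‖f q.2.1‖ * (1 * ‖g q.2.2‖) := by gcongr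
      _ = _ := by ring

/-- The case f = g of the preceding identity, with absolute values inside the double integral.
Absolute values are harmless because the energy in the definition of the Wiener integral carries
them too. -/
theorem lintegral_transform_sq_le (hk : Measurable (Function.uncurry k))
    (hk1 : ∀ x y, ‖k x y‖ ≤ 1) (hf : Integrable f ρ) :
    ∫⁻ y, ‖∫ x, k x y * f x ∂ρ‖ₑ ^ 2 ∂m ≤
      ∫⁻ p, ‖f p.1‖ₑ * ‖f p.2‖ₑ * ‖∫ y, k p.1 y * conj (k p.2 y) ∂m‖ₑ ∂(ρ.prod ρ) := by
  have hF : AEStronglyMeasurable (fun y => ∫ x, k x y * f x ∂ρ) m := by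
    have : AEStronglyMeasurable (fun q : Y × X => k q.2 q.1 * f q.2) (m.prod ρ) :=
      (hk.comp measurable_swap).aestronglyMeasurable.mul hf.aestronglyMeasurable.comp_snd
    exact this.integral_prod_right'
  have hb : ∀ y, ‖∫ x, k x y * f x ∂ρ‖ ≤ ∫ x, ‖f x‖ ∂ρ := fun y =>
    norm_integral_le_of_norm_le hf.norm (ae_of_all _ fun x => by
      rw [norm_mul]
      exact mul_le_of_le_one_left (norm_nonneg _) (hk1 x y))
  have hsq : Integrable (fun y => ‖∫ x, k x y * f x ∂ρ‖ ^ 2) m := by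
    refine Integrable.of_bound (hF.norm.pow 2) ((∫ x, ‖f x‖ ∂ρ) ^ 2) (ae_of_all _ fun y => ?_)
    rw [Real.norm_of_nonneg (by positivity)]
    exact pow_le_pow_left₀ (norm_nonneg _) (hb y) 2
  have key := integral_transform_mul_conj (m := m) hk hk1 hf hf
  have h2 : ∫ y, (∫ x, k x y * f x ∂ρ) * conj (∫ x, k x y * f x ∂ρ) ∂m =
      ((∫ y, ‖∫ x, k x y * f x ∂ρ‖ ^ 2 ∂m : ℝ) : ℂ) := by
    rw [← integral_complex_ofReal]
    congr 1
    ext y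
    rw [RCLike.mul_conj]
    push_cast
    rfl
  have h3 : ∫⁻ y, ‖∫ x, k x y * f x ∂ρ‖ₑ ^ 2 ∂m =
      ENNReal.ofReal (∫ y, ‖∫ x, k x y * f x ∂ρ‖ ^ 2 ∂m) := by
    rw [ofReal_integral_eq_lintegral_ofReal hsq (ae_of_all _ fun y => by positivity)]
    congr 1
    ext y
    rw [ENNReal.ofReal_pow (norm_nonneg _), ofReal_norm]
  rw [h3]
  have h4 : ENNReal.ofReal (∫ y, ‖∫ x, k x y * f x ∂ρ‖ ^ 2 ∂m) =
      ‖((∫ y, ‖∫ x, k x y * f x ∂ρ‖ ^ 2 ∂m : ℝ) : ℂ)‖ₑ := by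
    rw [← ofReal_norm, Complex.norm_real, Real.norm_of_nonneg]
    exact integral_nonneg fun y => by positivity
  rw [h4, ← h2, key]
  refine (enorm_integral_le_lintegral_enorm _).trans (lintegral_mono fun p => ?_)
  rw [enorm_mul, enorm_mul, ← ofReal_norm (conj (f p.2)), RCLike.norm_conj,
    ofReal_norm]

end Fubini

variable {d : ℕ}

theorem lintegral_comp_smul_space {r : ℝ} (hr : r ≠ 0) (f : Space d → ℝ≥0∞) :
    ∫⁻ x, f (r • x) = ENNReal.ofReal |(r ^ d)⁻¹| * ∫⁻ x, f x := by
  have h := Measure.map_addHaar_smul (volume : Measure (Space d)) hr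
  rw [finrank_euclideanSpace_fin] at h
  have h2 := lintegral_map_equiv f (Homeomorph.smulOfNeZero r hr (α := Space d)).toMeasurableEquiv
    (μ := volume)
  have h3 : Measure.map ⇑(Homeomorph.smulOfNeZero r hr (α := Space d)).toMeasurableEquiv volume =
      Measure.map (fun x : Space d => r • x) volume := rfl
  have h4 : ∀ a, (Homeomorph.smulOfNeZero r hr (α := Space d)).toMeasurableEquiv a = r • a :=
    fun a => rfl
  simp only [h3, h4] at h2
  rw [← h2, show (fun x : Space d => r • x) = (r • ·) from rfl, h, lintegral_smul_measure,
    smul_eq_mul]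

/-- Parabolic scaling of the heat kernel. -/
theorem lintegral_heatKernel_mul {t : ℝ} (ht : 0 < t) (F : Space d → ℝ≥0∞) :
    ∫⁻ w, ENNReal.ofReal (heatKernel t w) * F w =
      ∫⁻ w, ENNReal.ofReal (heatKernel 1 w) * F (√t • w) := by
  have hs : 0 < √t := Real.sqrt_pos.2 ht
  have h1 : ∀ w : Space d, heatKernel t (√t • w) = (√t ^ d)⁻¹ * heatKernel 1 w := by
    intro w
    rw [heatKernel_of_pos ht, heatKernel_of_pos one_pos, norm_smul, Real.norm_of_nonneg hs.le,
      mul_pow, Real.sq_sqrt ht.le, Real.mul_rpow (by positivity) ht.le]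
    have : t ^ (-(d : ℝ) / 2) = (√t ^ d)⁻¹ := by
      rw [Real.sqrt_eq_rpow, ← Real.rpow_natCast, ← Real.rpow_mul ht.le, ← Real.rpow_neg ht.le]
      congr 1; ring
    rw [this]
    have h2 : -(1 / (4 * t)) * (t * ‖w‖ ^ 2) = -(1 / 4) * ‖w‖ ^ 2 := by field_simp
    rw [h2]; simp only [mul_one]; ring
  have h2 := lintegral_comp_smul_space hs.ne' (fun w => ENNReal.ofReal (heatKernel t w) * F w)
  simp_rw [h1] at h2
  have hpos : 0 < (√t ^ d)⁻¹ := by positivity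
  rw [abs_of_pos hpos] at h2
  simp_rw [ENNReal.ofReal_mul hpos.le, mul_assoc] at h2
  rw [lintegral_const_mul' _ _ ENNReal.ofReal_ne_top] at h2
  exact ((ENNReal.mul_right_inj (by simpa using hpos) ENNReal.ofReal_ne_top).1 h2).symm

/-- A non-negative bounded measurable function supported in a ball. -/
structure IsBddBump (K R : ℝ) (f : Space d → ℝ) : Prop where
  measurable : Measurable f
  nonneg : ∀ x, 0 ≤ f x
  le : ∀ x, f x ≤ K
  support : ∀ x, R < ‖x‖ → f x = 0

namespace IsBddBump

variable {K R : ℝ} {f g : Space d → ℝ}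

theorem memLp (hf : IsBddBump K R f) (p : ℝ≥0∞) : MemLp f p volume := by
  have hball : f = (Metric.closedBall (0 : Space d) R).indicator f := by
    ext x
    by_cases hx : x ∈ Metric.closedBall (0 : Space d) R
    · rw [Set.indicator_of_mem hx]
    · rw [Set.indicator_of_notMem hx]
      exact hf.support x (by simpa using hx)
  rw [hball, memLp_indicator_iff_restrict measurableSet_closedBall]
  have : IsFiniteMeasure ((volume : Measure (Space d)).restrict (Metric.closedBall 0 R)) :=
    ⟨by simpa using measure_closedBall_lt_top⟩
  refine MemLp.of_bound hf.measurable.aestronglyMeasurable K (ae_of_all _ fun x => ?_)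
  rw [Real.norm_of_nonneg (hf.nonneg x)]
  exact hf.le x

theorem integrable (hf : IsBddBump K R f) : Integrable f := memLp_one_iff_integrable.1 (hf.memLp 1)

/-- The correlation of two bounded compactly supported functions is continuous. -/
theorem continuous_corr (hf : IsBddBump K R f) (hg : IsBddBump K R g) :
    Continuous fun a => ∫ z, f z * g (z - a) := by
  have hmp : ∀ a : Space d, MeasurePreserving (fun z : Space d => z - a) :=
    fun a => measurePreserving_sub_right volume a
  let T : Space d → C(Space d, Space d) := fun a => ⟨fun z => z - a, by fun_prop⟩
  have hT : Continuous T := by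
    apply ContinuousMap.continuous_of_continuous_uncurry
    change Continuous fun p : Space d × Space d => p.2 - p.1
    fun_prop
  let G := (hg.memLp 2).toLp g
  let F := (hf.memLp 2).toLp f
  -- Translation acts continuously on L², and the correlation is an L² inner product with a
  -- translate.
  have hcont : Continuous fun a => Lp.compMeasurePreserving (T a) (hmp a) G :=
    Continuous.compMeasurePreservingLp continuous_const hT (fun a => hmp a) (by simp)
  have hin : Continuous fun a =>
      (inner ℝ (Lp.compMeasurePreserving (T a) (hmp a) G) F : ℝ) :=
    hcont.inner continuous_const
  refine hin.congr fun a => ?_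
  rw [L2.inner_def]
  refine integral_congr_ae ?_
  have h1 := Lp.coeFn_compMeasurePreserving G (hmp a)
  have h2 : (G : Space d → ℝ) ∘ (fun z : Space d => z - a) =ᵐ[volume]
      g ∘ (fun z : Space d => z - a) :=
    (hmp a).quasiMeasurePreserving.ae_eq_comp (hg.memLp 2).coeFn_toLp
  filter_upwards [h1, h2, (hf.memLp 2).coeFn_toLp] with z hz1 hz2 hz3
  have hz1' : (Lp.compMeasurePreserving (T a) (hmp a) G) z = g (z - a) := by
    rw [← Function.comp_apply (f := g) (g := fun z : Space d => z - a), ← hz2, ← hz1]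
    rfl
  rw [hz1', show (F : Space d → ℝ) z = f z from hz3]
  simp

end IsBddBump

end

/-! ### Heat kernel smoothing of the spatial covariance. -/

section

open scoped ENNReal ComplexConjugate

variable {d : ℕ} {Λ μ : Measure (Space d)}

/-- The spatial covariance form of the noise on non-negative functions. -/
def covForm (Λ : Measure (Space d)) (f g : Space d → ℝ) : ℝ≥0∞ :=
  ∫⁻ z, ∫⁻ v, ENNReal.ofReal (f z) * ENNReal.ofReal (g (z - v)) ∂Λ

/-- The spatial covariance form smoothed by the heat kernel. -/
def smoothForm (Λ : Measure (Space d)) (t : ℝ) (f g : Space d → ℝ) : ℝ≥0∞ :=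
  ∫⁻ z, ∫⁻ z', ENNReal.ofReal (f z) * ENNReal.ofReal (g z') *
    ∫⁻ v, ENNReal.ofReal (heatKernel t (z - z' - v)) ∂Λ

/-- The correlation of two non-negative functions. -/
def corr (f g : Space d → ℝ) (a : Space d) : ℝ≥0∞ :=
  ∫⁻ z, ENNReal.ofReal (f z) * ENNReal.ofReal (g (z - a))

theorem covForm_eq [SFinite Λ] {f g : Space d → ℝ} (hf : Measurable f) (hg : Measurable g) :
    covForm Λ f g = ∫⁻ v, corr f g v ∂Λ := by
  unfold covForm corr
  rw [lintegral_lintegral_swap]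
  fun_prop

/-- The substitution z' = z - v - w turns the smoothing of Λ into an average of the correlation over
shifts √t·w with w of standard heat kernel law. The parameter t then sits only inside a continuous
function, ready for t → 0. -/
theorem smoothForm_eq [SFinite Λ] {t : ℝ} (ht : 0 < t) {f g : Space d → ℝ} (hf : Measurable f)
    (hg : Measurable g) :
    smoothForm Λ t f g =
      ∫⁻ v, (∫⁻ w, ENNReal.ofReal (heatKernel 1 w) * corr f g (v + √t • w)) ∂Λ := by
  have hγ : Measurable (heatKernel t : Space d → ℝ) := (continuous_heatKernel ht).measurable
  have h1 : ∀ z, ∫⁻ z', ENNReal.ofReal (f z) * ENNReal.ofReal (g z') *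
        ∫⁻ v, ENNReal.ofReal (heatKernel t (z - z' - v)) ∂Λ =
      ∫⁻ v, (∫⁻ w, ENNReal.ofReal (heatKernel t w) *
        (ENNReal.ofReal (f z) * ENNReal.ofReal (g (z - (v + w))))) ∂Λ := by
    intro z
    have h2 : ∀ z', ENNReal.ofReal (f z) * ENNReal.ofReal (g z') *
        ∫⁻ v, ENNReal.ofReal (heatKernel t (z - z' - v)) ∂Λ =
        ∫⁻ v, ENNReal.ofReal (f z) * ENNReal.ofReal (g z') *
          ENNReal.ofReal (heatKernel t (z - z' - v)) ∂Λ := by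
      intro z'
      rw [lintegral_const_mul' _ _ (by finiteness)]
    simp_rw [h2]
    rw [lintegral_lintegral_swap (by fun_prop)]
    refine lintegral_congr fun v => ?_
    rw [← lintegral_sub_left_eq_self _ (z - v)]
    refine lintegral_congr fun w => ?_
    rw [show z - (z - v - w) - v = w by abel, show z - v - w = z - (v + w) by abel]
    ring
  unfold smoothForm
  simp_rw [h1]
  rw [lintegral_lintegral_swap]
  · refine lintegral_congr fun v => ?_
    rw [lintegral_lintegral_swap (by fun_prop), ← lintegral_heatKernel_mul ht
      (fun w => corr f g (v + w))]
    refine lintegral_congr fun w => ?_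
    rw [lintegral_const_mul' _ _ ENNReal.ofReal_ne_top, corr]
  · refine Measurable.aemeasurable ?_
    refine Measurable.lintegral_prod_right' (f := fun q : (Space d × Space d) × Space d =>
      ENNReal.ofReal (heatKernel t q.2) *
        (ENNReal.ofReal (f q.1.1) * ENNReal.ofReal (g (q.1.1 - (q.1.2 + q.2))))) ?_
    fun_prop

namespace IsBddBump

variable {K R : ℝ} {f g : Space d → ℝ}

theorem integrable_mul_sub (hf : IsBddBump K R f) (hg : IsBddBump K R g) (a : Space d) :
    Integrable fun z => f z * g (z - a) := by
  refine (hf.integrable.mul_const K).mono'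
    (hf.measurable.mul (hg.measurable.comp (measurable_id.sub_const a))).aestronglyMeasurable
    (ae_of_all _ fun z => ?_)
  rw [Real.norm_of_nonneg (mul_nonneg (hf.nonneg _) (hg.nonneg _))]
  exact mul_le_mul_of_nonneg_left (hg.le _) (hf.nonneg _)

theorem corr_eq (hf : IsBddBump K R f) (hg : IsBddBump K R g) (a : Space d) :
    corr f g a = ENNReal.ofReal (∫ z, f z * g (z - a)) := by
  rw [ofReal_integral_eq_lintegral_ofReal (hf.integrable_mul_sub hg a)
    (ae_of_all _ fun z => mul_nonneg (hf.nonneg _) (hg.nonneg _)), corr]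
  simp_rw [ENNReal.ofReal_mul (hf.nonneg _)]

theorem continuous_corr' (hf : IsBddBump K R f) (hg : IsBddBump K R g) :
    Continuous (corr f g) := by
  rw [show corr f g = fun a => _ from funext (hf.corr_eq hg)]
  exact ENNReal.continuous_ofReal.comp (hf.continuous_corr hg)

theorem corr_le (hf : IsBddBump K R f) (hg : IsBddBump K R g) (a : Space d) :
    corr f g a ≤ ENNReal.ofReal K * ENNReal.ofReal K *
      volume (Metric.closedBall (0 : Space d) R) := by
  calc corr f g a ≤ ∫⁻ z, (Metric.closedBall (0 : Space d) R).indicator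
        (fun _ => ENNReal.ofReal K * ENNReal.ofReal K) z := by
        refine lintegral_mono fun z => ?_
        by_cases hz : z ∈ Metric.closedBall (0 : Space d) R
        · rw [Set.indicator_of_mem hz]
          exact mul_le_mul' (ENNReal.ofReal_le_ofReal (hf.le _))
            (ENNReal.ofReal_le_ofReal (hg.le _))
        · simp [hf.support z (by simpa using hz)]
    _ = _ := by
        rw [lintegral_indicator measurableSet_closedBall, setLIntegral_const]

theorem corr_eq_zero (hf : IsBddBump K R f) (hg : IsBddBump K R g) {a : Space d}
    (ha : 2 * R < ‖a‖) : corr f g a = 0 := by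
  have : ∀ z, ENNReal.ofReal (f z) * ENNReal.ofReal (g (z - a)) = 0 := by
    intro z
    by_cases hz : R < ‖z‖
    · simp [hf.support z hz]
    · rw [hg.support (z - a)]
      · simp
      · have := norm_sub_norm_le a z
        rw [norm_sub_rev] at this
        linarith
  simp [corr, this]

end IsBddBump

/-- The Gaussian is split into two equal factors: one absorbs the polynomial, the other remains
integrable. -/
theorem lintegral_heatKernel_mul_pow_lt_top (b : ℝ) (hb : 0 ≤ b) (n : ℕ) :
    ∫⁻ w : Space d, ENNReal.ofReal (heatKernel 1 w) *
      ENNReal.ofReal ((1 + b + ‖w‖) ^ n) < ∞ := by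
  have hint := (integrable_gaussian_of_temperate (Λ := (volume : Measure (Space d)))
    inferInstance (b := 1 / 8) (by norm_num) 0)
  set C : ℝ := (4 * Real.pi * 1) ^ (-(d : ℝ) / 2) * ((1 + b) ^ n *
    ((2 / (1 / 8)) ^ n * n.factorial * Real.exp (1 / 8)))
  have hle : ∀ w : Space d, ENNReal.ofReal (heatKernel 1 w) *
      ENNReal.ofReal ((1 + b + ‖w‖) ^ n) ≤
      ENNReal.ofReal (C * Real.exp (-(1 / 8) * ‖0 - w‖ ^ 2)) := by
    intro w
    rw [← ENNReal.ofReal_mul (heatKernel_nonneg _ _)]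
    apply ENNReal.ofReal_le_ofReal
    rw [heatKernel_of_pos one_pos, zero_sub, norm_neg]
    have h1 := one_add_pow_mul_exp_le (b := 1 / 8) (by norm_num) n (norm_nonneg w)
    have h2 : (1 + b + ‖w‖) ^ n ≤ (1 + b) ^ n * (1 + ‖w‖) ^ n := by
      rw [← mul_pow]
      gcongr
      nlinarith [norm_nonneg w]
    have h3 : Real.exp (-(1 / (4 * 1)) * ‖w‖ ^ 2) =
        Real.exp (-(1 / 8) * ‖w‖ ^ 2) * Real.exp (-(1 / 8) * ‖w‖ ^ 2) := by
      rw [← Real.exp_add]; congr 1; ring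
    rw [h3]
    calc (4 * Real.pi * 1) ^ (-(d : ℝ) / 2) * (Real.exp (-(1 / 8) * ‖w‖ ^ 2) *
          Real.exp (-(1 / 8) * ‖w‖ ^ 2)) * (1 + b + ‖w‖) ^ n
        ≤ (4 * Real.pi * 1) ^ (-(d : ℝ) / 2) * (Real.exp (-(1 / 8) * ‖w‖ ^ 2) *
          Real.exp (-(1 / 8) * ‖w‖ ^ 2)) * ((1 + b) ^ n * (1 + ‖w‖) ^ n) := by gcongr
      _ = (4 * Real.pi * 1) ^ (-(d : ℝ) / 2) * ((1 + b) ^ n *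
          ((1 + ‖w‖) ^ n * Real.exp (-(1 / 8) * ‖w‖ ^ 2))) * Real.exp (-(1 / 8) * ‖w‖ ^ 2) := by
          ring
      _ ≤ _ := by simp only [C]; gcongr
  exact (lintegral_mono hle).trans_lt (hint.const_mul C).lintegral_lt_top

/-- The bound, uniform in the smoothing parameter, for smoothed correlations of bumps. -/
def smoothBound (K R : ℝ) (n : ℕ) (v w : Space d) : ℝ≥0∞ :=
  ENNReal.ofReal K * ENNReal.ofReal K * volume (Metric.closedBall (0 : Space d) R) *
    ENNReal.ofReal ((1 + ‖v‖) ^ (-(n : ℝ))) * ENNReal.ofReal ((1 + 2 * |R| + ‖w‖) ^ n)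

/-- Where the correlation is non-zero, t ≤ 1 forces |v| ≤ 2|R| + |w|. The two weights in the bound
then multiply to at least 1, so decay in v is bought with polynomial growth in w. -/
theorem IsBddBump.corr_add_le {K R : ℝ} {f g : Space d → ℝ} (hf : IsBddBump K R f)
    (hg : IsBddBump K R g) {t : ℝ} (ht1 : t ≤ 1) (n : ℕ) (v w : Space d) :
    corr f g (v + √t • w) ≤ smoothBound K R n v w := by
  by_cases h : 2 * R < ‖v + √t • w‖
  · rw [hf.corr_eq_zero hg h]; exact zero_le
  · have h1 : ‖v‖ ≤ 2 * |R| + ‖w‖ := by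
      have a1 : ‖v‖ ≤ ‖v + √t • w‖ + ‖√t • w‖ := by
        calc ‖v‖ = ‖(v + √t • w) - √t • w‖ := by congr 1; abel
          _ ≤ _ := norm_sub_le _ _
      have a2 : ‖√t • w‖ ≤ ‖w‖ := by
        rw [norm_smul, Real.norm_of_nonneg (Real.sqrt_nonneg _)]
        exact mul_le_of_le_one_left (norm_nonneg _) (Real.sqrt_le_one.2 ht1)
      have := le_abs_self R
      linarith
    have h2 : 1 ≤ ENNReal.ofReal ((1 + ‖v‖) ^ (-(n : ℝ))) *
        ENNReal.ofReal ((1 + 2 * |R| + ‖w‖) ^ n) := by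
      rw [← ENNReal.ofReal_mul (by positivity), ← ENNReal.ofReal_one]
      apply ENNReal.ofReal_le_ofReal
      rw [Real.rpow_neg (by positivity), Real.rpow_natCast, inv_mul_eq_div,
        one_le_div₀ (by positivity)]
      exact pow_le_pow_left₀ (by positivity) (by linarith) n
    calc corr f g (v + √t • w) ≤ ENNReal.ofReal K * ENNReal.ofReal K *
          volume (Metric.closedBall (0 : Space d) R) * 1 := by
          rw [mul_one]; exact hf.corr_le hg _
      _ ≤ _ := by
          rw [smoothBound, mul_assoc _ (ENNReal.ofReal ((1 + ‖v‖) ^ (-(n : ℝ))))]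
          gcongr

/-- The exponent n is the one for which (1+|v|)^{-n} is Λ-integrable; the growth in w is paid for by
the heat kernel. This provides the dominating function for every limit t → 0. -/
theorem exists_lintegral_smoothBound_ne_top (hΛ : Λ.HasTemperateGrowth) (K R : ℝ) :
    ∃ n : ℕ, (∀ v : Space d, ∫⁻ w, ENNReal.ofReal (heatKernel 1 w) * smoothBound K R n v w ≠ ∞) ∧
      ∫⁻ v, (∫⁻ w, ENNReal.ofReal (heatKernel 1 w) * smoothBound K R n v w) ∂Λ ≠ ∞ := by
  obtain ⟨n, hn⟩ := hΛ.exists_integrable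
  have h1 := lintegral_heatKernel_mul_pow_lt_top (d := d) (2 * |R|) (by positivity) n
  have hb : ENNReal.ofReal K * ENNReal.ofReal K *
      volume (Metric.closedBall (0 : Space d) R) ≠ ∞ :=
    ENNReal.mul_ne_top (by finiteness) measure_closedBall_lt_top.ne
  have h2 : ∀ v : Space d, ∫⁻ w, ENNReal.ofReal (heatKernel 1 w) * smoothBound K R n v w =
      ENNReal.ofReal K * ENNReal.ofReal K * volume (Metric.closedBall (0 : Space d) R) *
        (∫⁻ w : Space d, ENNReal.ofReal (heatKernel 1 w) *
          ENNReal.ofReal ((1 + 2 * |R| + ‖w‖) ^ n)) *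
        ENNReal.ofReal ((1 + ‖v‖) ^ (-(n : ℝ))) := by
    intro v
    rw [mul_right_comm, ← lintegral_const_mul' _ _ (ENNReal.mul_ne_top hb ENNReal.ofReal_ne_top)]
    refine lintegral_congr fun w => ?_
    rw [smoothBound]; ring
  have hc := ENNReal.mul_ne_top hb h1.ne
  refine ⟨n, fun v => ?_, ?_⟩
  · rw [h2]; exact ENNReal.mul_ne_top hc ENNReal.ofReal_ne_top
  · simp_rw [h2]
    rw [lintegral_const_mul' _ _ hc]
    exact ENNReal.mul_ne_top hc hn.lintegral_lt_top.ne

theorem exists_smoothForm_le (hΛ : Λ.HasTemperateGrowth) (K R : ℝ) :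
    ∃ C : ℝ≥0∞, C ≠ ∞ ∧ ∀ f g, IsBddBump K R f → IsBddBump K R g → ∀ t, 0 < t → t ≤ 1 →
      smoothForm Λ t f g ≤ C := by
  obtain ⟨n, -, hn⟩ := exists_lintegral_smoothBound_ne_top hΛ K R
  have := sigmaFinite_of_temperate hΛ
  refine ⟨_, hn, fun f g hf hg t ht ht1 => ?_⟩
  rw [smoothForm_eq ht hf.measurable hg.measurable]
  gcongr with v w
  exact hf.corr_add_le hg ht1 n v w

/-- The smoothed covariance forms converge to the covariance form. -/
theorem tendsto_smoothForm (hΛ : Λ.HasTemperateGrowth) {K R : ℝ} {f g : Space d → ℝ}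
    (hf : IsBddBump K R f) (hg : IsBddBump K R g) :
    Tendsto (fun n : ℕ => smoothForm Λ (1 / (n + 1)) f g) atTop (𝓝 (covForm Λ f g)) := by
  obtain ⟨N, hN1, hN⟩ := exists_lintegral_smoothBound_ne_top hΛ K R
  have := sigmaFinite_of_temperate hΛ
  have hpos : ∀ n : ℕ, (0 : ℝ) < 1 / (n + 1) := fun n => by positivity
  have hle : ∀ n : ℕ, (1 : ℝ) / (n + 1) ≤ 1 := fun n => by
    rw [div_le_one (by positivity)]; linarith [Nat.cast_nonneg (α := ℝ) n]
  simp_rw [fun n : ℕ => smoothForm_eq (Λ := Λ) (hpos n) hf.measurable hg.measurable]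
  rw [covForm_eq hf.measurable hg.measurable]
  have hcorr := hf.continuous_corr' hg
  have hγ : Measurable (heatKernel 1 : Space d → ℝ) := (continuous_heatKernel one_pos).measurable
  have hsq : Tendsto (fun n : ℕ => √((1 : ℝ) / (n + 1))) atTop (𝓝 0) := by
    rw [← Real.sqrt_zero]
    exact (Real.continuous_sqrt.tendsto 0).comp (tendsto_one_div_add_atTop_nhds_zero_nat (𝕜 := ℝ))
  refine tendsto_lintegral_of_dominated_convergence _ (fun n => ?_)
    (fun n => ae_of_all _ fun v => lintegral_mono fun w => mul_le_mul_right
      (hf.corr_add_le hg (hle n) N v w) _) hN (ae_of_all _ fun v => ?_)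
  · refine Measurable.lintegral_prod_right' (f := fun q : Space d × Space d =>
      ENNReal.ofReal (heatKernel 1 q.2) * corr f g (q.1 + √((1 : ℝ) / (n + 1)) • q.2)) ?_
    have := hcorr.measurable
    fun_prop
  · have h1 : corr f g v = ∫⁻ w : Space d, ENNReal.ofReal (heatKernel 1 w) * corr f g v := by
      rw [lintegral_mul_const _ (by fun_prop), ← ofReal_integral_eq_lintegral_ofReal
        (integrable_heatKernel one_pos) (ae_of_all _ fun w => heatKernel_nonneg _ _),
        integral_heatKernel one_pos]
      simp
    rw [h1]
    refine tendsto_lintegral_of_dominated_convergence _ (fun n => ?_)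
      (fun n => ae_of_all _ fun w => mul_le_mul_right
        (hf.corr_add_le hg (hle n) N v w) _) (hN1 v) (ae_of_all _ fun w => ?_)
    · have := hcorr.measurable
      fun_prop
    · refine ENNReal.Tendsto.const_mul ?_ (Or.inr ENNReal.ofReal_ne_top)
      have h2 : Tendsto (fun n : ℕ => v + √((1 : ℝ) / (n + 1)) • w) atTop (𝓝 v) := by
        simpa using tendsto_const_nhds.add (hsq.smul_const w)
      exact (hcorr.tendsto v).comp h2

end

/-! ### Parseval's identity for the spatial covariance. -/

section

open scoped ENNReal ComplexConjugate

variable {d : ℕ} {Λ μ : Measure (Space d)}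

/-- The spectral measure damped by a Gaussian. -/
def damped (μ : Measure (Space d)) (t : ℝ) : Measure (Space d) :=
  μ.withDensity fun ξ => ENNReal.ofReal (Real.exp (-t * ‖ξ‖ ^ 2))

theorem isFiniteMeasure_damped (hμ : μ.HasTemperateGrowth) {t : ℝ} (ht : 0 < t) :
    IsFiniteMeasure (damped μ t) := by
  have := integrable_gaussian_of_temperate hμ ht 0
  simp only [zero_sub, norm_neg] at this
  exact isFiniteMeasure_withDensity_ofReal this.2

theorem integral_damped (t : ℝ) (F : Space d → ℂ) :
    ∫ ξ, F ξ ∂(damped μ t) = ∫ ξ, F ξ * (Real.exp (-t * ‖ξ‖ ^ 2) : ℂ) ∂μ := by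
  rw [damped, integral_withDensity_eq_integral_toReal_smul (by fun_prop)
    (ae_of_all _ fun _ => ENNReal.ofReal_lt_top)]
  refine integral_congr_ae (ae_of_all _ fun ξ => ?_)
  simp only
  rw [ENNReal.toReal_ofReal (Real.exp_pos _).le, Complex.real_smul, mul_comm]

/-- The character `e^{i x·ξ}`. -/
def spaceChar (x ξ : Space d) : ℂ := Complex.exp (Complex.I * ((inner ℝ x ξ : ℝ) : ℂ))

theorem continuous_spaceChar :
    Continuous (Function.uncurry (spaceChar : Space d → Space d → ℂ)) := by
  unfold spaceChar Function.uncurry; fun_prop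

theorem norm_spaceChar (x ξ : Space d) : ‖spaceChar x ξ‖ = 1 := by
  rw [spaceChar, mul_comm, Complex.norm_exp_ofReal_mul_I]

theorem spaceChar_mul_conj (x y ξ : Space d) :
    spaceChar x ξ * conj (spaceChar y ξ) = spaceChar (x - y) ξ := by
  simp only [spaceChar, ← Complex.exp_conj, ← Complex.exp_add, inner_sub_left]
  congr 1
  simp only [map_mul, Complex.conj_I, Complex.conj_ofReal, Complex.ofReal_sub]
  ring

/-- The characteristic function of the damped spectral measure is a smoothing of `Λ`. -/
theorem IsSpectralMeasure.integral_spaceChar (h : IsSpectralMeasure Λ μ) {t : ℝ} (ht : 0 < t)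
    (a : Space d) :
    ∫ ξ, spaceChar a ξ ∂(damped μ t) =
      (((2 * Real.pi) ^ d * ∫ v, heatKernel t (a - v) ∂Λ : ℝ) : ℂ) := by
  rw [integral_damped, Complex.ofReal_mul, h.integral_heatKernel ht, ← mul_assoc]
  push_cast
  rw [mul_inv_cancel₀ (pow_ne_zero _ (by simp [Real.pi_ne_zero])), one_mul]
  rfl

theorem lintegral_heatKernel_sub (hΛ : Λ.HasTemperateGrowth) {t : ℝ} (ht : 0 < t)
    (a : Space d) :
    ∫⁻ v, ENNReal.ofReal (heatKernel t (a - v)) ∂Λ =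
      ENNReal.ofReal (∫ v, heatKernel t (a - v) ∂Λ) := by
  rw [ofReal_integral_eq_lintegral_ofReal _ (ae_of_all _ fun v => heatKernel_nonneg _ _)]
  simp_rw [heatKernel_of_pos ht]
  exact (integrable_gaussian_of_temperate hΛ (by positivity) a).const_mul _

/-- The Fourier transform of a real function. -/
def hat (f : Space d → ℝ) (ξ : Space d) : ℂ := ∫ x, spaceChar x ξ * (f x : ℂ)

theorem measurable_hat {f : Space d → ℝ} (hf : Measurable f) : Measurable (hat f) := by
  have h : StronglyMeasurable fun q : Space d × Space d => spaceChar q.2 q.1 * (f q.2 : ℂ) := by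
    have := continuous_spaceChar.measurable.comp (measurable_swap (α := Space d) (β := Space d))
    exact (this.mul (Complex.measurable_ofReal.comp (hf.comp measurable_snd))).stronglyMeasurable
  exact h.integral_prod_right'.measurable

namespace IsBddBump

variable {K R : ℝ} {f g : Space d → ℝ}

/-- The damped measure is finite, so Fubini applies, and its characteristic function is (2π)^d times
the heat kernel smoothing of Λ. Everything on the right is non-negative, which permits the passage
to the extended form `smoothForm`. -/
theorem integral_hat_mul_conj_damped (h : IsSpectralMeasure Λ μ) (hf : IsBddBump K R f)
    (hg : IsBddBump K R g) {t : ℝ} (ht : 0 < t) :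
    ∫ ξ, hat f ξ * conj (hat g ξ) ∂(damped μ t) =
      (((2 * Real.pi) ^ d * (smoothForm Λ t f g).toReal : ℝ) : ℂ) := by
  have := isFiniteMeasure_damped h.temperate_spec ht
  have := sigmaFinite_of_temperate h.temperate_cov
  have hγ : Measurable (heatKernel t : Space d → ℝ) := (continuous_heatKernel ht).measurable
  have key := integral_transform_mul_conj (m := damped μ t) (k := spaceChar) (ρ := volume)
    (f := fun x => (f x : ℂ)) (g := fun x => (g x : ℂ))
    continuous_spaceChar.measurable (fun x y => (norm_spaceChar x y).le)
    hf.integrable.ofReal hg.integrable.ofReal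
  simp_rw [spaceChar_mul_conj, h.integral_spaceChar ht, Complex.conj_ofReal,
    ← Complex.ofReal_mul] at key
  change ∫ ξ, hat f ξ * conj (hat g ξ) ∂(damped μ t) = _ at key
  rw [key, integral_complex_ofReal]
  congr 1
  have hm : Measurable fun p : Space d × Space d => ∫ v, heatKernel t (p.1 - p.2 - v) ∂Λ := by
    have : StronglyMeasurable fun q : (Space d × Space d) × Space d =>
        heatKernel t (q.1.1 - q.1.2 - q.2) := by
      exact Measurable.stronglyMeasurable (by fun_prop)
    exact this.integral_prod_right'.measurable
  have hfm := hf.measurable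
  have hgm := hg.measurable
  have h0 : ∀ p : Space d × Space d, 0 ≤ f p.1 * g p.2 * ((2 * Real.pi) ^ d *
      ∫ v, heatKernel t (p.1 - p.2 - v) ∂Λ) := fun p =>
    mul_nonneg (mul_nonneg (hf.nonneg _) (hg.nonneg _))
      (mul_nonneg (by positivity) (integral_nonneg fun v => heatKernel_nonneg _ _))
  have hmeas : Measurable fun p : Space d × Space d => f p.1 * g p.2 * ((2 * Real.pi) ^ d *
      ∫ v, heatKernel t (p.1 - p.2 - v) ∂Λ) := by fun_prop
  rw [integral_eq_lintegral_of_nonneg_ae (ae_of_all _ h0) hmeas.aestronglyMeasurable,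
    lintegral_prod _ hmeas.ennreal_ofReal.aemeasurable]
  have h2 : ∀ p : Space d × Space d, ENNReal.ofReal (f p.1 * g p.2 * ((2 * Real.pi) ^ d *
      ∫ v, heatKernel t (p.1 - p.2 - v) ∂Λ)) = ENNReal.ofReal ((2 * Real.pi) ^ d) *
      (ENNReal.ofReal (f p.1) * ENNReal.ofReal (g p.2) *
        ∫⁻ v, ENNReal.ofReal (heatKernel t (p.1 - p.2 - v)) ∂Λ) := by
    intro p
    rw [lintegral_heatKernel_sub h.temperate_cov ht, ENNReal.ofReal_mul
      (mul_nonneg (hf.nonneg _) (hg.nonneg _)), ENNReal.ofReal_mul (hf.nonneg _),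
      ENNReal.ofReal_mul (by positivity)]
    ring
  simp_rw [fun x y => h2 (x, y)]
  simp_rw [lintegral_const_mul' _ _ ENNReal.ofReal_ne_top]
  rw [ENNReal.toReal_mul, ENNReal.toReal_ofReal (by positivity), smoothForm]

theorem enorm_hat_sq (ξ : Space d) :
    hat f ξ * conj (hat f ξ) = ((‖hat f ξ‖ ^ 2 : ℝ) : ℂ) := by
  rw [RCLike.mul_conj]; push_cast; rfl

theorem norm_hat_le (hf : IsBddBump K R f) (ξ : Space d) : ‖hat f ξ‖ ≤ ∫ x, ‖f x‖ := by
  refine norm_integral_le_of_norm_le hf.integrable.norm (ae_of_all _ fun x => ?_)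
  rw [norm_mul, norm_spaceChar, one_mul, Complex.norm_real]

theorem lintegral_hat_sq_damped (h : IsSpectralMeasure Λ μ) (hf : IsBddBump K R f)
    {t : ℝ} (ht : 0 < t) :
    ∫⁻ ξ, ENNReal.ofReal (‖hat f ξ‖ ^ 2) ∂(damped μ t) =
      ENNReal.ofReal ((2 * Real.pi) ^ d * (smoothForm Λ t f f).toReal) := by
  have := isFiniteMeasure_damped h.temperate_spec ht
  have key := integral_hat_mul_conj_damped h hf hf ht
  simp_rw [enorm_hat_sq, integral_complex_ofReal] at key
  rw [← Complex.ofReal_injective key, ofReal_integral_eq_lintegral_ofReal _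
    (ae_of_all _ fun ξ => by positivity)]
  refine Integrable.of_bound
    ((measurable_hat hf.measurable).norm.pow_const 2).aestronglyMeasurable
    ((∫ x, ‖f x‖) ^ 2) (ae_of_all _ fun ξ => ?_)
  rw [Real.norm_of_nonneg (by positivity)]
  exact pow_le_pow_left₀ (norm_nonneg _) (hf.norm_hat_le ξ) 2

theorem tendsto_exp_damping (c : ℝ) :
    Tendsto (fun n : ℕ => Real.exp (-(1 / ((n : ℝ) + 1)) * c)) atTop (𝓝 1) := by
  have h := ((tendsto_one_div_add_atTop_nhds_zero_nat (𝕜 := ℝ)).neg.mul_const c)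
  rw [neg_zero, zero_mul] at h
  simpa [Function.comp_def] using (Real.continuous_exp.tendsto 0).comp h

/-- Fatou's lemma as the damping is removed: the damped square norms equal smoothed covariances,
which stay bounded for t ≤ 1. -/
theorem memLp_hat (h : IsSpectralMeasure Λ μ) (hf : IsBddBump K R f) : MemLp (hat f) 2 μ := by
  obtain ⟨C, hC, hle⟩ := exists_smoothForm_le h.temperate_cov K R
  have hm := measurable_hat hf.measurable
  have hn : ∀ n : ℕ, ∫⁻ ξ, ENNReal.ofReal (Real.exp (-(1 / ((n : ℝ) + 1)) * ‖ξ‖ ^ 2)) *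
      ENNReal.ofReal (‖hat f ξ‖ ^ 2) ∂μ ≤ ENNReal.ofReal ((2 * Real.pi) ^ d * C.toReal) := by
    intro n
    have hpos : (0 : ℝ) < 1 / (n + 1) := by positivity
    have h1 : (1 : ℝ) / (n + 1) ≤ 1 := by
      rw [div_le_one (by positivity)]; linarith [Nat.cast_nonneg (α := ℝ) n]
    have := lintegral_hat_sq_damped h hf hpos
    rw [damped, lintegral_withDensity_eq_lintegral_mul _ (by fun_prop) (by fun_prop)] at this
    refine this.le.trans (ENNReal.ofReal_le_ofReal ?_)
    gcongr
    exact hle f f hf hf _ hpos h1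
  have hlim : ∫⁻ ξ, ENNReal.ofReal (‖hat f ξ‖ ^ 2) ∂μ ≤
      ENNReal.ofReal ((2 * Real.pi) ^ d * C.toReal) := by
    calc ∫⁻ ξ, ENNReal.ofReal (‖hat f ξ‖ ^ 2) ∂μ
        = ∫⁻ ξ, liminf (fun n : ℕ => ENNReal.ofReal (Real.exp (-(1 / ((n : ℝ) + 1)) * ‖ξ‖ ^ 2)) *
            ENNReal.ofReal (‖hat f ξ‖ ^ 2)) atTop ∂μ := by
          refine lintegral_congr fun ξ => (Tendsto.liminf_eq ?_).symm
          have := ENNReal.Tendsto.mul_const (b := ENNReal.ofReal (‖hat f ξ‖ ^ 2))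
            ((ENNReal.continuous_ofReal.tendsto 1).comp (tendsto_exp_damping (‖ξ‖ ^ 2)))
            (Or.inr ENNReal.ofReal_ne_top)
          simpa using this
      _ ≤ _ := lintegral_liminf_le (fun n => by fun_prop)
      _ ≤ _ := liminf_le_of_le (by isBoundedDefault) fun b hb => by
          obtain ⟨n, hn'⟩ := hb.exists
          exact hn'.trans (hn n)
  refine ⟨hm.aestronglyMeasurable, ?_⟩
  rw [eLpNorm_lt_top_iff_lintegral_rpow_enorm_lt_top (by simp) (by simp)]
  refine lt_of_le_of_lt (le_of_eq (lintegral_congr fun ξ => ?_))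
    (hlim.trans_lt ENNReal.ofReal_lt_top)
  rw [ENNReal.ofReal_pow (norm_nonneg _), ofReal_norm]
  simp

/-- Parseval's identity for the spatial covariance of the noise. -/
theorem integral_hat_mul_conj (h : IsSpectralMeasure Λ μ) (hf : IsBddBump K R f)
    (hg : IsBddBump K R g) :
    ∫ ξ, hat f ξ * conj (hat g ξ) ∂μ =
      (((2 * Real.pi) ^ d * (covForm Λ f g).toReal : ℝ) : ℂ) := by
  obtain ⟨C, hC, hle⟩ := exists_smoothForm_le h.temperate_cov K R
  have hint : Integrable (fun ξ => hat f ξ * conj (hat g ξ)) μ :=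
    (memLp_hat h hf).integrable_mul (memLp_hat h hg).star
  have hpos : ∀ n : ℕ, (0 : ℝ) < 1 / (n + 1) := fun n => by positivity
  have hone : ∀ n : ℕ, (1 : ℝ) / (n + 1) ≤ 1 := fun n => by
    rw [div_le_one (by positivity)]; linarith [Nat.cast_nonneg (α := ℝ) n]
  have hcov : covForm Λ f g ≠ ∞ :=
    ((le_of_tendsto' (tendsto_smoothForm h.temperate_cov hf hg) fun n =>
      hle f g hf hg _ (hpos n) (hone n)).trans_lt hC.lt_top).ne
  -- The damped integral converges on the spectral side by dominated convergence and on the side of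
  -- Λ by convergence of the smoothed forms; the two limits are compared.
  have h1 : Tendsto (fun n : ℕ => ∫ ξ, hat f ξ * conj (hat g ξ) ∂(damped μ (1 / (n + 1))))
      atTop (𝓝 (∫ ξ, hat f ξ * conj (hat g ξ) ∂μ)) := by
    simp_rw [integral_damped]
    refine tendsto_integral_of_dominated_convergence (fun ξ => ‖hat f ξ * conj (hat g ξ)‖)
      (fun n => ?_) hint.norm (fun n => ae_of_all _ fun ξ => ?_) (ae_of_all _ fun ξ => ?_)
    · exact hint.aestronglyMeasurable.mul (Measurable.aestronglyMeasurable (by fun_prop))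
    · rw [norm_mul _ ((Real.exp _ : ℝ) : ℂ), Complex.norm_real, Real.norm_eq_abs, Real.abs_exp]
      refine mul_le_of_le_one_right (norm_nonneg _) (Real.exp_le_one_iff.2 ?_)
      have := (hpos n).le
      nlinarith [sq_nonneg ‖ξ‖]
    · have := (Complex.continuous_ofReal.tendsto 1).comp (tendsto_exp_damping (‖ξ‖ ^ 2))
      simpa using this.const_mul (hat f ξ * conj (hat g ξ))
  have h2 : Tendsto (fun n : ℕ => ∫ ξ, hat f ξ * conj (hat g ξ) ∂(damped μ (1 / (n + 1))))
      atTop (𝓝 (((2 * Real.pi) ^ d * (covForm Λ f g).toReal : ℝ) : ℂ)) := by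
    simp_rw [fun n : ℕ => integral_hat_mul_conj_damped h hf hg (hpos n)]
    exact (Complex.continuous_ofReal.tendsto _).comp
      (((ENNReal.tendsto_toReal hcov).comp
        (tendsto_smoothForm h.temperate_cov hf hg)).const_mul _)
  exact tendsto_nhds_unique h1 h2

end IsBddBump

end

/-! ### Power weights as mixtures of Gaussians. -/

section

open scoped ENNReal ComplexConjugate

theorem setLIntegral_Ioc_zero_rpow {a b : ℝ} (ha : -1 < a) (hb : 0 ≤ b) :
    ∫⁻ x in Set.Ioc 0 b, ENNReal.ofReal (x ^ a) = ENNReal.ofReal (b ^ (a + 1) / (a + 1)) := by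
  have hi := intervalIntegral.intervalIntegrable_rpow' (a := 0) (b := b) ha
  rw [intervalIntegrable_iff_integrableOn_Ioc_of_le hb] at hi
  rw [← ofReal_integral_eq_lintegral_ofReal hi]
  · rw [← intervalIntegral.integral_of_le hb, integral_rpow (Or.inl ha),
      Real.zero_rpow (by linarith), sub_zero]
  · filter_upwards [ae_restrict_mem measurableSet_Ioc] with x hx
    exact Real.rpow_nonneg hx.1.le _

theorem setLIntegral_Ioi_rpow {a c : ℝ} (ha : a < -1) (hc : 0 < c) :
    ∫⁻ x in Set.Ioi c, ENNReal.ofReal (x ^ a) = ENNReal.ofReal (-c ^ (a + 1) / (a + 1)) := by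
  rw [← ofReal_integral_eq_lintegral_ofReal (integrableOn_Ioi_rpow_of_lt ha hc)]
  · rw [integral_Ioi_rpow_of_lt ha hc]
  · filter_upwards [ae_restrict_mem measurableSet_Ioi] with x hx
    exact Real.rpow_nonneg (hc.trans hx).le _

/-- Lower bound for the Gaussian mixture representing `|τ|^{1-2H}`. -/
theorem le_lintegral_gaussian_mixture {H : ℝ} (hH : 1 / 2 < H) (τ : ℝ) :
    ENNReal.ofReal (Real.exp (-1) / (H - 1 / 2)) * ENNReal.ofReal (|τ| ^ (1 - 2 * H)) ≤
      ∫⁻ ε in Set.Ioi (0 : ℝ), ENNReal.ofReal (ε ^ (H - 3 / 2)) *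
        ENNReal.ofReal (Real.exp (-ε * τ ^ 2)) := by
  rcases eq_or_ne τ 0 with rfl | hτ
  · rw [abs_zero, Real.zero_rpow (by linarith)]; simp
  have hτ2 : 0 < τ ^ 2 := by positivity
  -- Keep only ε ≤ τ^{-2}, where the exponential is at least e^{-1}.
  calc ENNReal.ofReal (Real.exp (-1) / (H - 1 / 2)) * ENNReal.ofReal (|τ| ^ (1 - 2 * H))
      = ∫⁻ ε in Set.Ioc 0 (1 / τ ^ 2), ENNReal.ofReal (ε ^ (H - 3 / 2)) *
          ENNReal.ofReal (Real.exp (-1)) := by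
        rw [lintegral_mul_const' _ _ ENNReal.ofReal_ne_top,
          setLIntegral_Ioc_zero_rpow (by linarith) (by positivity),
          ← ENNReal.ofReal_mul (div_nonneg (Real.exp_pos _).le (by linarith)),
          ← ENNReal.ofReal_mul (div_nonneg (by positivity) (by linarith))]
        congr 1
        have h1 : (1 / τ ^ 2) ^ (H - 3 / 2 + 1) = |τ| ^ (1 - 2 * H) := by
          rw [one_div, Real.inv_rpow hτ2.le, ← Real.rpow_neg hτ2.le, ← sq_abs,
            ← Real.rpow_natCast, ← Real.rpow_mul (abs_nonneg _)]
          congr 1; push_cast; ring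
        rw [h1, show H - 3 / 2 + 1 = H - 1 / 2 by ring]
        ring
    _ ≤ ∫⁻ ε in Set.Ioc 0 (1 / τ ^ 2), ENNReal.ofReal (ε ^ (H - 3 / 2)) *
          ENNReal.ofReal (Real.exp (-ε * τ ^ 2)) := by
        refine setLIntegral_mono' measurableSet_Ioc fun ε hε => ?_
        gcongr
        have := (le_div_iff₀ hτ2).1 hε.2
        linarith
    _ ≤ _ := lintegral_mono_set Set.Ioc_subset_Ioi_self

/-- Upper bound for the Gaussian mixture representing `|r|^{2H-2}`. -/
theorem lintegral_gaussian_mixture_le {H : ℝ} (hH : 1 / 2 < H) (hH' : H < 1) {r : ℝ}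
    (hr : r ≠ 0) :
    ∫⁻ ε in Set.Ioi (0 : ℝ), ENNReal.ofReal (ε ^ (H - 3 / 2)) *
        ENNReal.ofReal (√(Real.pi / ε) * Real.exp (-r ^ 2 / (4 * ε))) ≤
      ENNReal.ofReal (√Real.pi * (4 ^ (1 - H) * (1 / H + 1 / (1 - H)))) *
        ENNReal.ofReal (|r| ^ (2 * H - 2)) := by
  -- The integral is cut at ε = u: below it e^{-u/ε} ≤ ε/u restores integrability at 0, above it the
  -- exponential is at most 1.
  set u := r ^ 2 / 4 with hu
  have hu0 : 0 < u := by positivity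
  have hpt : ∀ ε : ℝ, 0 < ε → ε ^ (H - 3 / 2) *
      (√(Real.pi / ε) * Real.exp (-r ^ 2 / (4 * ε))) =
      √Real.pi * (ε ^ (H - 2) * Real.exp (-(u / ε))) := by
    intro ε hε
    rw [Real.sqrt_div Real.pi_pos.le, Real.sqrt_eq_rpow ε]
    have h1 : ε ^ (H - 2) = ε ^ (H - 3 / 2) / ε ^ (1 / 2 : ℝ) := by
      rw [← Real.rpow_sub hε]; congr 1; ring
    have h2 : -r ^ 2 / (4 * ε) = -(u / ε) := by rw [hu]; field_simp
    rw [h1, h2]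
    ring
  have h1 : ∫⁻ ε in Set.Ioc 0 u, ENNReal.ofReal (ε ^ (H - 3 / 2)) *
        ENNReal.ofReal (√(Real.pi / ε) * Real.exp (-r ^ 2 / (4 * ε))) ≤
      ENNReal.ofReal (√Real.pi * u ^ (H - 1) / H) := by
    calc _ ≤ ∫⁻ ε in Set.Ioc 0 u, ENNReal.ofReal (√Real.pi / u) *
          ENNReal.ofReal (ε ^ (H - 1)) := by
          refine setLIntegral_mono' measurableSet_Ioc fun ε hε => ?_
          have hε0 : 0 < ε := hε.1
          rw [← ENNReal.ofReal_mul (by positivity), ← ENNReal.ofReal_mul (by positivity),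
            hpt ε hε0]
          apply ENNReal.ofReal_le_ofReal
          have h3 : Real.exp (-(u / ε)) ≤ ε / u := by
            rw [Real.exp_neg]
            have := Real.add_one_le_exp (u / ε)
            rw [inv_le_comm₀ (Real.exp_pos _) (by positivity), inv_div]
            linarith
          calc √Real.pi * (ε ^ (H - 2) * Real.exp (-(u / ε)))
              ≤ √Real.pi * (ε ^ (H - 2) * (ε / u)) := by gcongr
            _ = √Real.pi / u * (ε ^ (H - 2) * ε ^ (1 : ℝ)) := by rw [Real.rpow_one]; ring
            _ = √Real.pi / u * ε ^ (H - 1) := by rw [← Real.rpow_add hε0]; congr 2; ring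
      _ = _ := by
          rw [lintegral_const_mul' _ _ ENNReal.ofReal_ne_top,
            setLIntegral_Ioc_zero_rpow (by linarith) hu0.le,
            ← ENNReal.ofReal_mul (by positivity), sub_add_cancel, Real.rpow_sub_one hu0.ne']
          congr 1; ring
  have h2 : ∫⁻ ε in Set.Ioi u, ENNReal.ofReal (ε ^ (H - 3 / 2)) *
        ENNReal.ofReal (√(Real.pi / ε) * Real.exp (-r ^ 2 / (4 * ε))) ≤
      ENNReal.ofReal (√Real.pi * u ^ (H - 1) / (1 - H)) := by
    calc _ ≤ ∫⁻ ε in Set.Ioi u, ENNReal.ofReal √Real.pi * ENNReal.ofReal (ε ^ (H - 2)) := by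
          refine setLIntegral_mono' measurableSet_Ioi fun ε hε => ?_
          have hε0 : 0 < ε := hu0.trans hε
          rw [← ENNReal.ofReal_mul (by positivity), ← ENNReal.ofReal_mul (by positivity),
            hpt ε hε0]
          apply ENNReal.ofReal_le_ofReal
          gcongr
          refine mul_le_of_le_one_right (by positivity) (Real.exp_le_one_iff.2 ?_)
          have : 0 ≤ u / ε := by positivity
          linarith
      _ = _ := by
          rw [lintegral_const_mul' _ _ ENNReal.ofReal_ne_top,
            setLIntegral_Ioi_rpow (by linarith) hu0,
            ← ENNReal.ofReal_mul (by positivity), show H - 2 + 1 = H - 1 by ring,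
            ← neg_div_neg_eq (-u ^ (H - 1)), neg_neg, neg_sub, mul_div_assoc]
  rw [← Set.Ioc_union_Ioi_eq_Ioi hu0.le,
    lintegral_union measurableSet_Ioi (Set.Ioc_disjoint_Ioi le_rfl)]
  refine (add_le_add h1 h2).trans (le_of_eq ?_)
  have hH1 : 0 < 1 - H := by linarith
  have hH0 : 0 < H := by linarith
  rw [← ENNReal.ofReal_add (by positivity) (by positivity), ← ENNReal.ofReal_mul (by positivity)]
  congr 1
  have h3 : u ^ (H - 1) = 4 ^ (1 - H) * |r| ^ (2 * H - 2) := by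
    rw [hu, Real.div_rpow (by positivity) (by norm_num), ← sq_abs, ← Real.rpow_natCast,
      ← Real.rpow_mul (abs_nonneg _), div_eq_mul_inv, ← Real.rpow_neg (by norm_num), mul_comm]
    congr 2
    · ring
    · push_cast; ring
  rw [h3]
  ring

end

/-! ### The space-time transform and the bound by the damped energy. -/

section

open scoped ENNReal ComplexConjugate

variable {d : ℕ} {Λ μ : Measure (Space d)}

/-- The space-time character `e^{i(τ r + ξ·z)}`. -/
def stChar (p q : ℝ × Space d) : ℂ :=
  Complex.exp (((p.1 * q.1 : ℝ) : ℂ) * Complex.I) * spaceChar p.2 q.2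

theorem continuous_stChar :
    Continuous (Function.uncurry (stChar : ℝ × Space d → ℝ × Space d → ℂ)) := by
  unfold stChar spaceChar Function.uncurry; fun_prop

theorem norm_stChar (p q : ℝ × Space d) : ‖stChar p q‖ = 1 := by
  rw [stChar, norm_mul, norm_spaceChar, Complex.norm_exp_ofReal_mul_I, one_mul]

theorem stChar_mul_conj (p p' q : ℝ × Space d) :
    stChar p q * conj (stChar p' q) =
      Complex.exp (((p.1 - p'.1) * q.1 : ℝ) * Complex.I) * spaceChar (p.2 - p'.2) q.2 := by
  rw [← spaceChar_mul_conj]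
  simp only [stChar, map_mul, ← Complex.exp_conj]
  rw [mul_mul_mul_comm, ← Complex.exp_add]
  congr 2
  simp only [Complex.conj_I, Complex.conj_ofReal]
  push_cast
  ring

/-- The space-time Fourier transform. -/
def stFourier (φ : ℝ × Space d → ℝ) (q : ℝ × Space d) : ℂ := ∫ p, stChar p q * (φ p : ℂ)

theorem measurable_stFourier {φ : ℝ × Space d → ℝ} (hφ : Measurable φ) :
    Measurable (stFourier φ) := by
  have h : StronglyMeasurable fun q : (ℝ × Space d) × (ℝ × Space d) =>
      stChar q.2 q.1 * (φ q.2 : ℂ) := by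
    have := continuous_stChar.measurable.comp
      (measurable_swap (α := ℝ × Space d) (β := ℝ × Space d))
    exact (this.mul (Complex.measurable_ofReal.comp (hφ.comp measurable_snd))).stronglyMeasurable
  exact h.integral_prod_right'.measurable

/-- The heat kernel smoothing of `Λ`. -/
def smoothKernel (Λ : Measure (Space d)) (t : ℝ) (a : Space d) : ℝ≥0∞ :=
  ∫⁻ v, ENNReal.ofReal (heatKernel t (a - v)) ∂Λ

theorem measurable_smoothKernel [SFinite Λ] {t : ℝ} (ht : 0 < t) :
    Measurable (smoothKernel Λ t) := by
  have hγ : Measurable (heatKernel t : Space d → ℝ) := (continuous_heatKernel ht).measurable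
  exact Measurable.lintegral_prod_right' (f := fun q : Space d × Space d =>
    ENNReal.ofReal (heatKernel t (q.1 - q.2))) (by fun_prop)

/-- A Gaussian weight in the time frequency. -/
def timeDamped (ε : ℝ) : Measure ℝ :=
  volume.withDensity fun τ => ENNReal.ofReal (Real.exp (-ε * τ ^ 2))

theorem isFiniteMeasure_timeDamped {ε : ℝ} (hε : 0 < ε) : IsFiniteMeasure (timeDamped ε) :=
  isFiniteMeasure_withDensity_ofReal (integrable_exp_neg_mul_sq hε).2

theorem integral_timeDamped {ε : ℝ} (hε : 0 < ε) (r : ℝ) :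
    ∫ τ, Complex.exp ((r * τ : ℝ) * Complex.I) ∂(timeDamped ε) =
      ((√(Real.pi / ε) * Real.exp (-r ^ 2 / (4 * ε)) : ℝ) : ℂ) := by
  rw [timeDamped, integral_withDensity_eq_integral_toReal_smul (by fun_prop)
    (ae_of_all _ fun _ => ENNReal.ofReal_lt_top)]
  have key := fourierIntegral_gaussian (b := (ε : ℂ)) (by simpa using hε) (r : ℂ)
  rw [Complex.ofReal_mul, Real.sqrt_eq_rpow, Complex.ofReal_cpow (by positivity),
    Complex.ofReal_exp]
  push_cast
  rw [← key]
  refine integral_congr_ae (ae_of_all _ fun τ => ?_)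
  simp only
  rw [ENNReal.toReal_ofReal (Real.exp_pos _).le, Complex.real_smul, Complex.ofReal_exp, mul_comm]
  congr 2
  · ring
  · push_cast; ring

/-- Both weights, in τ and in ξ, are finite measures with non-negative characteristic functions: a
Gaussian in r - s and a smoothing of Λ. The general bound for transforms therefore yields an energy
with a positive kernel. -/
theorem lintegral_stFourier_damped_le (h : IsSpectralMeasure Λ μ) {φ : ℝ × Space d → ℝ}
    (hφm : Measurable φ) (hφ : Integrable φ) {ε t : ℝ} (hε : 0 < ε) (ht : 0 < t) :
    ∫⁻ τ, ENNReal.ofReal (Real.exp (-ε * τ ^ 2)) *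
        ∫⁻ ξ, ‖stFourier φ (τ, ξ)‖ₑ ^ 2 ∂(damped μ t) ≤
      ∫⁻ p : (ℝ × Space d) × (ℝ × Space d), ‖φ p.1‖ₑ * ‖φ p.2‖ₑ *
        (ENNReal.ofReal (√(Real.pi / ε) * Real.exp (-(p.1.1 - p.2.1) ^ 2 / (4 * ε))) *
          (ENNReal.ofReal ((2 * Real.pi) ^ d) * smoothKernel Λ t (p.1.2 - p.2.2))) := by
  have := isFiniteMeasure_damped h.temperate_spec ht
  have := isFiniteMeasure_timeDamped hε
  have key := lintegral_transform_sq_le (m := (timeDamped ε).prod (damped μ t)) (k := stChar)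
    (ρ := volume) (f := fun x => (φ x : ℂ)) continuous_stChar.measurable
    (fun x y => (norm_stChar x y).le) hφ.ofReal
  have hmF := measurable_stFourier hφm
  have hL : ∫⁻ y, ‖∫ x, stChar x y * (φ x : ℂ)‖ₑ ^ 2 ∂((timeDamped ε).prod (damped μ t)) =
      ∫⁻ τ, ENNReal.ofReal (Real.exp (-ε * τ ^ 2)) *
        ∫⁻ ξ, ‖stFourier φ (τ, ξ)‖ₑ ^ 2 ∂(damped μ t) := by
    change ∫⁻ y, ‖stFourier φ y‖ₑ ^ 2 ∂((timeDamped ε).prod (damped μ t)) = _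
    have hm2 : Measurable fun y => ‖stFourier φ y‖ₑ ^ 2 := by fun_prop
    rw [lintegral_prod _ hm2.aemeasurable, timeDamped,
      lintegral_withDensity_eq_lintegral_mul _ (by fun_prop) hm2.lintegral_prod_right']
    rfl
  rw [hL] at key
  refine key.trans (le_of_eq (lintegral_congr fun p => ?_))
  have e1 : ∫ y, stChar p.1 y * conj (stChar p.2 y) ∂((timeDamped ε).prod (damped μ t)) =
      ((√(Real.pi / ε) * Real.exp (-(p.1.1 - p.2.1) ^ 2 / (4 * ε)) *
        ((2 * Real.pi) ^ d * ∫ v, heatKernel t (p.1.2 - p.2.2 - v) ∂Λ) : ℝ) : ℂ) := by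
    simp_rw [stChar_mul_conj]
    rw [integral_prod_mul (fun τ : ℝ => Complex.exp (((p.1.1 - p.2.1) * τ : ℝ) * Complex.I))
      (fun ξ => spaceChar (p.1.2 - p.2.2) ξ), integral_timeDamped hε, h.integral_spaceChar ht,
      ← Complex.ofReal_mul]
  have e2 : ∀ x : ℝ, ‖(x : ℂ)‖ₑ = ‖x‖ₑ := fun x => by
    rw [← ofReal_norm, Complex.norm_real, ofReal_norm]
  rw [e1, e2, e2, e2, smoothKernel, lintegral_heatKernel_sub h.temperate_cov ht,
    ← ENNReal.ofReal_mul (by positivity), ← ENNReal.ofReal_mul (by positivity),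
    ← ofReal_norm (_ * _), Real.norm_of_nonneg]
  exact mul_nonneg (by positivity) (mul_nonneg (by positivity)
    (integral_nonneg fun v => heatKernel_nonneg _ _))

/-- The weight `|τ|^{1-2H} dτ`. -/
def timeMeasure (H : ℝ) : Measure ℝ :=
  volume.withDensity fun τ => ENNReal.ofReal (|τ| ^ (1 - 2 * H))

instance (H : ℝ) : SFinite (timeMeasure H) := by unfold timeMeasure; infer_instance

/-- The spectral measure of the noise in space-time. -/
def specMeasure (H : ℝ) (μ : Measure (Space d)) : Measure (ℝ × Space d) :=
  (timeMeasure H).prod μ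

theorem lintegral_specMeasure {H : ℝ} [SFinite μ] {F : ℝ × Space d → ℝ≥0∞} (hF : Measurable F) :
    ∫⁻ q, F q ∂(specMeasure H μ) =
      ∫⁻ τ, ENNReal.ofReal (|τ| ^ (1 - 2 * H)) * ∫⁻ ξ, F (τ, ξ) ∂μ := by
  rw [specMeasure, lintegral_prod _ hF.aemeasurable, timeMeasure,
    lintegral_withDensity_eq_lintegral_mul _ (by fun_prop) hF.lintegral_prod_right']
  rfl

/-- Tonelli's theorem in two space-time variables, times first. -/
theorem lintegral_prod_prod_space {F : (ℝ × Space d) × (ℝ × Space d) → ℝ≥0∞} (hF : Measurable F) :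
    ∫⁻ p, F p = ∫⁻ r, ∫⁻ s, ∫⁻ z, ∫⁻ z', F ((r, z), (s, z')) := by
  have h1 : ∫⁻ p, F p = ∫⁻ p, ∫⁻ q, F (p, q) := lintegral_prod _ hF.aemeasurable
  have h2 : ∫⁻ p, ∫⁻ q, F (p, q) = ∫⁻ r, ∫⁻ z, ∫⁻ q, F ((r, z), q) :=
    lintegral_prod _ hF.lintegral_prod_right'.aemeasurable
  rw [h1, h2]
  refine lintegral_congr fun r => ?_
  have h3 : ∀ z, ∫⁻ q, F ((r, z), q) = ∫⁻ s, ∫⁻ z', F ((r, z), (s, z')) := fun z =>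
    lintegral_prod (fun q => F ((r, z), q)) (by fun_prop)
  simp_rw [h3]
  refine lintegral_lintegral_swap (Measurable.aemeasurable ?_)
  exact Measurable.lintegral_prod_right' (f := fun q : (Space d × ℝ) × Space d =>
    F ((r, q.1.1), (q.1.2, q.2))) (by fun_prop)

/-- Integrate the preceding bound against ε^{H-3/2} dε. On the left the mixture dominates a multiple
of |τ|^{1-2H}; on the right it is dominated by a multiple of |r-s|^{2H-2}. The constant does not
depend on t, so the damping can be removed afterwards. -/
theorem lintegral_stFourier_spec_damped_le (h : IsSpectralMeasure Λ μ) {H : ℝ} (hH : 1 / 2 < H)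
    (hH' : H < 1) : ∃ C : ℝ≥0∞, C ≠ ∞ ∧ ∀ φ : ℝ × Space d → ℝ, Measurable φ → Integrable φ →
    ∀ t, 0 < t → ∫⁻ q, ‖stFourier φ q‖ₑ ^ 2 ∂(specMeasure H (damped μ t)) ≤
      C * ∫⁻ r, ∫⁻ s, ENNReal.ofReal (|r - s| ^ (2 * H - 2)) *
        smoothForm Λ t (fun z => |φ (r, z)|) (fun z => |φ (s, z)|) := by
  set c₁ : ℝ := Real.exp (-1) / (H - 1 / 2) with hc₁
  have hc₁0 : 0 < c₁ := div_pos (Real.exp_pos _) (by linarith)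
  set c₂ : ℝ := √Real.pi * (4 ^ (1 - H) * (1 / H + 1 / (1 - H))) with hc₂
  refine ⟨(ENNReal.ofReal c₁)⁻¹ * (ENNReal.ofReal c₂ * ENNReal.ofReal ((2 * Real.pi) ^ d)),
    ENNReal.mul_ne_top (by simpa using hc₁0) (by finiteness), fun φ hφm hφ t ht => ?_⟩
  have := isFiniteMeasure_damped h.temperate_spec ht
  have := sigmaFinite_of_temperate h.temperate_cov
  have hmF := measurable_stFourier hφm
  have hm2 : Measurable fun y => ‖stFourier φ y‖ₑ ^ 2 := by fun_prop
  have hS := measurable_smoothKernel (Λ := Λ) ht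
  have hm3 : Measurable fun τ => ∫⁻ ξ, ‖stFourier φ (τ, ξ)‖ₑ ^ 2 ∂(damped μ t) :=
    hm2.lintegral_prod_right'
  have hm4 : Measurable fun q : ℝ × ℝ => ∫⁻ ξ, ‖stFourier φ (q.1, ξ)‖ₑ ^ 2 ∂(damped μ t) :=
    hm3.comp measurable_fst
  have hmain : ∫⁻ τ, (∫⁻ ε in Set.Ioi (0 : ℝ), ENNReal.ofReal (ε ^ (H - 3 / 2)) *
        ENNReal.ofReal (Real.exp (-ε * τ ^ 2))) *
        ∫⁻ ξ, ‖stFourier φ (τ, ξ)‖ₑ ^ 2 ∂(damped μ t) ≤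
      ∫⁻ p : (ℝ × Space d) × (ℝ × Space d), ‖φ p.1‖ₑ * ‖φ p.2‖ₑ *
        ((∫⁻ ε in Set.Ioi (0 : ℝ), ENNReal.ofReal (ε ^ (H - 3 / 2)) *
          ENNReal.ofReal (√(Real.pi / ε) * Real.exp (-(p.1.1 - p.2.1) ^ 2 / (4 * ε)))) *
          (ENNReal.ofReal ((2 * Real.pi) ^ d) * smoothKernel Λ t (p.1.2 - p.2.2))) := by
    calc _ = ∫⁻ τ, ∫⁻ ε in Set.Ioi (0 : ℝ), ENNReal.ofReal (ε ^ (H - 3 / 2)) *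
          (ENNReal.ofReal (Real.exp (-ε * τ ^ 2)) *
          ∫⁻ ξ, ‖stFourier φ (τ, ξ)‖ₑ ^ 2 ∂(damped μ t)) := by
          refine lintegral_congr fun τ => ?_
          rw [← lintegral_mul_const _ (by fun_prop)]
          exact lintegral_congr fun ε => mul_assoc _ _ _
      _ = ∫⁻ ε in Set.Ioi (0 : ℝ), ∫⁻ τ, ENNReal.ofReal (ε ^ (H - 3 / 2)) *
          (ENNReal.ofReal (Real.exp (-ε * τ ^ 2)) *
          ∫⁻ ξ, ‖stFourier φ (τ, ξ)‖ₑ ^ 2 ∂(damped μ t)) := by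
          rw [lintegral_lintegral_swap]
          refine Measurable.aemeasurable ?_
          unfold Function.uncurry
          fun_prop
      _ ≤ ∫⁻ ε in Set.Ioi (0 : ℝ), ∫⁻ p : (ℝ × Space d) × (ℝ × Space d),
          ENNReal.ofReal (ε ^ (H - 3 / 2)) * (‖φ p.1‖ₑ * ‖φ p.2‖ₑ *
        (ENNReal.ofReal (√(Real.pi / ε) * Real.exp (-(p.1.1 - p.2.1) ^ 2 / (4 * ε))) *
          (ENNReal.ofReal ((2 * Real.pi) ^ d) * smoothKernel Λ t (p.1.2 - p.2.2)))) := by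
          refine setLIntegral_mono' measurableSet_Ioi fun ε hε => ?_
          rw [lintegral_const_mul' _ _ ENNReal.ofReal_ne_top,
            lintegral_const_mul' _ _ ENNReal.ofReal_ne_top]
          gcongr
          exact lintegral_stFourier_damped_le h hφm hφ hε ht
      _ = ∫⁻ p : (ℝ × Space d) × (ℝ × Space d), ∫⁻ ε in Set.Ioi (0 : ℝ),
          ENNReal.ofReal (ε ^ (H - 3 / 2)) * (‖φ p.1‖ₑ * ‖φ p.2‖ₑ *
        (ENNReal.ofReal (√(Real.pi / ε) * Real.exp (-(p.1.1 - p.2.1) ^ 2 / (4 * ε))) *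
          (ENNReal.ofReal ((2 * Real.pi) ^ d) * smoothKernel Λ t (p.1.2 - p.2.2)))) := by
          rw [lintegral_lintegral_swap]
          refine Measurable.aemeasurable ?_
          unfold Function.uncurry
          fun_prop
      _ = _ := by
          refine lintegral_congr fun p => ?_
          rw [← lintegral_mul_const _ (by fun_prop), ← lintegral_const_mul _ (by fun_prop)]
          exact lintegral_congr fun ε => by ring
  have hL : ENNReal.ofReal c₁ * ∫⁻ q, ‖stFourier φ q‖ₑ ^ 2 ∂(specMeasure H (damped μ t)) ≤
      ∫⁻ τ, (∫⁻ ε in Set.Ioi (0 : ℝ), ENNReal.ofReal (ε ^ (H - 3 / 2)) *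
        ENNReal.ofReal (Real.exp (-ε * τ ^ 2))) *
        ∫⁻ ξ, ‖stFourier φ (τ, ξ)‖ₑ ^ 2 ∂(damped μ t) := by
    rw [lintegral_specMeasure hm2, ← lintegral_const_mul' _ _ ENNReal.ofReal_ne_top]
    refine lintegral_mono fun τ => ?_
    rw [← mul_assoc]
    gcongr
    exact le_lintegral_gaussian_mixture hH τ
  have hR : ∫⁻ p : (ℝ × Space d) × (ℝ × Space d), ‖φ p.1‖ₑ * ‖φ p.2‖ₑ *
        ((∫⁻ ε in Set.Ioi (0 : ℝ), ENNReal.ofReal (ε ^ (H - 3 / 2)) *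
          ENNReal.ofReal (√(Real.pi / ε) * Real.exp (-(p.1.1 - p.2.1) ^ 2 / (4 * ε)))) *
          (ENNReal.ofReal ((2 * Real.pi) ^ d) * smoothKernel Λ t (p.1.2 - p.2.2))) ≤
      ENNReal.ofReal c₂ * ENNReal.ofReal ((2 * Real.pi) ^ d) *
        ∫⁻ r, ∫⁻ s, ENNReal.ofReal (|r - s| ^ (2 * H - 2)) *
        smoothForm Λ t (fun z => |φ (r, z)|) (fun z => |φ (s, z)|) := by
    -- Only almost everywhere: for r = s the mixture diverges while `0 ^ (2 * H - 2)` is `0`.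
    have hker : ∀ᵐ p : (ℝ × Space d) × (ℝ × Space d), ‖φ p.1‖ₑ * ‖φ p.2‖ₑ *
        ((∫⁻ ε in Set.Ioi (0 : ℝ), ENNReal.ofReal (ε ^ (H - 3 / 2)) *
          ENNReal.ofReal (√(Real.pi / ε) * Real.exp (-(p.1.1 - p.2.1) ^ 2 / (4 * ε)))) *
          (ENNReal.ofReal ((2 * Real.pi) ^ d) * smoothKernel Λ t (p.1.2 - p.2.2))) ≤
        ENNReal.ofReal c₂ * ENNReal.ofReal ((2 * Real.pi) ^ d) *
          (ENNReal.ofReal (|p.1.1 - p.2.1| ^ (2 * H - 2)) *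
          (‖φ p.1‖ₑ * ‖φ p.2‖ₑ * smoothKernel Λ t (p.1.2 - p.2.2))) := by
      have hne : ∀ᵐ p : (ℝ × Space d) × (ℝ × Space d), p.1.1 - p.2.1 ≠ 0 := by
        have hms : MeasurableSet {p : (ℝ × Space d) × (ℝ × Space d) | p.1.1 - p.2.1 ≠ 0} :=
          (measurableSet_eq_fun (by fun_prop) measurable_const).compl
        rw [show (volume : Measure ((ℝ × Space d) × (ℝ × Space d))) = volume.prod volume from rfl,
          Measure.ae_prod_iff_ae_ae hms]
        refine ae_of_all _ fun x => ?_
        have hms' : MeasurableSet {y : ℝ × Space d | x.1 - y.1 ≠ 0} :=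
          (measurableSet_eq_fun (by fun_prop) measurable_const).compl
        rw [show (volume : Measure (ℝ × Space d)) = volume.prod volume from rfl,
          Measure.ae_prod_iff_ae_ae hms']
        have := Measure.ae_ne (volume : Measure ℝ) x.1
        filter_upwards [this] with y hy
        exact ae_of_all _ fun z => sub_ne_zero.2 (Ne.symm hy)
      filter_upwards [hne] with p hp
      calc _ ≤ ‖φ p.1‖ₑ * ‖φ p.2‖ₑ *
            ((ENNReal.ofReal c₂ * ENNReal.ofReal (|p.1.1 - p.2.1| ^ (2 * H - 2))) *
            (ENNReal.ofReal ((2 * Real.pi) ^ d) * smoothKernel Λ t (p.1.2 - p.2.2))) := by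
            gcongr
            exact lintegral_gaussian_mixture_le hH hH' hp
        _ = _ := by ring
    refine (lintegral_mono_ae hker).trans (le_of_eq ?_)
    rw [lintegral_const_mul' _ _ (by finiteness)]
    congr 1
    rw [lintegral_prod_prod_space (by fun_prop)]
    refine lintegral_congr fun r => lintegral_congr fun s => ?_
    simp_rw [lintegral_const_mul' _ _ ENNReal.ofReal_ne_top]
    congr 1
    simp only [smoothForm, smoothKernel, ← Real.norm_eq_abs, ofReal_norm]
  calc _ = (ENNReal.ofReal c₁)⁻¹ * (ENNReal.ofReal c₁ *
        ∫⁻ q, ‖stFourier φ q‖ₑ ^ 2 ∂(specMeasure H (damped μ t))) := by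
        rw [← mul_assoc, ENNReal.inv_mul_cancel (by simpa using hc₁0) ENNReal.ofReal_ne_top,
          one_mul]
    _ ≤ _ := by
        rw [mul_assoc]
        exact mul_le_mul_right (hL.trans (hmain.trans hR)) _

end

/-! ### Removing the damping: the energy controls the spectral norm. -/

section

open scoped ENNReal ComplexConjugate

theorem lintegral_comp_abs (f : ℝ → ℝ≥0∞) : ∫⁻ x, f |x| = 2 * ∫⁻ x in Set.Ioi 0, f x := by
  have h1 : ∫⁻ x in Set.Ioi 0, f |x| = ∫⁻ x in Set.Ioi 0, f x :=
    setLIntegral_congr_fun measurableSet_Ioi fun x hx => by rw [abs_of_pos hx]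
  have h2 : ∫⁻ x in Set.Iio 0, f |x| = ∫⁻ x in Set.Ioi 0, f x := by
    rw [← h1, ← lintegral_indicator measurableSet_Iio, ← lintegral_indicator measurableSet_Ioi,
      ← lintegral_neg_eq_self]
    refine lintegral_congr fun x => ?_
    by_cases hx : 0 < x
    · rw [Set.indicator_of_mem (by simpa using hx), Set.indicator_of_mem (by simpa using hx),
        abs_neg]
    · rw [Set.indicator_of_notMem (by simpa using hx), Set.indicator_of_notMem (by simpa using hx)]
  have h3 := lintegral_add_compl (μ := volume) (fun x : ℝ => f |x|) (measurableSet_Ioi (a := (0 : ℝ)))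
  rw [Set.compl_Ioi, ← Measure.restrict_congr_set Iio_ae_eq_Iic, h1, h2] at h3
  rw [← h3, two_mul]

variable {d : ℕ} {Λ μ : Measure (Space d)}

/-- Local integrability of the time kernel, which dominates the smoothed energies. The condition a ≠
0 makes `0 ^ a` vanish on the diagonal, so that the half-open interval used for |r - s| loses
nothing. -/
theorem setLIntegral_rpow_abs_sub_lt_top {a : ℝ} (ha : -1 < a) (ha0 : a ≠ 0) {R : ℝ}
    (hR : 0 ≤ R) :
    ∫⁻ p : ℝ × ℝ, (Set.Icc (-R) R ×ˢ Set.Icc (-R) R).indicator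
      (fun p => ENNReal.ofReal (|p.1 - p.2| ^ a)) p < ∞ := by
  have hinner : ∫⁻ x : ℝ, (Set.Ioc 0 (2 * R)).indicator (fun x => ENNReal.ofReal (x ^ a)) |x| < ∞ := by
    rw [lintegral_comp_abs, setLIntegral_indicator measurableSet_Ioc,
      Set.inter_eq_left.2 Set.Ioc_subset_Ioi_self, setLIntegral_Ioc_zero_rpow ha (by positivity)]
    finiteness
  have hm : Measurable ((Set.Icc (-R) R ×ˢ Set.Icc (-R) R).indicator
      (fun p : ℝ × ℝ => ENNReal.ofReal (|p.1 - p.2| ^ a))) :=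
    Measurable.indicator (by fun_prop) (measurableSet_Icc.prod measurableSet_Icc)
  rw [show (volume : Measure (ℝ × ℝ)) = volume.prod volume from rfl,
    lintegral_prod _ hm.aemeasurable]
  calc _ ≤ ∫⁻ r, (Set.Icc (-R) R).indicator (fun _ => ∫⁻ x : ℝ, (Set.Ioc 0 (2 * R)).indicator
        (fun x => ENNReal.ofReal (x ^ a)) |x|) r := by
        refine lintegral_mono fun r => ?_
        by_cases hr : r ∈ Set.Icc (-R) R
        · rw [Set.indicator_of_mem hr, ← lintegral_sub_left_eq_self
            (fun x : ℝ => (Set.Ioc 0 (2 * R)).indicator (fun x => ENNReal.ofReal (x ^ a)) |x|) r]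
          refine lintegral_mono fun s => ?_
          by_cases hs : (r, s) ∈ Set.Icc (-R) R ×ˢ Set.Icc (-R) R
          swap
          · rw [Set.indicator_of_notMem hs]; exact zero_le
          rw [Set.indicator_of_mem hs]
          rcases eq_or_ne (r - s) 0 with h0 | h0
          · simp only at h0 ⊢
            rw [h0, abs_zero, Real.zero_rpow ha0]; simp
          · rw [Set.indicator_of_mem]
            refine ⟨abs_pos.2 h0, ?_⟩
            have := hs.2
            simp only [Set.mem_Icc] at this hr
            rw [abs_le]
            constructor <;> linarith
        · rw [Set.indicator_of_notMem hr]
          have h0 : ∀ y, (Set.Icc (-R) R ×ˢ Set.Icc (-R) R).indicator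
              (fun p : ℝ × ℝ => ENNReal.ofReal (|p.1 - p.2| ^ a)) (r, y) = 0 := fun y =>
            Set.indicator_of_notMem (fun h => hr h.1) _
          simp only [h0, lintegral_zero, le_refl]
    _ < ∞ := by
        rw [lintegral_indicator measurableSet_Icc, setLIntegral_const]
        exact ENNReal.mul_lt_top hinner measure_Icc_lt_top

theorem measurable_smoothForm_slice [SFinite Λ] {t : ℝ} (ht : 0 < t) {φ : ℝ × Space d → ℝ}
    (hφ : Measurable φ) : Measurable fun p : ℝ × ℝ =>
      smoothForm Λ t (fun z => |φ (p.1, z)|) (fun z => |φ (p.2, z)|) := by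
  have hS := measurable_smoothKernel (Λ := Λ) ht
  refine Measurable.lintegral_prod_right' (f := fun q : (ℝ × ℝ) × Space d =>
    ∫⁻ z', ENNReal.ofReal |φ (q.1.1, q.2)| * ENNReal.ofReal |φ (q.1.2, z')| *
      smoothKernel Λ t (q.2 - z')) ?_
  exact Measurable.lintegral_prod_right' (f := fun q : ((ℝ × ℝ) × Space d) × Space d =>
    ENNReal.ofReal |φ (q.1.1.1, q.1.2)| * ENNReal.ofReal |φ (q.1.1.2, q.2)| *
      smoothKernel Λ t (q.1.2 - q.2)) (by fun_prop)

theorem energy_eq (H : ℝ) (φ : ℝ × Space d → ℝ) :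
    energy H Λ (fun r z => φ (r, z)) = ENNReal.ofReal (H * (2 * H - 1)) *
      ∫⁻ r, ∫⁻ s, ENNReal.ofReal (|r - s| ^ (2 * H - 2)) *
        covForm Λ (fun z => |φ (r, z)|) (fun z => |φ (s, z)|) := by
  simp only [energy, covForm, ← Real.norm_eq_abs, ofReal_norm]

theorem lintegral_specMeasure_damped {H : ℝ} [SFinite μ] {t : ℝ} [SFinite (damped μ t)]
    {F : ℝ × Space d → ℝ≥0∞} (hF : Measurable F) :
    ∫⁻ q, F q ∂(specMeasure H (damped μ t)) =
      ∫⁻ q, ENNReal.ofReal (Real.exp (-t * ‖q.2‖ ^ 2)) * F q ∂(specMeasure H μ) := by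
  rw [lintegral_specMeasure hF, lintegral_specMeasure (by fun_prop)]
  refine lintegral_congr fun τ => ?_
  congr 1
  rw [damped, lintegral_withDensity_eq_lintegral_mul _ (by fun_prop) (by fun_prop)]
  rfl

/-- Let the smoothing parameter tend to 0: dominated convergence on the side of the energy,
available for bounded functions of bounded support, and Fatou's lemma on the spectral side. -/
theorem lintegral_stFourier_le_of_bounded (h : IsSpectralMeasure Λ μ) {H : ℝ} (hH : 1 / 2 < H)
    (hH' : H < 1) : ∃ C : ℝ≥0∞, C ≠ ∞ ∧ ∀ (φ : ℝ × Space d → ℝ) (K R : ℝ), Measurable φ →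
      0 ≤ R → (∀ p, |φ p| ≤ K) → (∀ p, R < ‖p‖ → φ p = 0) →
    ∫⁻ q, ‖stFourier φ q‖ₑ ^ 2 ∂(specMeasure H μ) ≤ C * energy H Λ (fun r z => φ (r, z)) := by
  obtain ⟨C, hC, hle⟩ := lintegral_stFourier_spec_damped_le h hH hH'
  have hHpos : 0 < H * (2 * H - 1) := mul_pos (by linarith) (by linarith)
  refine ⟨C * (ENNReal.ofReal (H * (2 * H - 1)))⁻¹, ENNReal.mul_ne_top hC (by simpa using hHpos),
    fun φ K R hφ hR hK hsupp => ?_⟩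
  have := sigmaFinite_of_temperate h.temperate_cov
  have := sigmaFinite_of_temperate h.temperate_spec
  have hbump : ∀ r, IsBddBump K R (fun z => |φ (r, z)|) := fun r =>
    ⟨by fun_prop, fun z => abs_nonneg _, fun z => hK _, fun z hz => by
      rw [hsupp (r, z) (lt_of_lt_of_le hz (le_max_right _ _)), abs_zero]⟩
  have hint : Integrable φ := by
    have : φ = (Metric.closedBall (0 : ℝ × Space d) R).indicator φ := by
      ext p
      by_cases hp : p ∈ Metric.closedBall (0 : ℝ × Space d) R
      · rw [Set.indicator_of_mem hp]
      · rw [Set.indicator_of_notMem hp]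
        exact hsupp p (by simpa using hp)
    rw [this, integrable_indicator_iff measurableSet_closedBall]
    exact Measure.integrableOn_of_bounded measure_closedBall_lt_top.ne
      hφ.aestronglyMeasurable (ae_of_all _ hK)
  have hpos : ∀ n : ℕ, (0 : ℝ) < 1 / (n + 1) := fun n => by positivity
  have hone : ∀ n : ℕ, (1 : ℝ) / (n + 1) ≤ 1 := fun n => by
    rw [div_le_one (by positivity)]; linarith [Nat.cast_nonneg (α := ℝ) n]
  have hmF := measurable_stFourier hφ
  have hm2 : Measurable fun y => ‖stFourier φ y‖ₑ ^ 2 := by fun_prop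
  -- the limit of the smoothed forms
  have hmn : ∀ n : ℕ, Measurable fun p : ℝ × ℝ => ENNReal.ofReal (|p.1 - p.2| ^ (2 * H - 2)) *
      smoothForm Λ (1 / ((n : ℝ) + 1)) (fun z => |φ (p.1, z)|) (fun z => |φ (p.2, z)|) := fun n => by
    have := measurable_smoothForm_slice (Λ := Λ) (hpos n) hφ
    fun_prop
  have hlim_pt : ∀ p : ℝ × ℝ, Tendsto (fun n : ℕ => ENNReal.ofReal (|p.1 - p.2| ^ (2 * H - 2)) *
      smoothForm Λ (1 / ((n : ℝ) + 1)) (fun z => |φ (p.1, z)|) (fun z => |φ (p.2, z)|)) atTop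
      (𝓝 (ENNReal.ofReal (|p.1 - p.2| ^ (2 * H - 2)) *
        covForm Λ (fun z => |φ (p.1, z)|) (fun z => |φ (p.2, z)|))) := fun p =>
    ENNReal.Tendsto.const_mul (tendsto_smoothForm h.temperate_cov (hbump p.1) (hbump p.2))
      (Or.inr ENNReal.ofReal_ne_top)
  have hmlim : Measurable fun p : ℝ × ℝ => ENNReal.ofReal (|p.1 - p.2| ^ (2 * H - 2)) *
        covForm Λ (fun z => |φ (p.1, z)|) (fun z => |φ (p.2, z)|) :=
    measurable_of_tendsto_metrizable hmn (tendsto_pi_nhds.2 hlim_pt)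
  obtain ⟨B, hB, hBle⟩ := exists_smoothForm_le h.temperate_cov K R
  have hlim : Tendsto (fun n : ℕ => ∫⁻ p : ℝ × ℝ, ENNReal.ofReal (|p.1 - p.2| ^ (2 * H - 2)) *
      smoothForm Λ (1 / ((n : ℝ) + 1)) (fun z => |φ (p.1, z)|) (fun z => |φ (p.2, z)|)) atTop
      (𝓝 (∫⁻ p : ℝ × ℝ, ENNReal.ofReal (|p.1 - p.2| ^ (2 * H - 2)) *
        covForm Λ (fun z => |φ (p.1, z)|) (fun z => |φ (p.2, z)|))) := by
    refine tendsto_lintegral_of_dominated_convergence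
      (fun p => B * (Set.Icc (-R) R ×ˢ Set.Icc (-R) R).indicator
        (fun p => ENNReal.ofReal (|p.1 - p.2| ^ (2 * H - 2))) p) hmn (fun n => ae_of_all _ fun p => ?_)
      ?_ (ae_of_all _ hlim_pt)
    · have hzero : ∀ r, r ∉ Set.Icc (-R) R → ∀ z, φ (r, z) = 0 := fun r hr z => by
        refine hsupp _ (lt_of_lt_of_le ?_ (le_max_left _ _))
        simp only [Real.norm_eq_abs]
        by_contra hcon
        exact hr (abs_le.1 (not_lt.1 hcon))
      by_cases hp : p ∈ Set.Icc (-R) R ×ˢ Set.Icc (-R) R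
      · simp only [Set.indicator_of_mem hp]
        rw [mul_comm B]
        gcongr
        exact hBle _ _ (hbump _) (hbump _) _ (hpos n) (hone n)
      · have : smoothForm Λ (1 / ((n : ℝ) + 1)) (fun z => |φ (p.1, z)|) (fun z => |φ (p.2, z)|) = 0 := by
          rw [Set.mem_prod, not_and_or] at hp
          rcases hp with hp | hp <;> simp [smoothForm, hzero _ hp]
        simp only [this, mul_zero]
        exact zero_le
    · rw [lintegral_const_mul' _ _ hB]
      exact ENNReal.mul_ne_top hB
        (setLIntegral_rpow_abs_sub_lt_top (by linarith) (by linarith) hR).ne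
  -- lower semicontinuity on the spectral side
  have hfatou : ∫⁻ q, ‖stFourier φ q‖ₑ ^ 2 ∂(specMeasure H μ) ≤
      liminf (fun n : ℕ => ∫⁻ q, ‖stFourier φ q‖ₑ ^ 2
        ∂(specMeasure H (damped μ (1 / ((n : ℝ) + 1))))) atTop := by
    calc _ = ∫⁻ q, liminf (fun n : ℕ => ENNReal.ofReal
          (Real.exp (-(1 / ((n : ℝ) + 1)) * ‖q.2‖ ^ 2)) * ‖stFourier φ q‖ₑ ^ 2) atTop
          ∂(specMeasure H μ) := by
          refine lintegral_congr fun q => (Tendsto.liminf_eq ?_).symm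
          have := ENNReal.Tendsto.mul_const (b := ‖stFourier φ q‖ₑ ^ 2)
            ((ENNReal.continuous_ofReal.tendsto 1).comp
              (IsBddBump.tendsto_exp_damping (‖q.2‖ ^ 2)))
            (Or.inr (by finiteness))
          simpa using this
      _ ≤ liminf (fun n : ℕ => ∫⁻ q, ENNReal.ofReal
          (Real.exp (-(1 / ((n : ℝ) + 1)) * ‖q.2‖ ^ 2)) * ‖stFourier φ q‖ₑ ^ 2
          ∂(specMeasure H μ)) atTop := lintegral_liminf_le fun n => by fun_prop
      _ = _ := by
          congr 1
          ext n
          have := isFiniteMeasure_damped h.temperate_spec (hpos n)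
          rw [lintegral_specMeasure_damped hm2]
  calc _ ≤ _ := hfatou
    _ ≤ liminf (fun n : ℕ => C * ∫⁻ p : ℝ × ℝ, ENNReal.ofReal (|p.1 - p.2| ^ (2 * H - 2)) *
      smoothForm Λ (1 / ((n : ℝ) + 1)) (fun z => |φ (p.1, z)|) (fun z => |φ (p.2, z)|)) atTop := by
        refine liminf_le_liminf (Eventually.of_forall fun n => ?_)
        refine (hle φ hφ hint _ (hpos n)).trans (le_of_eq ?_)
        rw [show (volume : Measure (ℝ × ℝ)) = volume.prod volume from rfl,
          lintegral_prod _ (hmn n).aemeasurable]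
    _ = C * ∫⁻ p : ℝ × ℝ, ENNReal.ofReal (|p.1 - p.2| ^ (2 * H - 2)) *
        covForm Λ (fun z => |φ (p.1, z)|) (fun z => |φ (p.2, z)|) :=
        (ENNReal.Tendsto.const_mul hlim (Or.inr hC)).liminf_eq
    _ = _ := by
        rw [energy_eq, show (volume : Measure (ℝ × ℝ)) = volume.prod volume from rfl,
          lintegral_prod _ hmlim.aemeasurable, mul_assoc C, ← mul_assoc (_)⁻¹,
          ENNReal.inv_mul_cancel (by simpa using hHpos) ENNReal.ofReal_ne_top, one_mul]

/-- The spectral norm of an integrable function is controlled by its energy. -/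
theorem lintegral_stFourier_le (h : IsSpectralMeasure Λ μ) {H : ℝ} (hH : 1 / 2 < H)
    (hH' : H < 1) : ∃ C : ℝ≥0∞, C ≠ ∞ ∧ ∀ (φ : ℝ × Space d → ℝ), Measurable φ → Integrable φ →
    ∫⁻ q, ‖stFourier φ q‖ₑ ^ 2 ∂(specMeasure H μ) ≤ C * energy H Λ (fun r z => φ (r, z)) := by
  classical
  obtain ⟨C, hC, hle⟩ := lintegral_stFourier_le_of_bounded h hH hH'
  refine ⟨C, hC, fun φ hφ hint => ?_⟩
  -- Truncate values and support. The energy depends on |φ| monotonically, so it does not increase,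
  -- and by integrability the transforms converge pointwise, which is enough for Fatou's lemma.
  let ψ : ℕ → ℝ × Space d → ℝ := fun n p => if |φ p| ≤ n ∧ ‖p‖ ≤ n then φ p else 0
  have hψm : ∀ n, Measurable (ψ n) := fun n =>
    Measurable.ite (MeasurableSet.inter (s₁ := {p | |φ p| ≤ n}) (s₂ := {p | ‖p‖ ≤ n})
      (measurableSet_le (by fun_prop) measurable_const)
      (measurableSet_le (by fun_prop) measurable_const)) hφ measurable_const
  have hψle : ∀ n p, |ψ n p| ≤ |φ p| := fun n p => by
    simp only [ψ]; split_ifs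
    · exact le_rfl
    · simp
  have hlim : ∀ q, Tendsto (fun n => stFourier (ψ n) q) atTop (𝓝 (stFourier φ q)) := by
    intro q
    refine tendsto_integral_of_dominated_convergence (fun p => |φ p|) (fun n => ?_) hint.abs
      (fun n => ae_of_all _ fun p => ?_) (ae_of_all _ fun p => ?_)
    · have := hψm n
      have hc : Measurable fun p => stChar p q :=
        continuous_stChar.measurable.comp (measurable_id.prodMk measurable_const)
      exact Measurable.aestronglyMeasurable (by fun_prop)
    · rw [norm_mul, norm_stChar, one_mul, Complex.norm_real]
      exact hψle n p
    · refine tendsto_const_nhds.congr' ?_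
      obtain ⟨N, hN⟩ := exists_nat_ge (max |φ p| ‖p‖)
      filter_upwards [eventually_ge_atTop N] with n hn
      have hn' : (N : ℝ) ≤ n := by exact_mod_cast hn
      simp only [ψ]
      rw [if_pos ⟨(le_max_left _ _).trans (hN.trans hn'), (le_max_right _ _).trans (hN.trans hn')⟩]
  calc ∫⁻ q, ‖stFourier φ q‖ₑ ^ 2 ∂(specMeasure H μ)
      = ∫⁻ q, liminf (fun n => ‖stFourier (ψ n) q‖ₑ ^ 2) atTop ∂(specMeasure H μ) := by
        refine lintegral_congr fun q => (Tendsto.liminf_eq ?_).symm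
        exact ((ENNReal.continuous_pow 2).tendsto _).comp
          ((continuous_enorm.tendsto _).comp (hlim q))
    _ ≤ liminf (fun n => ∫⁻ q, ‖stFourier (ψ n) q‖ₑ ^ 2 ∂(specMeasure H μ)) atTop :=
        lintegral_liminf_le fun n => by
          have := measurable_stFourier (hψm n)
          fun_prop
    _ ≤ C * energy H Λ (fun r z => φ (r, z)) := by
        refine liminf_le_of_le (by isBoundedDefault) fun b hb => ?_
        obtain ⟨n, hn⟩ := hb.exists
        refine hn.trans ((hle (ψ n) n n (hψm n) (Nat.cast_nonneg n) (fun p => ?_)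
          fun p hp => ?_).trans ?_)
        · simp only [ψ]; split_ifs with h1
          · exact h1.1
          · simp
        · simp only [ψ]; rw [if_neg]
          exact fun h1 => absurd h1.2 (not_le.2 hp)
        · have he : ∀ p, ‖ψ n p‖ₑ ≤ ‖φ p‖ₑ := fun p => by
            rw [← ofReal_norm, ← ofReal_norm]
            exact ENNReal.ofReal_le_ofReal (hψle n p)
          unfold energy
          gcongr <;> exact he _

end

/-! ### Spectral representation of fractional Brownian motion. -/

section

open scoped ENNReal ComplexConjugate

/-- The density `(1 - cos τ)|τ|^{-1-2H}` whose integral normalises fractional Brownian motion. -/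
def fbmDensity (H τ : ℝ) : ℝ := (1 - Real.cos τ) * |τ| ^ (-1 - 2 * H)

theorem fbmDensity_nonneg (H τ : ℝ) : 0 ≤ fbmDensity H τ :=
  mul_nonneg (by linarith [Real.cos_le_one τ]) (by positivity)

theorem measurable_fbmDensity (H : ℝ) : Measurable (fbmDensity H) := by
  unfold fbmDensity; fun_prop

/-- Near 0 the factor 1 - cos is at most τ², leaving |τ|^{1-2H}, integrable as H < 1; at infinity it
is at most 2. -/
theorem integrable_fbmDensity {H : ℝ} (hH : 1 / 2 < H) (hH' : H < 1) :
    Integrable (fbmDensity H) := by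
  refine ⟨(measurable_fbmDensity H).aestronglyMeasurable, ?_⟩
  let f : ℝ → ℝ≥0∞ := fun x => ENNReal.ofReal ((1 - Real.cos x) * x ^ (-1 - 2 * H))
  have h1 : ∫⁻ τ, ‖fbmDensity H τ‖ₑ = ∫⁻ τ, f |τ| := by
    refine lintegral_congr fun τ => ?_
    rw [← ofReal_norm, Real.norm_of_nonneg (fbmDensity_nonneg _ _)]
    simp only [f, fbmDensity, Real.cos_abs]
  rw [hasFiniteIntegral_def, h1, lintegral_comp_abs, ← Set.Ioc_union_Ioi_eq_Ioi zero_le_one,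
    lintegral_union measurableSet_Ioi (Set.Ioc_disjoint_Ioi le_rfl)]
  have h2 : ∫⁻ x in Set.Ioc 0 1, f x ≤ ∫⁻ x in Set.Ioc (0 : ℝ) 1, ENNReal.ofReal (x ^ (1 - 2 * H)) := by
    refine setLIntegral_mono' measurableSet_Ioc fun x hx => ENNReal.ofReal_le_ofReal ?_
    have h3 : x ^ (1 - 2 * H) = x ^ 2 * x ^ (-1 - 2 * H) := by
      rw [← Real.rpow_natCast, ← Real.rpow_add hx.1]; congr 1; push_cast; ring
    rw [h3]
    have h4 := Real.one_sub_sq_div_two_le_cos (x := x)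
    have : 0 ≤ x ^ (-1 - 2 * H) := Real.rpow_nonneg hx.1.le _
    gcongr
    nlinarith [sq_nonneg x]
  have h3 : ∫⁻ x in Set.Ioi 1, f x ≤
      ∫⁻ x in Set.Ioi (1 : ℝ), ENNReal.ofReal 2 * ENNReal.ofReal (x ^ (-1 - 2 * H)) := by
    refine setLIntegral_mono' measurableSet_Ioi fun x hx => ?_
    rw [← ENNReal.ofReal_mul zero_le_two]
    apply ENNReal.ofReal_le_ofReal
    have : 0 ≤ x ^ (-1 - 2 * H) := Real.rpow_nonneg (zero_le_one.trans (le_of_lt hx)) _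
    gcongr
    linarith [Real.neg_one_le_cos x]
  rw [setLIntegral_Ioc_zero_rpow (by linarith) zero_le_one] at h2
  rw [lintegral_const_mul' _ _ ENNReal.ofReal_ne_top,
    setLIntegral_Ioi_rpow (by linarith) one_pos] at h3
  exact ENNReal.mul_lt_top (by simp) (ENNReal.add_lt_top.2
    ⟨h2.trans_lt ENNReal.ofReal_lt_top, h3.trans_lt (by finiteness)⟩)

/-- The normalising constant `∫ (1 - cos τ)|τ|^{-1-2H} dτ`. -/
def fbmConst (H : ℝ) : ℝ := ∫ τ, fbmDensity H τ

theorem fbmConst_pos {H : ℝ} (hH : 1 / 2 < H) (hH' : H < 1) : 0 < fbmConst H := by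
  rw [fbmConst, integral_pos_iff_support_of_nonneg (fbmDensity_nonneg H)
    (integrable_fbmDensity hH hH')]
  refine lt_of_lt_of_le ?_ (measure_mono (s := Set.Ioo (0 : ℝ) 1) fun x hx => ?_)
  · simp
  · have h1 : Real.cos x < Real.cos 0 :=
      Real.cos_lt_cos_of_nonneg_of_le_pi le_rfl (by linarith [hx.2, Real.pi_gt_three]) hx.1
    rw [Real.cos_zero] at h1
    have h2 : 0 < |x| := abs_pos.2 hx.1.ne'
    exact (mul_pos (by linarith) (Real.rpow_pos_of_pos h2 _)).ne'

theorem fbmDensity_mul {H t : ℝ} (τ : ℝ) :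
    (1 - Real.cos (t * τ)) * |τ| ^ (-1 - 2 * H) * |t| ^ (-1 - 2 * H) = fbmDensity H (t * τ) := by
  rw [fbmDensity, abs_mul, Real.mul_rpow (abs_nonneg _) (abs_nonneg _)]; ring

theorem integrable_one_sub_cos {H : ℝ} (hH : 1 / 2 < H) (hH' : H < 1) (t : ℝ) :
    Integrable fun τ => (1 - Real.cos (t * τ)) * |τ| ^ (-1 - 2 * H) := by
  rcases eq_or_ne t 0 with rfl | ht
  · simp
  have ht' : |t| ^ (-1 - 2 * H) ≠ 0 := (Real.rpow_pos_of_pos (abs_pos.2 ht) _).ne'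
  have := (integrable_fbmDensity hH hH').comp_mul_left' ht
  simp_rw [← fbmDensity_mul] at this
  exact (integrable_mul_const_iff (IsUnit.mk0 _ ht') _).1 this

/-- Scaling τ ↦ tτ; the value at t = 0 is consistent because 2H > 0. -/
theorem integral_one_sub_cos {H : ℝ} (hH : 1 / 2 < H) (t : ℝ) :
    ∫ τ, (1 - Real.cos (t * τ)) * |τ| ^ (-1 - 2 * H) = fbmConst H * |t| ^ (2 * H) := by
  rcases eq_or_ne t 0 with rfl | ht
  · rw [abs_zero, Real.zero_rpow (by linarith)]; simp
  have ht0 := abs_pos.2 ht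
  have h1 := Measure.integral_comp_mul_left (fbmDensity H) t
  simp_rw [← fbmDensity_mul] at h1
  rw [integral_mul_const] at h1
  have h2 : |t| ^ (2 * H) * |t| ^ (-1 - 2 * H) = |t⁻¹| := by
    rw [← Real.rpow_add ht0, show 2 * H + (-1 - 2 * H) = -1 by ring, Real.rpow_neg_one, abs_inv]
  have h3 : |t| ^ (-1 - 2 * H) ≠ 0 := (Real.rpow_pos_of_pos ht0 _).ne'
  apply mul_right_cancel₀ h3
  rw [h1, mul_assoc, h2, fbmConst, smul_eq_mul, mul_comm]

/-- The Fourier transform of the indicator of `(a, b]`. -/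
def timeHat (a b τ : ℝ) : ℂ := ∫ r in Set.Ioc a b, Complex.exp (((r * τ : ℝ) : ℂ) * Complex.I)

theorem measurable_timeHat (a b : ℝ) : Measurable (timeHat a b) := by
  have h : StronglyMeasurable fun q : ℝ × ℝ =>
      Complex.exp (((q.2 * q.1 : ℝ) : ℂ) * Complex.I) :=
    Measurable.stronglyMeasurable (by fun_prop)
  exact (h.integral_prod_right' (ν := volume.restrict (Set.Ioc a b))).measurable

theorem timeHat_eq {a b τ : ℝ} (hab : a ≤ b) (hτ : τ ≠ 0) :
    timeHat a b τ = (Complex.exp (((b * τ : ℝ) : ℂ) * Complex.I) -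
      Complex.exp (((a * τ : ℝ) : ℂ) * Complex.I)) / (Complex.I * τ) := by
  have hc : Complex.I * (τ : ℂ) ≠ 0 := mul_ne_zero Complex.I_ne_zero (by exact_mod_cast hτ)
  have := integral_exp_mul_complex (a := a) (b := b) hc
  rw [timeHat, ← intervalIntegral.integral_of_le hab]
  have e : ∀ r : ℝ, (((r * τ : ℝ) : ℂ) * Complex.I) = Complex.I * τ * r := fun r => by
    push_cast; ring
  simp_rw [e, this]

/-- The four cosines of the expanded product have coefficients adding up to 0, so each may be
replaced by minus its defect 1 - cos. The defects are separately integrable against |τ|^{-1-2H}; the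
cosines are not. -/
theorem re_timeHat_mul_conj {H a b a' b' τ : ℝ} (hab : a ≤ b) (hab' : a' ≤ b') (hτ : τ ≠ 0) :
    (timeHat a b τ * conj (timeHat a' b' τ)).re * |τ| ^ (1 - 2 * H) =
      (1 - Real.cos ((b - a') * τ)) * |τ| ^ (-1 - 2 * H) +
      (1 - Real.cos ((a - b') * τ)) * |τ| ^ (-1 - 2 * H) -
      (1 - Real.cos ((b - b') * τ)) * |τ| ^ (-1 - 2 * H) -
      (1 - Real.cos ((a - a') * τ)) * |τ| ^ (-1 - 2 * H) := by
  have h1 : |τ| ^ (1 - 2 * H) = τ ^ 2 * |τ| ^ (-1 - 2 * H) := by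
    rw [← sq_abs, ← Real.rpow_natCast, ← Real.rpow_add (abs_pos.2 hτ)]
    congr 1; push_cast; ring
  have h2 : timeHat a b τ * conj (timeHat a' b' τ) =
      ((Complex.exp (((b * τ : ℝ) : ℂ) * Complex.I) -
        Complex.exp (((a * τ : ℝ) : ℂ) * Complex.I)) *
      conj (Complex.exp (((b' * τ : ℝ) : ℂ) * Complex.I) -
        Complex.exp (((a' * τ : ℝ) : ℂ) * Complex.I))) / ((τ ^ 2 : ℝ) : ℂ) := by
    rw [timeHat_eq hab hτ, timeHat_eq hab' hτ, map_div₀, div_mul_div_comm]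
    congr 1
    simp only [map_mul, Complex.conj_I, Complex.conj_ofReal]
    push_cast
    linear_combination (-(τ : ℂ) ^ 2) * Complex.I_sq
  rw [h2, Complex.div_ofReal_re, h1]
  have h3 : ((Complex.exp (((b * τ : ℝ) : ℂ) * Complex.I) -
        Complex.exp (((a * τ : ℝ) : ℂ) * Complex.I)) *
      conj (Complex.exp (((b' * τ : ℝ) : ℂ) * Complex.I) -
        Complex.exp (((a' * τ : ℝ) : ℂ) * Complex.I))).re =
      Real.cos ((b - b') * τ) - Real.cos ((b - a') * τ) - Real.cos ((a - b') * τ) +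
        Real.cos ((a - a') * τ) := by
    rw [Complex.mul_re, Complex.conj_re, Complex.conj_im]
    simp only [Complex.sub_re, Complex.sub_im, Complex.exp_ofReal_mul_I_re,
      Complex.exp_ofReal_mul_I_im, sub_mul, Real.cos_sub]
    ring
  rw [h3]
  field_simp
  ring

theorem integral_timeMeasure {E : Type*} [NormedAddCommGroup E] [NormedSpace ℝ E] (H : ℝ)
    (f : ℝ → E) : ∫ τ, f τ ∂(timeMeasure H) = ∫ τ, |τ| ^ (1 - 2 * H) • f τ := by
  rw [timeMeasure, integral_withDensity_eq_integral_toReal_smul (by fun_prop)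
    (ae_of_all _ fun _ => ENNReal.ofReal_lt_top)]
  refine integral_congr_ae (ae_of_all _ fun τ => ?_)
  simp only
  rw [ENNReal.toReal_ofReal (by positivity)]

theorem memLp_timeHat {H : ℝ} (hH : 1 / 2 < H) (hH' : H < 1) {a b : ℝ} (hab : a ≤ b) :
    MemLp (timeHat a b) 2 (timeMeasure H) := by
  have hm := measurable_timeHat a b
  rw [memLp_two_iff_integrable_sq_norm hm.aestronglyMeasurable, timeMeasure,
    integrable_withDensity_iff_integrable_smul' (by fun_prop)
      (ae_of_all _ fun _ => ENNReal.ofReal_lt_top)]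
  have h1 := ((integrable_one_sub_cos hH hH' (b - a)).add
    (integrable_one_sub_cos hH hH' (a - b)))
  refine h1.congr ?_
  filter_upwards [Measure.ae_ne volume (0 : ℝ)] with τ hτ
  have h2 := re_timeHat_mul_conj (H := H) hab hab hτ
  rw [RCLike.mul_conj] at h2
  rw [ENNReal.toReal_ofReal (by positivity), smul_eq_mul, mul_comm (|τ| ^ _) (‖_‖ ^ 2)]
  simp only [sub_self, zero_mul, Real.cos_zero, sub_zero] at h2
  rw [Pi.add_apply, ← h2]
  congr 1
  norm_cast

theorem re_integral_timeHat_mul_conj {H : ℝ} (hH : 1 / 2 < H) (hH' : H < 1) {a b a' b' : ℝ}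
    (hab : a ≤ b) (hab' : a' ≤ b') :
    (∫ τ, timeHat a b τ * conj (timeHat a' b' τ) ∂(timeMeasure H)).re =
      fbmConst H * (|b - a'| ^ (2 * H) + |a - b'| ^ (2 * H) - |b - b'| ^ (2 * H) -
        |a - a'| ^ (2 * H)) := by
  have hint : Integrable (fun τ => timeHat a b τ * conj (timeHat a' b' τ)) (timeMeasure H) :=
    (memLp_timeHat hH hH' hab).integrable_mul (memLp_timeHat hH hH' hab').star
  rw [← RCLike.re_eq_complex_re, ← integral_re hint, integral_timeMeasure]
  have e : (fun τ => |τ| ^ (1 - 2 * H) •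
      (RCLike.re (timeHat a b τ * conj (timeHat a' b' τ)) : ℝ)) =ᵐ[volume]
      fun τ => (1 - Real.cos ((b - a') * τ)) * |τ| ^ (-1 - 2 * H) +
      (1 - Real.cos ((a - b') * τ)) * |τ| ^ (-1 - 2 * H) -
      (1 - Real.cos ((b - b') * τ)) * |τ| ^ (-1 - 2 * H) -
      (1 - Real.cos ((a - a') * τ)) * |τ| ^ (-1 - 2 * H) := by
    filter_upwards [Measure.ae_ne volume (0 : ℝ)] with τ hτ
    rw [← re_timeHat_mul_conj hab hab' hτ, smul_eq_mul, mul_comm]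
    rfl
  have i := integrable_one_sub_cos hH hH'
  rw [integral_congr_ae e, integral_sub ?_ (i _), integral_sub ?_ (i _),
    integral_add (i _) (i _)]
  · simp_rw [integral_one_sub_cos hH]
    ring
  · exact (i _).add (i _)
  · exact ((i _).add (i _)).sub (i _)

end

/-! ### The isometry for linear combinations of increments. -/

section

open scoped ENNReal ComplexConjugate

variable {d : ℕ} {Λ μ : Measure (Space d)}

theorem IsBddBump.mono {K R R' : ℝ} {f : Space d → ℝ} (hf : IsBddBump K R f) (h : R ≤ R') :
    IsBddBump K R' f :=
  ⟨hf.measurable, hf.nonneg, hf.le, fun x hx => hf.support x (h.trans_lt hx)⟩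

theorem exists_isBddBump_indicator {A : Set (Space d)} (hA : MeasurableSet A)
    (hb : Bornology.IsBounded A) : ∃ R, IsBddBump 1 R (A.indicator (1 : Space d → ℝ)) := by
  obtain ⟨R, hR⟩ := hb.exists_norm_le
  refine ⟨R, measurable_one.indicator hA, fun x => Set.indicator_nonneg (fun _ _ => zero_le_one) x,
    fun x => Set.indicator_le_self' (fun _ _ => zero_le_one) x, fun x hx => ?_⟩
  exact Set.indicator_of_notMem (fun h => absurd (hR x h) (not_le.2 hx)) _

/-- Rewrites the covariance of the noise in the form for which Parseval's identity is available. -/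
theorem spatialCov_eq {A B : Set (Space d)} (hA : MeasurableSet A) (hB : MeasurableSet B) :
    spatialCov Λ A B = (covForm Λ (A.indicator 1) (B.indicator 1)).toReal := by
  rw [spatialCov, covForm, ← lintegral_indicator hA]
  congr 1
  refine lintegral_congr fun z => ?_
  by_cases hz : z ∈ A
  · rw [Set.indicator_of_mem hz]
    simp only [Set.indicator_of_mem hz, Pi.one_apply, ENNReal.ofReal_one, one_mul]
    have hm : MeasurableSet {v | z - v ∈ B} := (measurable_const.sub measurable_id) hB
    rw [← lintegral_indicator_one hm]
    refine lintegral_congr fun v => ?_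
    by_cases hv : z - v ∈ B
    · rw [Set.indicator_of_mem hv, Set.indicator_of_mem (by exact hv)]; simp
    · rw [Set.indicator_of_notMem hv, Set.indicator_of_notMem (by exact hv)]; simp
  · simp [Set.indicator_of_notMem hz]

theorem memLp_hat_indicator (h : IsSpectralMeasure Λ μ) {A : Set (Space d)} (hA : MeasurableSet A)
    (hb : Bornology.IsBounded A) : MemLp (hat (A.indicator 1)) 2 μ := by
  obtain ⟨R, hR⟩ := exists_isBddBump_indicator hA hb
  exact IsBddBump.memLp_hat h hR

theorem integral_hat_indicator_mul_conj (h : IsSpectralMeasure Λ μ) {A B : Set (Space d)}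
    (hA : MeasurableSet A) (hAb : Bornology.IsBounded A) (hB : MeasurableSet B)
    (hBb : Bornology.IsBounded B) :
    ∫ ξ, hat (A.indicator 1) ξ * conj (hat (B.indicator 1) ξ) ∂μ =
      (((2 * Real.pi) ^ d * spatialCov Λ A B : ℝ) : ℂ) := by
  obtain ⟨R, hR⟩ := exists_isBddBump_indicator hA hAb
  obtain ⟨R', hR'⟩ := exists_isBddBump_indicator hB hBb
  rw [spatialCov_eq hA hB, IsBddBump.integral_hat_mul_conj h (hR.mono (le_max_left R R'))
    (hR'.mono (le_max_right R R'))]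

theorem eLpNorm_two_sq {α E : Type*} [MeasurableSpace α] [NormedAddCommGroup E] {m : Measure α}
    (f : α → E) : eLpNorm f 2 m ^ 2 = ∫⁻ x, ‖f x‖ₑ ^ 2 ∂m := by
  have := eLpNorm_nnreal_pow_eq_lintegral (μ := m) (f := f) (p := 2) two_ne_zero
  simpa using this

theorem eLpNorm_two_sq_eq_ofReal {α E : Type*} [MeasurableSpace α] [NormedAddCommGroup E]
    {m : Measure α} {f : α → E} (hf : MemLp f 2 m) :
    eLpNorm f 2 m ^ 2 = ENNReal.ofReal (∫ x, ‖f x‖ ^ 2 ∂m) := by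
  rw [eLpNorm_two_sq, ofReal_integral_eq_lintegral_ofReal
    ((memLp_two_iff_integrable_sq_norm hf.1).1 hf) (ae_of_all _ fun x => by positivity)]
  refine lintegral_congr fun x => ?_
  rw [ENNReal.ofReal_pow (norm_nonneg _), ofReal_norm]

/-- The constant relating the variance of a Wiener integral to the spectral norm. -/
def specConst (d : ℕ) (H : ℝ) : ℝ := (2 * fbmConst H)⁻¹ * ((2 * Real.pi) ^ d)⁻¹

theorem specConst_pos {H : ℝ} (hH : 1 / 2 < H) (hH' : H < 1) : 0 < specConst d H := by
  have := fbmConst_pos hH hH'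
  have := Real.pi_pos
  unfold specConst
  positivity

section Isometry

variable {Ω : Type*} [MeasurableSpace Ω] {P : Measure Ω} {T H : ℝ} {W : NoiseIndex d T → Ω → ℝ}

theorem IsFractionalNoise.memLp (hW : IsFractionalNoise P T H Λ W) (p : NoiseIndex d T) :
    MemLp (W p) 2 P :=
  (hW.gaussian.hasGaussianLaw_eval p).memLp_two

/-- The spectral transform of an increment of the noise. -/
def incrHat (p q : NoiseIndex d T) (x : ℝ × Space d) : ℂ :=
  timeHat q.1.1 p.1.1 x.1 * hat (p.1.2.indicator 1) x.2

theorem memLp_incrHat (h : IsSpectralMeasure Λ μ) (hH : 1 / 2 < H) (hH' : H < 1)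
    {p q : NoiseIndex d T} (hle : q.1.1 ≤ p.1.1) : MemLp (incrHat p q) 2 (specMeasure H μ) := by
  have := sigmaFinite_of_temperate h.temperate_spec
  have h1 := (memLp_two_iff_integrable_sq_norm (memLp_timeHat hH hH' hle).1).1
    (memLp_timeHat hH hH' hle)
  have hh := memLp_hat_indicator h p.2.2.1 p.2.2.2
  have h2 := (memLp_two_iff_integrable_sq_norm hh.1).1 hh
  have hm : AEStronglyMeasurable (incrHat p q) (specMeasure H μ) :=
    ((memLp_timeHat hH hH' hle).1.comp_fst (ν := μ)).mul hh.1.comp_snd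
  rw [memLp_two_iff_integrable_sq_norm hm]
  refine (h1.mul_prod h2).congr (ae_of_all _ fun x => ?_)
  simp only [incrHat, norm_mul, mul_pow]

/-- The transform of an increment is a product, so the integral factors into the fractional time
part and Parseval in space. The constant `specConst` cancels the normalisations c and (2π)^d, the 2
being the one in the fractional covariance. The real part is enough, since only real combinations
are formed. -/
theorem re_integral_incrHat_mul_conj (h : IsSpectralMeasure Λ μ) (hH : 1 / 2 < H) (hH' : H < 1)
    {p q p' q' : NoiseIndex d T} (hle : q.1.1 ≤ p.1.1) (hle' : q'.1.1 ≤ p'.1.1) :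
    specConst d H * (∫ x, incrHat p q x * conj (incrHat p' q' x) ∂(specMeasure H μ)).re =
      (fbmCov H p.1.1 p'.1.1 - fbmCov H p.1.1 q'.1.1 - fbmCov H q.1.1 p'.1.1 +
        fbmCov H q.1.1 q'.1.1) * spatialCov Λ p.1.2 p'.1.2 := by
  have := sigmaFinite_of_temperate h.temperate_spec
  have e : ∀ x, incrHat p q x * conj (incrHat p' q' x) =
      (timeHat q.1.1 p.1.1 x.1 * conj (timeHat q'.1.1 p'.1.1 x.1)) *
      (hat (p.1.2.indicator 1) x.2 * conj (hat (p'.1.2.indicator 1) x.2)) := by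
    intro x; simp only [incrHat, map_mul]; ring
  simp_rw [e]
  rw [specMeasure, integral_prod_mul
    (fun τ => timeHat q.1.1 p.1.1 τ * conj (timeHat q'.1.1 p'.1.1 τ))
    (fun ξ => hat (p.1.2.indicator 1) ξ * conj (hat (p'.1.2.indicator 1) ξ)),
    integral_hat_indicator_mul_conj h p.2.2.1 p.2.2.2 p'.2.2.1 p'.2.2.2, Complex.re_mul_ofReal,
    re_integral_timeHat_mul_conj hH hH' hle hle', specConst]
  have h1 := (fbmConst_pos hH hH').ne'
  have h2 : (2 * Real.pi) ^ d ≠ 0 := by have := Real.pi_pos; positivity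
  unfold fbmCov
  field_simp
  ring

/-- The isometry between linear combinations of increments of the noise and their spectral
transforms. -/
theorem IsFractionalNoise.eLpNorm_sum_sq (hW : IsFractionalNoise P T H Λ W)
    (h : IsSpectralMeasure Λ μ) (hH : 1 / 2 < H) (hH' : H < 1) {ι : Type*} [Fintype ι]
    (c : ι → ℝ) (p q : ι → NoiseIndex d T) (hA : ∀ i, (p i).1.2 = (q i).1.2)
    (hle : ∀ i, (q i).1.1 ≤ (p i).1.1) :
    eLpNorm (fun ω => ∑ i, c i * (W (p i) ω - W (q i) ω)) 2 P ^ 2 =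
      ENNReal.ofReal (specConst d H) *
        eLpNorm (fun x => ∑ i, (c i : ℂ) * incrHat (p i) (q i) x) 2 (specMeasure H μ) ^ 2 := by
  have hX : ∀ i, MemLp (fun ω => W (p i) ω - W (q i) ω) 2 P := fun i =>
    (hW.memLp (p i)).sub (hW.memLp (q i))
  have hV := fun i => memLp_incrHat h hH hH' (hle i)
  have hXs : MemLp (fun ω => ∑ i, c i * (W (p i) ω - W (q i) ω)) 2 P :=
    memLp_finsetSum _ fun i _ => (hX i).const_mul (c i)
  have hVs : MemLp (fun x => ∑ i, (c i : ℂ) * incrHat (p i) (q i) x) 2 (specMeasure H μ) :=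
    memLp_finsetSum _ fun i _ => (hV i).const_mul (c i : ℂ)
  rw [eLpNorm_two_sq_eq_ofReal hXs, eLpNorm_two_sq_eq_ofReal hVs,
    ← ENNReal.ofReal_mul (specConst_pos hH hH').le]
  congr 1
  have hcov : ∀ i j, ∫ ω, (W (p i) ω - W (q i) ω) * (W (p j) ω - W (q j) ω) ∂P =
      specConst d H * (∫ x, incrHat (p i) (q i) x * conj (incrHat (p j) (q j) x)
        ∂(specMeasure H μ)).re := by
    intro i j
    rw [re_integral_incrHat_mul_conj h hH hH' (hle i) (hle j)]
    have hi : ∀ a b, Integrable (fun ω => W a ω * W b ω) P := fun a b =>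
      (hW.memLp a).integrable_mul (hW.memLp b)
    have e : ∀ ω, (W (p i) ω - W (q i) ω) * (W (p j) ω - W (q j) ω) =
        W (p i) ω * W (p j) ω - W (p i) ω * W (q j) ω - W (q i) ω * W (p j) ω +
          W (q i) ω * W (q j) ω := fun ω => by ring
    simp_rw [e]
    rw [integral_add ?_ (hi _ _), integral_sub ?_ (hi _ _), integral_sub (hi _ _) (hi _ _)]
    · simp_rw [hW.covariance, ← hA]
      ring
    · exact (hi _ _).sub (hi _ _)
    · exact ((hi _ _).sub (hi _ _)).sub (hi _ _)
  have hL : ∫ ω, ‖∑ i, c i * (W (p i) ω - W (q i) ω)‖ ^ 2 ∂P = ∑ i, ∑ j, c i * c j *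
      ∫ ω, (W (p i) ω - W (q i) ω) * (W (p j) ω - W (q j) ω) ∂P := by
    have e : ∀ ω, ‖∑ i, c i * (W (p i) ω - W (q i) ω)‖ ^ 2 = ∑ i, ∑ j, c i * c j *
        ((W (p i) ω - W (q i) ω) * (W (p j) ω - W (q j) ω)) := fun ω => by
      rw [Real.norm_eq_abs, sq_abs, sq, Finset.sum_mul_sum]
      refine Finset.sum_congr rfl fun i _ => Finset.sum_congr rfl fun j _ => by ring
    have hi : ∀ i j, Integrable (fun ω => c i * c j *
        ((W (p i) ω - W (q i) ω) * (W (p j) ω - W (q j) ω))) P := fun i j =>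
      ((hX i).integrable_mul (hX j)).const_mul _
    simp_rw [e]
    rw [integral_finsetSum _ fun i _ => integrable_finsetSum _ fun j _ => hi i j]
    refine Finset.sum_congr rfl fun i _ => ?_
    rw [integral_finsetSum _ fun j _ => hi i j]
    exact Finset.sum_congr rfl fun j _ => integral_const_mul _ _
  have hR : ∫ x, ‖∑ i, (c i : ℂ) * incrHat (p i) (q i) x‖ ^ 2 ∂(specMeasure H μ) =
      ∑ i, ∑ j, c i * c j * (∫ x, incrHat (p i) (q i) x * conj (incrHat (p j) (q j) x)
        ∂(specMeasure H μ)).re := by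
    have hi : ∀ i j, Integrable (fun x => incrHat (p i) (q i) x * conj (incrHat (p j) (q j) x))
        (specMeasure H μ) := fun i j => (hV i).integrable_mul (hV j).star
    have e : ∀ x, ‖∑ i, (c i : ℂ) * incrHat (p i) (q i) x‖ ^ 2 = ∑ i, ∑ j, c i * c j *
        (incrHat (p i) (q i) x * conj (incrHat (p j) (q j) x)).re := fun x => by
      have h1 : ((‖∑ i, (c i : ℂ) * incrHat (p i) (q i) x‖ ^ 2 : ℝ) : ℂ) =
          (∑ i, (c i : ℂ) * incrHat (p i) (q i) x) *
            conj (∑ i, (c i : ℂ) * incrHat (p i) (q i) x) := by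
        rw [RCLike.mul_conj]; push_cast; rfl
      rw [← Complex.ofReal_re (‖_‖ ^ 2), h1, map_sum, Finset.sum_mul_sum, Complex.re_sum]
      refine Finset.sum_congr rfl fun i _ => ?_
      rw [Complex.re_sum]
      refine Finset.sum_congr rfl fun j _ => ?_
      rw [map_mul, Complex.conj_ofReal, mul_mul_mul_comm, ← Complex.ofReal_mul,
        Complex.re_ofReal_mul]
    have hir : ∀ i j, Integrable (fun x => c i * c j *
        (incrHat (p i) (q i) x * conj (incrHat (p j) (q j) x)).re) (specMeasure H μ) := fun i j =>
      (hi i j).re.const_mul _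
    simp_rw [e]
    rw [integral_finsetSum _ fun i _ => integrable_finsetSum _ fun j _ => hir i j]
    refine Finset.sum_congr rfl fun i _ => ?_
    rw [integral_finsetSum _ fun j _ => hir i j]
    refine Finset.sum_congr rfl fun j _ => ?_
    rw [integral_const_mul]
    congr 1
    exact integral_re (hi i j)
  rw [hL, hR, Finset.mul_sum]
  refine Finset.sum_congr rfl fun i _ => ?_
  rw [Finset.mul_sum]
  refine Finset.sum_congr rfl fun j _ => ?_
  rw [hcov]
  ring

end Isometry

end

/-! ### The isometry for Wiener integrals. -/

section

open scoped ENNReal ComplexConjugate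

variable {d : ℕ} {Λ μ : Measure (Space d)} {T H : ℝ}

namespace Elementary

/-- The right end of the `i`-th increment of an elementary integrand. -/
def upper (e : Elementary d T) (i : Fin e.n) : NoiseIndex d T :=
  ⟨(e.b i, e.A i), ⟨(e.a_nonneg i).trans (e.a_le_b i), e.b_le i⟩,
    e.measurableSet_A i, e.isBounded_A i⟩

/-- The left end of the `i`-th increment of an elementary integrand. -/
def lower (e : Elementary d T) (i : Fin e.n) : NoiseIndex d T :=
  ⟨(e.a i, e.A i), ⟨e.a_nonneg i, (e.a_le_b i).trans (e.b_le i)⟩,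
    e.measurableSet_A i, e.isBounded_A i⟩

theorem measurable_toFun (e : Elementary d T) :
    Measurable fun p : ℝ × Space d => e.toFun p.1 p.2 := by
  unfold toFun
  refine Finset.measurable_sum _ fun i _ => ?_
  have h1 : Measurable ((Set.Ioc (e.a i) (e.b i)).indicator (1 : ℝ → ℝ)) :=
    measurable_one.indicator measurableSet_Ioc
  have h2 : Measurable ((e.A i).indicator (1 : Space d → ℝ)) :=
    measurable_one.indicator (e.measurableSet_A i)
  fun_prop

theorem integrable_term (e : Elementary d T) (i : Fin e.n) :
    Integrable fun p : ℝ × Space d =>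
      e.c i * (Set.Ioc (e.a i) (e.b i)).indicator 1 p.1 * (e.A i).indicator 1 p.2 := by
  obtain ⟨R, hR⟩ := exists_isBddBump_indicator (e.measurableSet_A i) (e.isBounded_A i)
  have h1 : Integrable ((Set.Ioc (e.a i) (e.b i)).indicator (1 : ℝ → ℝ)) :=
    (integrable_indicator_iff measurableSet_Ioc).2 (integrableOn_const (by simp))
  exact (h1.const_mul (e.c i)).mul_prod hR.integrable

theorem integrable_toFun (e : Elementary d T) :
    Integrable fun p : ℝ × Space d => e.toFun p.1 p.2 :=
  integrable_finsetSum _ fun i _ => e.integrable_term i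

end Elementary

theorem integrable_stChar_mul {φ : ℝ × Space d → ℝ} (hφ : Integrable φ) (q : ℝ × Space d) :
    Integrable fun p => stChar p q * (φ p : ℂ) := by
  have hc : Measurable fun p => stChar p q :=
    continuous_stChar.measurable.comp (measurable_id.prodMk measurable_const)
  refine hφ.norm.mono' (hc.aestronglyMeasurable.mul hφ.ofReal.aestronglyMeasurable)
    (ae_of_all _ fun p => ?_)
  rw [norm_mul, norm_stChar, one_mul, Complex.norm_real]

theorem stFourier_sub {φ ψ : ℝ × Space d → ℝ} (hφ : Integrable φ) (hψ : Integrable ψ)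
    (q : ℝ × Space d) :
    stFourier (fun p => φ p - ψ p) q = stFourier φ q - stFourier ψ q := by
  rw [stFourier, stFourier, stFourier,
    ← integral_sub (integrable_stChar_mul hφ q) (integrable_stChar_mul hψ q)]
  refine integral_congr_ae (ae_of_all _ fun p => ?_)
  simp only
  push_cast
  ring

theorem Elementary.stFourier_toFun (e : Elementary d T) (x : ℝ × Space d) :
    stFourier (fun p => e.toFun p.1 p.2) x =
      ∑ i, (e.c i : ℂ) * incrHat (e.upper i) (e.lower i) x := by
  unfold stFourier toFun
  simp_rw [Complex.ofReal_sum, Finset.mul_sum]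
  rw [integral_finsetSum _ fun i _ => integrable_stChar_mul (e.integrable_term i) x]
  refine Finset.sum_congr rfl fun i _ => ?_
  have h1 : timeHat (e.a i) (e.b i) x.1 = ∫ r : ℝ, Complex.exp (((r * x.1 : ℝ) : ℂ) * Complex.I) *
      (((Set.Ioc (e.a i) (e.b i)).indicator (1 : ℝ → ℝ) r : ℝ) : ℂ) := by
    rw [timeHat, ← integral_indicator measurableSet_Ioc]
    refine integral_congr_ae (ae_of_all _ fun r => ?_)
    by_cases hr : r ∈ Set.Ioc (e.a i) (e.b i) <;> simp [hr]
  change _ = (e.c i : ℂ) * (timeHat (e.a i) (e.b i) x.1 * hat ((e.A i).indicator 1) x.2)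
  rw [h1, hat, ← integral_prod_mul, ← integral_const_mul]
  refine integral_congr_ae (ae_of_all _ fun p => ?_)
  simp only [stChar]
  push_cast
  ring

section Limit

variable {Ω : Type*} [MeasurableSpace Ω] {P : Measure Ω} {W : NoiseIndex d T → Ω → ℝ}

/-- The difference of two elementary integrals is one linear combination of increments, indexed by
the disjoint union of the two index sets. -/
theorem Elementary.eLpNorm_integral_sub_sq (hW : IsFractionalNoise P T H Λ W)
    (h : IsSpectralMeasure Λ μ) (hH : 1 / 2 < H) (hH' : H < 1) (e e' : Elementary d T) :
    eLpNorm (fun ω => e.integral W ω - e'.integral W ω) 2 P ^ 2 =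
      ENNReal.ofReal (specConst d H) *
        eLpNorm (fun x => stFourier (fun p => e.toFun p.1 p.2) x -
          stFourier (fun p => e'.toFun p.1 p.2) x) 2 (specMeasure H μ) ^ 2 := by
  have key := hW.eLpNorm_sum_sq h hH hH' (ι := Fin e.n ⊕ Fin e'.n)
    (Sum.elim e.c fun i => -e'.c i) (Sum.elim e.upper e'.upper) (Sum.elim e.lower e'.lower)
    (by rintro (i | i) <;> rfl) (by
      rintro (i | i)
      · exact e.a_le_b i
      · exact e'.a_le_b i)
  simp only [Fintype.sum_sum_type, Sum.elim_inl, Sum.elim_inr, Complex.ofReal_neg, neg_mul,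
    Finset.sum_neg_distrib, ← sub_eq_add_neg, ← Elementary.stFourier_toFun] at key
  exact key

theorem tendsto_eLpNorm_of_sub {α E : Type*} [MeasurableSpace α] [NormedAddCommGroup E]
    {m : Measure α} {f : ℕ → α → E} {g : α → E} (hf : ∀ n, AEStronglyMeasurable (f n) m)
    (hg : AEStronglyMeasurable g m)
    (h : Tendsto (fun n => eLpNorm (fun x => f n x - g x) 2 m) atTop (𝓝 0)) :
    Tendsto (fun n => eLpNorm (f n) 2 m) atTop (𝓝 (eLpNorm g 2 m)) := by
  have h1 : ∀ n, eLpNorm (f n) 2 m ≤ eLpNorm g 2 m + eLpNorm (fun x => f n x - g x) 2 m := by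
    intro n
    have := eLpNorm_add_le hg ((hf n).sub hg) (p := 2) one_le_two
    rw [add_sub_cancel] at this
    exact this
  have h2 : ∀ n, eLpNorm g 2 m - eLpNorm (fun x => f n x - g x) 2 m ≤ eLpNorm (f n) 2 m := by
    intro n
    rw [tsub_le_iff_right]
    have := eLpNorm_sub_le (hf n) ((hf n).sub hg) (p := 2) one_le_two
    rw [sub_sub_cancel] at this
    exact this
  refine tendsto_of_tendsto_of_tendsto_of_le_of_le ?_ ?_ h2 h1
  · simpa using ENNReal.Tendsto.sub (tendsto_const_nhds (x := eLpNorm g 2 m)) h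
      (Or.inr ENNReal.zero_ne_top)
  · simpa using (tendsto_const_nhds (x := eLpNorm g 2 m)).add h

theorem tendsto_eLpNorm_two_sub {α E : Type*} [MeasurableSpace α] [NormedAddCommGroup E]
    {m : Measure α} {f f' : ℕ → α → E} {g g' : α → E} (hf : ∀ n, AEStronglyMeasurable (f n) m)
    (hg : AEStronglyMeasurable g m) (hf' : ∀ n, AEStronglyMeasurable (f' n) m)
    (hg' : AEStronglyMeasurable g' m)
    (h : Tendsto (fun n => eLpNorm (fun x => f n x - g x) 2 m) atTop (𝓝 0))
    (h' : Tendsto (fun n => eLpNorm (fun x => f' n x - g' x) 2 m) atTop (𝓝 0)) :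
    Tendsto (fun n => eLpNorm (fun x => f n x - f' n x) 2 m) atTop
      (𝓝 (eLpNorm (fun x => g x - g' x) 2 m)) := by
  refine tendsto_eLpNorm_of_sub (fun n => (hf n).sub (hf' n)) (hg.sub hg') ?_
  refine tendsto_of_tendsto_of_tendsto_of_le_of_le tendsto_const_nhds
    (by simpa using h.add h') (fun n => zero_le) fun n => ?_
  have := eLpNorm_sub_le ((hf n).sub hg) ((hf' n).sub hg') (p := 2) one_le_two
  refine le_trans (le_of_eq ?_) this
  congr 1
  ext x
  simp only [Pi.sub_apply]
  abel

/-- The approximation is given in energy; `lintegral_stFourier_le` carries it over to L² of the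
spectral measure. Integrability of φ is what makes its transform a genuine function. -/
theorem IsWienerIntegral.exists_approx (h : IsSpectralMeasure Λ μ)
    (hH : 1 / 2 < H) (hH' : H < 1)
    {φ : ℝ → Space d → ℝ} {X : Ω → ℝ} (hX : IsWienerIntegral P H Λ W φ X)
    (hφm : Measurable (Function.uncurry φ)) (hφ : Integrable (Function.uncurry φ)) :
    ∃ e : ℕ → Elementary d T,
      Tendsto (fun n => eLpNorm (fun ω => (e n).integral W ω - X ω) 2 P) atTop (𝓝 0) ∧
      Tendsto (fun n => eLpNorm (fun x => stFourier (fun p => (e n).toFun p.1 p.2) x -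
        stFourier (Function.uncurry φ) x) 2 (specMeasure H μ)) atTop (𝓝 0) := by
  obtain ⟨-, e, he, hlim⟩ := hX
  refine ⟨e, hlim, ?_⟩
  obtain ⟨C, hC, hle⟩ := lintegral_stFourier_le h hH hH'
  have h1 : Tendsto (fun n => eLpNorm (fun x => stFourier (fun p => (e n).toFun p.1 p.2) x -
        stFourier (Function.uncurry φ) x) 2 (specMeasure H μ) ^ 2) atTop (𝓝 0) := by
    have h2 : Tendsto (fun n => C * energy H Λ (fun s y => (e n).toFun s y - φ s y)) atTop (𝓝 0) := by
      simpa using ENNReal.Tendsto.const_mul he (Or.inr hC)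
    refine tendsto_of_tendsto_of_tendsto_of_le_of_le tendsto_const_nhds h2
      (fun n => zero_le) fun n => ?_
    have h3 := hle (fun p => (e n).toFun p.1 p.2 - Function.uncurry φ p)
      ((e n).measurable_toFun.sub hφm) ((e n).integrable_toFun.sub hφ)
    simp only
    rw [eLpNorm_two_sq]
    simp_rw [← stFourier_sub (e n).integrable_toFun hφ]
    exact h3
  have h4 := (ENNReal.continuous_rpow_const (y := 1 / 2)).tendsto 0 |>.comp h1
  rw [ENNReal.zero_rpow_of_pos (by norm_num)] at h4
  refine h4.congr fun n => ?_
  simp only [Function.comp]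
  rw [← ENNReal.rpow_natCast, ← ENNReal.rpow_mul]
  norm_num

/-- The isometry between Wiener integrals and spectral transforms. -/
theorem IsWienerIntegral.eLpNorm_sub_sq (h : IsSpectralMeasure Λ μ)
    (hW : IsFractionalNoise P T H Λ W) (hH : 1 / 2 < H) (hH' : H < 1)
    {φ ψ : ℝ → Space d → ℝ} {X Y : Ω → ℝ} (hX : IsWienerIntegral P H Λ W φ X)
    (hY : IsWienerIntegral P H Λ W ψ Y)
    (hφm : Measurable (Function.uncurry φ)) (hφ : Integrable (Function.uncurry φ))
    (hψm : Measurable (Function.uncurry ψ)) (hψ : Integrable (Function.uncurry ψ)) :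
    eLpNorm (fun ω => X ω - Y ω) 2 P ^ 2 = ENNReal.ofReal (specConst d H) *
      eLpNorm (fun x => stFourier (Function.uncurry φ) x - stFourier (Function.uncurry ψ) x) 2
        (specMeasure H μ) ^ 2 := by
  obtain ⟨e, he1, he2⟩ := hX.exists_approx h hH hH' hφm hφ
  obtain ⟨e', he1', he2'⟩ := hY.exists_approx h hH hH' hψm hψ
  have hI : ∀ e : Elementary d T, AEStronglyMeasurable (e.integral W) P := fun e => by
    unfold Elementary.integral
    exact (memLp_finsetSum _ fun i _ =>
      ((hW.memLp (e.upper i)).sub (hW.memLp (e.lower i))).const_mul (e.c i)).1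
  have hF : ∀ e : Elementary d T, AEStronglyMeasurable
      (stFourier fun p => e.toFun p.1 p.2) (specMeasure H μ) := fun e =>
    (measurable_stFourier e.measurable_toFun).aestronglyMeasurable
  have l1 := tendsto_eLpNorm_two_sub (fun n => hI (e n)) hX.1.1 (fun n => hI (e' n)) hY.1.1 he1 he1'
  have l2 := tendsto_eLpNorm_two_sub (fun n => hF (e n))
    (measurable_stFourier hφm).aestronglyMeasurable (fun n => hF (e' n))
    (measurable_stFourier hψm).aestronglyMeasurable he2 he2'
  have l1' := ((ENNReal.continuous_pow 2).tendsto _).comp l1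
  have l2' := ENNReal.Tendsto.const_mul (a := ENNReal.ofReal (specConst d H))
    (((ENNReal.continuous_pow 2).tendsto _).comp l2) (Or.inr ENNReal.ofReal_ne_top)
  refine tendsto_nhds_unique l1' (l2'.congr fun n => ?_)
  exact (Elementary.eLpNorm_integral_sub_sq hW h hH hH' (e n) (e' n)).symm

end Limit

end

/-! ### The transform of the heat kernel and the reduction to a Riesz weight. -/

section

open scoped ENNReal

variable {d : ℕ}

/-- The integrand of the Wiener integral defining the solution of the heat equation. -/
def solKernel (t : ℝ) (x : Space d) (s : ℝ) (y : Space d) : ℝ :=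
  (Set.Ioc 0 t).indicator (fun r => heatKernel (t - r) (x - y)) s

/-- The time factor of the space-time Fourier transform of `solKernel`. -/
def solHat (t τ ρ : ℝ) : ℂ :=
  (Complex.exp ((t * τ : ℝ) * Complex.I) - (Real.exp (-t * ρ) : ℂ)) / (ρ + τ * Complex.I)

theorem measurable_solKernel (t : ℝ) (x : Space d) :
    Measurable (Function.uncurry (solKernel t x)) := by
  have h1 : Measurable fun p : ℝ × Space d => heatKernel (t - p.1) (x - p.2) := by
    unfold heatKernel
    refine Measurable.ite (measurableSet_lt measurable_const (by fun_prop)) ?_ measurable_const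
    fun_prop
  exact h1.indicator (measurable_fst measurableSet_Ioc)

theorem solKernel_of_mem {t r : ℝ} (hr : r ∈ Set.Ioo 0 t) (x : Space d) :
    solKernel t x r = fun y => heatKernel (t - r) (x - y) := by
  funext y
  exact Set.indicator_of_mem (Set.Ioo_subset_Ioc_self hr) _

/-- At the end point r = t the kernel is 0 because `heatKernel 0` is; hence the open interval serves
where the definition has a half-open one. -/
theorem solKernel_of_notMem {t r : ℝ} (hr : r ∉ Set.Ioo 0 t) (x : Space d) :
    solKernel t x r = 0 := by
  funext y
  by_cases h : r ∈ Set.Ioc 0 t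
  · have : r = t := by
      by_contra hne
      exact hr ⟨h.1, lt_of_le_of_ne h.2 hne⟩
    simp [solKernel, this, heatKernel]
  · exact Set.indicator_of_notMem h _

/-- The heat kernel has mass one at each time in (0,t), so the total mass is finite. -/
theorem integrable_solKernel (t : ℝ) (x : Space d) :
    Integrable (Function.uncurry (solKernel t x)) := by
  refine (integrable_prod_iff (measurable_solKernel t x).aestronglyMeasurable).2 ⟨?_, ?_⟩
  · refine ae_of_all _ fun r => ?_
    change Integrable (solKernel t x r)
    by_cases hr : r ∈ Set.Ioo 0 t
    · rw [solKernel_of_mem hr]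
      exact (integrable_heatKernel (sub_pos.2 hr.2)).comp_sub_left x
    · rw [solKernel_of_notMem hr]
      exact integrable_zero _ _ _
  · have : (fun r => ∫ y, ‖Function.uncurry (solKernel t x) (r, y)‖) =
        (Set.Ioo 0 t).indicator 1 := by
      funext r
      change ∫ y, ‖solKernel t x r y‖ = _
      by_cases hr : r ∈ Set.Ioo 0 t
      · rw [Set.indicator_of_mem hr, solKernel_of_mem hr]
        simp only [Real.norm_of_nonneg (heatKernel_nonneg _ _), Pi.one_apply]
        rw [integral_sub_left_eq_self (fun y => heatKernel (t - r) y) volume x]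
        exact integral_heatKernel (sub_pos.2 hr.2)
      · rw [Set.indicator_of_notMem hr, solKernel_of_notMem hr]
        simp
    rw [this]
    exact (integrable_indicator_iff measurableSet_Ioo).2 (integrableOn_const (by simp))

/-- The spatial transform is e^{ix·ξ} e^{-(t-r)|ξ|²}, an exponential in r that integrates
explicitly. Excluding ξ = 0 keeps the denominator |ξ|² + iτ away from 0 for every τ. -/
theorem stFourier_solKernel {t : ℝ} (ht : 0 ≤ t) (x : Space d) (τ : ℝ) {ξ : Space d}
    (hξ : ξ ≠ 0) :
    stFourier (Function.uncurry (solKernel t x)) (τ, ξ) =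
      spaceChar x ξ * solHat t τ (‖ξ‖ ^ 2) := by
  have hρ : 0 < ‖ξ‖ ^ 2 := by have := norm_pos_iff.2 hξ; positivity
  set ρ := ‖ξ‖ ^ 2 with hρd
  have hc : (ρ + τ * Complex.I : ℂ) ≠ 0 := by
    intro h
    have := congrArg Complex.re h
    simp at this
    exact hρ.ne' this
  rw [stFourier, Measure.volume_eq_prod,
    integral_prod (fun p => stChar p (τ, ξ) * ((Function.uncurry (solKernel t x) p : ℝ) : ℂ))
      (integrable_stChar_mul (integrable_solKernel t x) (τ, ξ))]
  have h1 : ∀ r : ℝ, ∫ y, stChar (r, y) (τ, ξ) * ((Function.uncurry (solKernel t x) (r, y) : ℝ) : ℂ) =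
      (Set.Ioo 0 t).indicator (fun r : ℝ => spaceChar x ξ * (Real.exp (-t * ρ) : ℂ) *
        Complex.exp ((ρ + τ * Complex.I) * r)) r := by
    intro r
    by_cases hr : r ∈ Set.Ioo 0 t
    · rw [Set.indicator_of_mem hr]
      have key := fourierTransform_heatKernel (sub_pos.2 hr.2) x ξ
      have h2 : ∀ y, stChar (r, y) (τ, ξ) * ((Function.uncurry (solKernel t x) (r, y) : ℝ) : ℂ) =
          Complex.exp ((r * τ : ℝ) * Complex.I) *
            (Complex.exp (Complex.I * ((inner ℝ y ξ : ℝ) : ℂ)) * (heatKernel (t - r) (x - y) : ℂ)) := by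
        intro y
        rw [Function.uncurry_apply_pair, solKernel_of_mem hr, stChar, spaceChar, mul_assoc]
      simp_rw [h2]
      rw [integral_const_mul]
      rw [fourierTransform] at key
      rw [key, spaceChar, ← hρd]
      push_cast
      rw [← Complex.exp_add, ← Complex.exp_add, ← Complex.exp_add, ← Complex.exp_add]
      congr 1
      ring
    · rw [Set.indicator_of_notMem hr]
      simp only [Function.uncurry_apply_pair, solKernel_of_notMem hr]
      simp
  simp_rw [h1]
  rw [integral_indicator measurableSet_Ioo, ← integral_Ioc_eq_integral_Ioo,
    ← intervalIntegral.integral_of_le ht, intervalIntegral.integral_const_mul,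
    integral_exp_mul_complex hc, mul_assoc, solHat, mul_div_assoc', mul_sub]
  congr 3
  · rw [Complex.ofReal_exp, ← Complex.exp_add]
    congr 1
    push_cast
    ring
  · simp

/-- The integral against `|τ|^{1-2H} dτ` of the squared modulus of the transform of the difference
of two integrands. -/
def spectralDensity (H : ℝ) (t : ℝ) (x : Space d) (s : ℝ) (y : Space d) (ξ : Space d) : ℝ≥0∞ :=
  ∫⁻ τ, ENNReal.ofReal (|τ| ^ (1 - 2 * H)) *
    ‖spaceChar x ξ * solHat t τ (‖ξ‖ ^ 2) - spaceChar y ξ * solHat s τ (‖ξ‖ ^ 2)‖ₑ ^ 2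

/-- The variance of the increments for the spectral measure `|ξ|^{-α} dξ`. -/
def rieszVariance (α H : ℝ) (t : ℝ) (x : Space d) (s : ℝ) (y : Space d) : ℝ≥0∞ :=
  ∫⁻ ξ, spectralDensity H t x s y ξ * ENNReal.ofReal (‖ξ‖ ^ (-α))

section Variance

variable {Λ μ : Measure (Space d)} {T H α k₁ k₂ : ℝ} {Ω : Type*} [MeasurableSpace Ω]
  {P : Measure Ω} {W : NoiseIndex d T → Ω → ℝ} {u : ℝ → Space d → Ω → ℝ}

theorem IsHeatSolution.memLp (hu : IsHeatSolution P H Λ W u) {t : ℝ} (ht : t ∈ Set.Icc 0 T)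
    (x : Space d) : MemLp (u t x) 2 P := (hu t ht x).1

theorem IsHeatSolution.variance_bounds [Nontrivial (Space d)] (hu : IsHeatSolution P H Λ W u)
    (hW : IsFractionalNoise P T H Λ W) (h : IsSpectralMeasure Λ μ)
    (hR : RieszComparable α k₁ k₂ μ) (hH : 1 / 2 < H) (hH' : H < 1)
    {t s : ℝ} (ht : t ∈ Set.Icc 0 T) (hs : s ∈ Set.Icc 0 T) (x y : Space d) :
    ENNReal.ofReal (specConst d H) * (ENNReal.ofReal k₁ * rieszVariance α H t x s y) ≤
        ENNReal.ofReal (∫ ω, (u t x ω - u s y ω) ^ 2 ∂P) ∧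
      ENNReal.ofReal (∫ ω, (u t x ω - u s y ω) ^ 2 ∂P) ≤
        ENNReal.ofReal (specConst d H) * (ENNReal.ofReal k₂ * rieszVariance α H t x s y) := by
  have := sigmaFinite_of_temperate h.temperate_spec
  have e0 : ENNReal.ofReal (∫ ω, (u t x ω - u s y ω) ^ 2 ∂P) =
      eLpNorm (fun ω => u t x ω - u s y ω) 2 P ^ 2 := by
    refine Eq.trans ?_ (eLpNorm_two_sq_eq_ofReal ((hu.memLp ht x).sub (hu.memLp hs y))).symm
    simp [sq_abs]
  have e1 := IsWienerIntegral.eLpNorm_sub_sq h hW hH hH' (hu t ht x) (hu s hs y)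
    (measurable_solKernel t x) (integrable_solKernel t x)
    (measurable_solKernel s y) (integrable_solKernel s y)
  set F : ℝ × Space d → ℝ≥0∞ := fun q => ‖stFourier (Function.uncurry (solKernel t x)) q -
    stFourier (Function.uncurry (solKernel s y)) q‖ₑ ^ 2 with hF
  have hFm : Measurable F := ((measurable_stFourier (measurable_solKernel t x)).sub
    (measurable_stFourier (measurable_solKernel s y))).enorm.pow_const 2
  -- The comparison with the Riesz weight is applied to G, defined at every ξ by the transform
  -- itself. The explicit formula enters only after μ is gone, when ξ = 0 is a Lebesgue null set.
  set G : Space d → ℝ≥0∞ := fun ξ => ∫⁻ τ, ENNReal.ofReal (|τ| ^ (1 - 2 * H)) * F (τ, ξ) with hG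
  have hGm2 : Measurable fun q : ℝ × Space d => ENNReal.ofReal (|q.1| ^ (1 - 2 * H)) * F q := by
    fun_prop
  have hGm : Measurable G := hGm2.lintegral_prod_left'
  have e2 : eLpNorm (fun x' => stFourier (Function.uncurry (solKernel t x)) x' -
      stFourier (Function.uncurry (solKernel s y)) x') 2 (specMeasure H μ) ^ 2 =
      ∫⁻ ξ, G ξ ∂μ := by
    rw [eLpNorm_two_sq, lintegral_specMeasure hFm, hG,
      ← lintegral_lintegral_swap (f := fun τ ξ => ENNReal.ofReal (|τ| ^ (1 - 2 * H)) * F (τ, ξ))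
        hGm2.aemeasurable]
    simp_rw [lintegral_const_mul' _ _ ENNReal.ofReal_ne_top]
  have e3 : ∫⁻ ξ, G ξ * ENNReal.ofReal (‖ξ‖ ^ (-α)) = rieszVariance α H t x s y := by
    refine lintegral_congr_ae ?_
    filter_upwards [Measure.ae_ne volume (0 : Space d)] with ξ hξ
    simp only [hG, hF, spectralDensity, stFourier_solKernel ht.1 _ _ hξ,
      stFourier_solKernel hs.1 _ _ hξ]
  have hb := hR G hGm
  rw [e3] at hb
  rw [e0]
  have e4 : eLpNorm (fun ω => u t x ω - u s y ω) 2 P ^ 2 =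
    ENNReal.ofReal (specConst d H) * ∫⁻ ξ, G ξ ∂μ := by
    rw [← e2]
    exact e1
  rw [e4]
  exact ⟨mul_le_mul_right hb.1 _, mul_le_mul_right hb.2 _⟩

end Variance

end

/-! ### Radial integrals. -/

section

open scoped ENNReal

theorem setLIntegral_Ioc_rpow {a b p : ℝ} (ha : 0 < a) (hab : a ≤ b) :
    ∫⁻ x in Set.Ioc a b, ENNReal.ofReal (x ^ p) = ENNReal.ofReal (∫ x in a..b, x ^ p) := by
  have hi : IntervalIntegrable (fun x : ℝ => x ^ p) volume a b :=
    intervalIntegral.intervalIntegrable_rpow (Or.inr (Set.notMem_uIcc_of_lt ha (ha.trans_le hab)))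
  rw [intervalIntegrable_iff_integrableOn_Ioc_of_le hab] at hi
  rw [intervalIntegral.integral_of_le hab, ofReal_integral_eq_lintegral_ofReal hi]
  filter_upwards [ae_restrict_mem measurableSet_Ioc] with x hx
  exact Real.rpow_nonneg (ha.trans hx.1).le _

/-- Two-sided bounds for `∫ ρ^{1-θ}` over `[1/L, 1/r]`, with a logarithm in the critical case. -/
theorem exists_setLIntegral_rpow_bounds (θ : ℝ) {L : ℝ} (hL : 0 < L) (n : ℕ)
    (hn : n = open Classical in if θ = 2 then 1 else 0) :
    ∃ c C : ℝ, 0 < c ∧ 0 < C ∧ ∀ r, 0 < r → Real.exp 1 * r ≤ L →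
      ENNReal.ofReal (c * (Real.log (L / r) ^ n * r ^ (min 2 θ - 2))) ≤
          ∫⁻ ρ in Set.Ioc (1 / L) (1 / r), ENNReal.ofReal (ρ ^ (1 - θ)) ∧
        ∫⁻ ρ in Set.Ioc (1 / L) (1 / r), ENNReal.ofReal (ρ ^ (1 - θ)) ≤
          ENNReal.ofReal (C * (Real.log (L / r) ^ n * r ^ (min 2 θ - 2))) := by
  have hle : ∀ {r : ℝ}, 0 < r → Real.exp 1 * r ≤ L → 1 / L ≤ 1 / r := fun {r} hr h =>
    one_div_le_one_div_of_le hr (by nlinarith [Real.add_one_le_exp 1])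
  have hI : ∀ {r : ℝ}, 0 < r → Real.exp 1 * r ≤ L → θ ≠ 2 →
      ∫⁻ ρ in Set.Ioc (1 / L) (1 / r), ENNReal.ofReal (ρ ^ (1 - θ)) =
        ENNReal.ofReal ((r ^ (θ - 2) - L ^ (θ - 2)) / (2 - θ)) := by
    intro r hr h hθ
    rw [setLIntegral_Ioc_rpow (by positivity) (hle hr h), integral_rpow (Or.inr ⟨fun h => hθ (by
      linarith), Set.notMem_uIcc_of_lt (by positivity) (by positivity)⟩)]
    rw [one_div, one_div, Real.inv_rpow hr.le, Real.inv_rpow hL.le, ← Real.rpow_neg hr.le,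
      ← Real.rpow_neg hL.le]
    congr 2 <;> ring_nf
  rcases lt_trichotomy θ 2 with hθ | hθ | hθ
  · rw [if_neg hθ.ne] at hn
    have h2 : 0 < 2 - θ := by linarith
    refine ⟨(1 - Real.exp 1 ^ (θ - 2)) / (2 - θ), 1 / (2 - θ), ?_, by positivity, fun r hr h => ?_⟩
    · have := Real.rpow_lt_one_of_one_lt_of_neg (Real.one_lt_exp_iff.2 one_pos)
        (show θ - 2 < 0 by linarith)
      exact div_pos (by linarith) h2
    · rw [hI hr h hθ.ne, hn, pow_zero, one_mul, min_eq_right hθ.le]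
      -- For the lower bound: e·r ≤ L keeps the end points apart by a factor at least e, so the end
      -- point that is subtracted removes only a fixed fraction. The case θ > 2 is the mirror image.
      have h3 : L ^ (θ - 2) ≤ Real.exp 1 ^ (θ - 2) * r ^ (θ - 2) := by
        rw [← Real.mul_rpow (Real.exp_pos 1).le hr.le]
        exact Real.rpow_le_rpow_of_nonpos (by positivity) h (by linarith)
      constructor
      · apply ENNReal.ofReal_le_ofReal
        rw [div_mul_eq_mul_div]
        gcongr
        linarith
      · apply ENNReal.ofReal_le_ofReal
        rw [div_mul_eq_mul_div]
        gcongr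
        have : 0 < L ^ (θ - 2) := by positivity
        linarith
  · rw [if_pos hθ] at hn
    refine ⟨1, 1, one_pos, one_pos, fun r hr h => ?_⟩
    rw [setLIntegral_Ioc_rpow (by positivity) (hle hr h), hn, hθ]
    have : ∫ x in (1 / L)..(1 / r), x ^ ((1 : ℝ) - 2) = Real.log (L / r) := by
      have h1 : ∀ x : ℝ, x ^ ((1 : ℝ) - 2) = x⁻¹ := fun x => by
        rw [show (1 : ℝ) - 2 = -1 by norm_num, Real.rpow_neg_one]
      simp_rw [h1]
      rw [integral_inv_of_pos (by positivity) (by positivity)]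
      congr 1
      field_simp
    rw [this]
    simp
  · rw [if_neg hθ.ne'] at hn
    have h2 : 0 < θ - 2 := by linarith
    have hLp : 0 < L ^ (θ - 2) := by positivity
    refine ⟨L ^ (θ - 2) * (1 - Real.exp 1 ^ (-(θ - 2))) / (θ - 2), L ^ (θ - 2) / (θ - 2), ?_,
      by positivity, fun r hr h => ?_⟩
    · have := Real.rpow_lt_one_of_one_lt_of_neg (Real.one_lt_exp_iff.2 one_pos)
        (show -(θ - 2) < 0 by linarith)
      exact div_pos (mul_pos hLp (by linarith)) h2
    · rw [hI hr h hθ.ne', hn, pow_zero, one_mul, min_eq_left hθ.le, sub_self, Real.rpow_zero,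
        mul_one, mul_one]
      have h3 : r ^ (θ - 2) ≤ L ^ (θ - 2) * Real.exp 1 ^ (-(θ - 2)) := by
        rw [Real.rpow_neg (Real.exp_pos 1).le, ← div_eq_mul_inv, ← Real.div_rpow hL.le
          (Real.exp_pos 1).le]
        exact Real.rpow_le_rpow hr.le (by rw [le_div_iff₀ (Real.exp_pos 1)]; linarith) h2.le
      have h4 : (r ^ (θ - 2) - L ^ (θ - 2)) / (2 - θ) = (L ^ (θ - 2) - r ^ (θ - 2)) / (θ - 2) := by
        rw [← neg_sub (L ^ _), ← neg_sub θ 2, neg_div_neg_eq]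
      rw [h4]
      constructor
      · apply ENNReal.ofReal_le_ofReal
        gcongr
        linarith
      · apply ENNReal.ofReal_le_ofReal
        gcongr
        have : 0 < r ^ (θ - 2) := by positivity
        linarith

variable {d : ℕ}

/-- Integration in polar coordinates. -/
theorem exists_lintegral_norm_mul_rpow (hd : 0 < d) :
    ∃ ω : ℝ, 0 < ω ∧ ∀ (a : ℝ) (f : ℝ → ℝ≥0∞), Measurable f →
      ∫⁻ ξ : Space d, f ‖ξ‖ * ENNReal.ofReal (‖ξ‖ ^ a) =
        ENNReal.ofReal ω * ∫⁻ ρ in Set.Ioi (0 : ℝ), f ρ * ENNReal.ofReal (ρ ^ (d - 1 + a)) := by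
  have : Nonempty (Fin d) := ⟨⟨0, hd⟩⟩
  have : Nontrivial (Space d) := inferInstance
  set m : Measure (Space d) := volume
  have htop : m.toSphere Set.univ ≠ ∞ := measure_ne_top _ _
  have hpos : m.toSphere Set.univ ≠ 0 := by
    rw [Measure.toSphere_apply_univ]
    refine mul_ne_zero ?_ (Metric.measure_ball_pos _ _ one_pos).ne'
    simpa using hd.ne'
  refine ⟨(m.toSphere Set.univ).toReal, ENNReal.toReal_pos hpos htop, fun a f hf => ?_⟩
  rw [ENNReal.ofReal_toReal htop]
  set g : ℝ → ℝ≥0∞ := fun ρ => f ρ * ENNReal.ofReal (ρ ^ a) with hg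
  have hgm : Measurable g := by fun_prop
  calc ∫⁻ ξ, g ‖ξ‖ ∂m = ∫⁻ x : ({(0)}ᶜ : Set (Space d)), g ‖x.1‖ ∂(m.comap (↑)) := by
        rw [lintegral_subtype_comap (measurableSet_singleton _).compl fun x => g ‖x‖,
          restrict_compl_singleton]
    _ = ∫⁻ x, g x.2 ∂m.toSphere.prod (.volumeIoiPow (Module.finrank ℝ (Space d) - 1)) := by
        have := m.measurePreserving_homeomorphUnitSphereProd.lintegral_comp
          (f := fun x => g x.2) (by fun_prop)
        simpa using this
    _ = m.toSphere Set.univ * ∫⁻ x : Set.Ioi (0 : ℝ), g x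
          ∂(Measure.volumeIoiPow (Module.finrank ℝ (Space d) - 1)) := by
        rw [lintegral_prod _ (by fun_prop)]
        simp only [lintegral_const]
        rw [mul_comm]
    _ = _ := by
        congr 1
        rw [finrank_euclideanSpace_fin, Measure.volumeIoiPow,
          lintegral_withDensity_eq_lintegral_mul _ (by fun_prop) (by fun_prop)]
        simp only [Pi.mul_apply]
        rw [lintegral_subtype_comap measurableSet_Ioi
          fun x : ℝ => ENNReal.ofReal (x ^ (d - 1)) * g x]
        refine setLIntegral_congr_fun measurableSet_Ioi fun x hx => ?_
        have hx : 0 < x := hx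
        simp only [hg]
        rw [Real.rpow_add hx, ENNReal.ofReal_mul (by positivity)]
        have : x ^ ((d : ℝ) - 1) = x ^ (d - 1) := by
          rw [← Real.rpow_natCast, Nat.cast_sub hd, Nat.cast_one]
        rw [this]
        ring

/-- The second moments of a radial measure. -/
theorem lintegral_inner_sq_mul (f : ℝ → ℝ≥0∞) (hf : Measurable f) (z : Space d) :
    d * ∫⁻ ξ : Space d, ENNReal.ofReal (inner ℝ z ξ ^ 2) * f ‖ξ‖ =
      ENNReal.ofReal (‖z‖ ^ 2) * ∫⁻ ξ : Space d, ENNReal.ofReal (‖ξ‖ ^ 2) * f ‖ξ‖ := by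
  have hrot : ∀ w : Space d, ‖w‖ = ‖z‖ →
      ∫⁻ ξ : Space d, ENNReal.ofReal (inner ℝ w ξ ^ 2) * f ‖ξ‖ =
        ∫⁻ ξ : Space d, ENNReal.ofReal (inner ℝ z ξ ^ 2) * f ‖ξ‖ := by
    intro w hw
    -- The reflection exchanging two vectors of equal norm preserves both Lebesgue measure and ‖ξ‖.
    -- Summing over the rescaled basis vectors ‖z‖eᵢ then gives the trace identity.
    set R := (ℝ ∙ (w - z))ᗮ.reflection with hR
    have hRw : R w = z := Submodule.reflection_sub hw
    refine Eq.symm ?_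
    rw [← R.measurePreserving.lintegral_comp (by fun_prop)]
    refine lintegral_congr fun ξ => ?_
    rw [← hRw, R.inner_map_map, R.norm_map]
  have hsum : ∀ ξ : Space d, ∑ i : Fin d,
      inner ℝ (‖z‖ • EuclideanSpace.basisFun (Fin d) ℝ i) ξ ^ 2 = ‖z‖ ^ 2 * ‖ξ‖ ^ 2 := by
    intro ξ
    rw [EuclideanSpace.real_norm_sq_eq ξ, Finset.mul_sum]
    refine Finset.sum_congr rfl fun i _ => ?_
    rw [real_inner_smul_left, mul_pow, EuclideanSpace.basisFun_apply,
      EuclideanSpace.inner_single_left]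
    simp
  calc d * ∫⁻ ξ : Space d, ENNReal.ofReal (inner ℝ z ξ ^ 2) * f ‖ξ‖
      = ∑ i : Fin d, ∫⁻ ξ : Space d, ENNReal.ofReal
          (inner ℝ (‖z‖ • EuclideanSpace.basisFun (Fin d) ℝ i) ξ ^ 2) * f ‖ξ‖ := by
        rw [Finset.sum_congr rfl fun i _ => hrot _ (by simp [norm_smul])]
        simp
    _ = ∫⁻ ξ : Space d, (∑ i : Fin d, ENNReal.ofReal
          (inner ℝ (‖z‖ • EuclideanSpace.basisFun (Fin d) ℝ i) ξ ^ 2)) * f ‖ξ‖ := by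
        rw [← lintegral_finsetSum _ fun i _ => by fun_prop]
        simp_rw [Finset.sum_mul]
    _ = _ := by
        rw [← lintegral_const_mul' _ _ ENNReal.ofReal_ne_top]
        refine lintegral_congr fun ξ => ?_
        rw [← ENNReal.ofReal_sum_of_nonneg fun i _ => sq_nonneg _, hsum,
          ENNReal.ofReal_mul (by positivity), mul_assoc]

end

/-! ### Upper bounds at a fixed spatial frequency. -/

section

open scoped ENNReal

variable {d : ℕ}

theorem enorm_sq_eq_ofReal {E : Type*} [SeminormedAddCommGroup E] (z : E) :
    ‖z‖ₑ ^ 2 = ENNReal.ofReal (‖z‖ ^ 2) := by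
  rw [← ofReal_norm, ENNReal.ofReal_pow (norm_nonneg _)]

theorem setLIntegral_Ioi_eq_add {a b : ℝ} (hab : a ≤ b) (f : ℝ → ℝ≥0∞) :
    ∫⁻ x in Set.Ioi a, f x = (∫⁻ x in Set.Ioc a b, f x) + ∫⁻ x in Set.Ioi b, f x := by
  rw [← lintegral_union measurableSet_Ioi Set.Ioc_disjoint_Ioi_same, Set.Ioc_union_Ioi_eq_Ioi hab]

/-- A function bounded by a power near the origin and by another power at infinity. -/
theorem setLIntegral_Ioi_zero_le {p q b : ℝ} (hp : -1 < p) (hq : p - q < -1) (hb : 0 < b)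
    {f : ℝ → ℝ≥0∞} (h1 : ∀ x, 0 < x → x ≤ b → f x ≤ ENNReal.ofReal (b ^ (-q) * x ^ p))
    (h2 : ∀ x, b < x → f x ≤ ENNReal.ofReal (x ^ (p - q))) :
    ∫⁻ x in Set.Ioi 0, f x ≤
      ENNReal.ofReal ((1 / (p + 1) + 1 / (q - p - 1)) * b ^ (p + 1 - q)) := by
  have hp' : 0 < p + 1 := by linarith
  have hq' : 0 < q - p - 1 := by linarith
  rw [setLIntegral_Ioi_eq_add hb.le]
  calc _ ≤ (∫⁻ x in Set.Ioc 0 b, ENNReal.ofReal (b ^ (-q)) * ENNReal.ofReal (x ^ p)) +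
        ∫⁻ x in Set.Ioi b, ENNReal.ofReal (x ^ (p - q)) := by
        refine add_le_add (setLIntegral_mono' measurableSet_Ioc fun x hx => ?_)
          (setLIntegral_mono' measurableSet_Ioi fun x hx => h2 x hx)
        rw [← ENNReal.ofReal_mul (by positivity)]
        exact h1 x hx.1 hx.2
    _ = _ := by
        have e : b ^ (p + 1 - q) = b ^ (-q) * b ^ (p + 1) := by
          rw [← Real.rpow_add hb]; ring_nf
        rw [lintegral_const_mul' _ _ ENNReal.ofReal_ne_top, setLIntegral_Ioc_zero_rpow hp hb.le,
          setLIntegral_Ioi_rpow hq hb, ← ENNReal.ofReal_mul (by positivity),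
          ← ENNReal.ofReal_add (by positivity), show p - q + 1 = p + 1 - q by ring]
        · congr 1
          rw [show p + 1 - q = -(q - p - 1) by ring, div_neg, neg_div, neg_neg,
            show -(q - p - 1) = p + 1 - q by ring, add_mul, e]
          ring
        · rw [show p - q + 1 = -(q - p - 1) by ring, div_neg, neg_div, neg_neg]
          positivity

theorem abs_exp_neg_sub_exp_neg_le {a b : ℝ} (ha : 0 ≤ a) (hb : 0 ≤ b) :
    |Real.exp (-a) - Real.exp (-b)| ≤ 1 ∧ |Real.exp (-a) - Real.exp (-b)| ≤ |a - b| := by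
  have ha1 := Real.exp_le_one_iff.2 (neg_nonpos.2 ha)
  have hb1 := Real.exp_le_one_iff.2 (neg_nonpos.2 hb)
  have ha0 := Real.exp_pos (-a)
  have hb0 := Real.exp_pos (-b)
  refine ⟨abs_le.2 ⟨by linarith, by linarith⟩, ?_⟩
  have key : ∀ {a b : ℝ}, 0 ≤ a → Real.exp (-a) - Real.exp (-b) ≤ |a - b| := by
    intro a b ha
    have ha1 := Real.exp_le_one_iff.2 (neg_nonpos.2 ha)
    have ha0 := Real.exp_pos (-a)
    have h1 : Real.exp (-b) = Real.exp (-a) * Real.exp (a - b) := by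
      rw [← Real.exp_add]; ring_nf
    have h2 := Real.add_one_le_exp (a - b)
    have h3 := neg_abs_le (a - b)
    have h4 := abs_nonneg (a - b)
    rw [h1]
    nlinarith [mul_le_mul_of_nonneg_left h2 ha0.le]
  refine abs_le.2 ⟨?_, key ha⟩
  have := key (b := a) hb
  rw [abs_sub_comm] at this
  linarith

theorem norm_ofReal_add_mul_I_ge (ρ τ : ℝ) :
    |ρ| ≤ ‖(ρ + τ * Complex.I : ℂ)‖ ∧ |τ| ≤ ‖(ρ + τ * Complex.I : ℂ)‖ := by
  have h1 := Complex.abs_re_le_norm (ρ + τ * Complex.I : ℂ)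
  have h2 := Complex.abs_im_le_norm (ρ + τ * Complex.I : ℂ)
  simp at h1 h2
  exact ⟨h1, h2⟩

/-- The difference of numerators is at most 1 + 1 + 1, and also at most |t-s||τ| + |t-s|ρ ≤ 2|t-s||ρ
+ iτ|. The denominator dominates both ρ and |τ|. -/
theorem norm_solHat_sub_le {t s ρ : ℝ} (ht : 0 ≤ t) (hs : 0 ≤ s) (hρ : 0 < ρ) (τ : ℝ) :
    ‖solHat t τ ρ - solHat s τ ρ‖ ≤ 3 * min |t - s| ρ⁻¹ ∧
      |τ| * ‖solHat t τ ρ - solHat s τ ρ‖ ≤ 3 := by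
  obtain ⟨hr, hi⟩ := norm_ofReal_add_mul_I_ge ρ τ
  rw [abs_of_pos hρ] at hr
  set D := ‖(ρ + τ * Complex.I : ℂ)‖ with hD
  have hD0 : 0 < D := hρ.trans_le hr
  obtain ⟨he1, he2⟩ := abs_exp_neg_sub_exp_neg_le (mul_nonneg ht hρ.le) (mul_nonneg hs hρ.le)
  set N := ‖(Complex.exp ((t * τ : ℝ) * Complex.I) - Complex.exp ((s * τ : ℝ) * Complex.I)) -
    ((Real.exp (-(t * ρ)) - Real.exp (-(s * ρ)) : ℝ) : ℂ)‖ with hN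
  have hND : ‖solHat t τ ρ - solHat s τ ρ‖ = N / D := by
    rw [solHat, solHat, ← sub_div, norm_div, ← hD, hN]
    congr 2
    push_cast
    ring_nf
  have hN1 : N ≤ 3 := by
    refine (norm_sub_le _ _).trans ?_
    have h1 := norm_sub_le (Complex.exp ((t * τ : ℝ) * Complex.I))
      (Complex.exp ((s * τ : ℝ) * Complex.I))
    rw [Complex.norm_exp_ofReal_mul_I, Complex.norm_exp_ofReal_mul_I] at h1
    rw [Complex.norm_real, Real.norm_eq_abs]
    linarith
  have hN2 : N ≤ 2 * |t - s| * D := by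
    refine (norm_sub_le _ _).trans ?_
    have h1 : ‖Complex.exp ((t * τ : ℝ) * Complex.I) - Complex.exp ((s * τ : ℝ) * Complex.I)‖ ≤
        |t - s| * |τ| := by
      have e : Complex.exp ((t * τ : ℝ) * Complex.I) - Complex.exp ((s * τ : ℝ) * Complex.I) =
          Complex.exp ((s * τ : ℝ) * Complex.I) *
            (Complex.exp (Complex.I * (((t - s) * τ : ℝ) : ℂ)) - 1) := by
        rw [mul_sub, ← Complex.exp_add, mul_one]
        congr 2
        push_cast
        ring
      rw [e, norm_mul, Complex.norm_exp_ofReal_mul_I, one_mul, ← abs_mul]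
      exact Real.norm_exp_I_mul_ofReal_sub_one_le
    rw [Complex.norm_real, Real.norm_eq_abs]
    have h2 : |t * ρ - s * ρ| = |t - s| * ρ := by rw [← sub_mul, abs_mul, abs_of_pos hρ]
    rw [h2] at he2
    nlinarith [abs_nonneg (t - s)]
  rw [hND]
  refine ⟨?_, ?_⟩
  · rw [mul_min_of_nonneg _ _ (by norm_num)]
    refine le_min ?_ ?_
    · rw [div_le_iff₀ hD0]
      nlinarith [mul_nonneg (abs_nonneg (t - s)) hD0.le]
    · rw [← div_eq_mul_inv]
      exact div_le_div₀ (by norm_num) hN1 hρ hr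
  · rw [mul_div_assoc', div_le_iff₀ hD0]
    have : 0 ≤ N := norm_nonneg _
    nlinarith [abs_nonneg τ]

/-- The constant in the time integral. -/
def timeConst (H : ℝ) : ℝ := 18 * (1 / (1 - 2 * H + 1) + 1 / (2 - (1 - 2 * H) - 1))

theorem timeConst_pos {H : ℝ} (hH : 1 / 2 < H) (hH' : H < 1) : 0 < timeConst H := by
  have h1 : 0 < 1 - 2 * H + 1 := by linarith
  have h2 : 0 < 2 - (1 - 2 * H) - 1 := by linarith
  unfold timeConst
  positivity

/-- The square is at most 9 min(η, 1/|τ|)², η being the minimum in the bound; cut the integral at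
|τ| = 1/η. The factor 18 in `timeConst` is this 9 doubled for negative τ. -/
theorem lintegral_solHat_sub_le {H : ℝ} (hH : 1 / 2 < H) (hH' : H < 1) {t s ρ : ℝ} (ht : 0 ≤ t)
    (hs : 0 ≤ s) (hρ : 0 < ρ) :
    ∫⁻ τ, ENNReal.ofReal (|τ| ^ (1 - 2 * H)) * ‖solHat t τ ρ - solHat s τ ρ‖ₑ ^ 2 ≤
      ENNReal.ofReal (timeConst H * min |t - s| ρ⁻¹ ^ (2 * H)) := by
  rcases eq_or_ne t s with rfl | hts
  · simp
  set η := min |t - s| ρ⁻¹ with hη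
  have hη0 : 0 < η := lt_min (abs_pos.2 (sub_ne_zero.2 hts)) (by positivity)
  set f : ℝ → ℝ≥0∞ := fun r => ENNReal.ofReal (r ^ (1 - 2 * H)) *
    ENNReal.ofReal (min η r⁻¹ ^ 2) with hf
  have hpt : ∀ τ, ENNReal.ofReal (|τ| ^ (1 - 2 * H)) * ‖solHat t τ ρ - solHat s τ ρ‖ₑ ^ 2 ≤
      9 * f |τ| := by
    intro τ
    rcases eq_or_ne τ 0 with rfl | hτ
    · rw [abs_zero, Real.zero_rpow (by linarith)]
      simp
    obtain ⟨h1, h2⟩ := norm_solHat_sub_le ht hs hρ τ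
    have hτ0 : 0 < |τ| := abs_pos.2 hτ
    have h3 : ‖solHat t τ ρ - solHat s τ ρ‖ ≤ 3 * min η |τ|⁻¹ := by
      rw [mul_min_of_nonneg _ _ (by norm_num)]
      refine le_min h1 ?_
      rw [← div_eq_mul_inv, le_div_iff₀ hτ0]
      linarith
    rw [hf, enorm_sq_eq_ofReal, mul_left_comm]
    gcongr
    rw [show (9 : ℝ≥0∞) = ENNReal.ofReal 9 by norm_num, ← ENNReal.ofReal_mul (by norm_num)]
    apply ENNReal.ofReal_le_ofReal
    calc _ ≤ (3 * min η |τ|⁻¹) ^ 2 := by gcongr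
      _ = _ := by ring
  have hint : ∫⁻ r in Set.Ioi 0, f r ≤ ENNReal.ofReal
      ((1 / (1 - 2 * H + 1) + 1 / (2 - (1 - 2 * H) - 1)) * η⁻¹ ^ (1 - 2 * H + 1 - 2)) := by
    refine setLIntegral_Ioi_zero_le (by linarith) (by linarith) (by positivity) ?_ ?_
    · intro x hx _
      simp only [hf]
      rw [← ENNReal.ofReal_mul (by positivity)]
      apply ENNReal.ofReal_le_ofReal
      rw [mul_comm]
      have : η⁻¹ ^ (-2 : ℝ) = η ^ 2 := by
        rw [Real.inv_rpow hη0.le, Real.rpow_neg hη0.le, inv_inv]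
        norm_num
      rw [this]
      gcongr
      exact min_le_left _ _
    · intro x hx
      have hx0 : 0 < x := (inv_pos.2 hη0).trans hx
      simp only [hf]
      rw [← ENNReal.ofReal_mul (by positivity)]
      apply ENNReal.ofReal_le_ofReal
      have : x ^ (1 - 2 * H - 2) = x ^ (1 - 2 * H) * x⁻¹ ^ 2 := by
        rw [Real.rpow_sub hx0, inv_pow, div_eq_mul_inv]
        norm_num
      rw [this]
      gcongr
      exact min_le_right _ _
  calc _ ≤ ∫⁻ τ, 9 * f |τ| := lintegral_mono hpt
    _ = 9 * (2 * ∫⁻ r in Set.Ioi 0, f r) := by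
        rw [lintegral_const_mul' _ _ (by norm_num), lintegral_comp_abs]
    _ ≤ 9 * (2 * ENNReal.ofReal
      ((1 / (1 - 2 * H + 1) + 1 / (2 - (1 - 2 * H) - 1)) * η⁻¹ ^ (1 - 2 * H + 1 - 2))) := by gcongr
    _ = _ := by
      rw [← mul_assoc, show (9 * 2 : ℝ≥0∞) = ENNReal.ofReal 18 by norm_num,
        ← ENNReal.ofReal_mul (by norm_num), timeConst, ← mul_assoc]
      congr 2
      rw [Real.inv_rpow hη0.le, ← Real.rpow_neg hη0.le]
      ring_nf

theorem norm_spaceChar_sub_sq_le (x y ξ : Space d) :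
    ‖spaceChar x ξ - spaceChar y ξ‖ ^ 2 ≤ min 4 (‖ξ‖ ^ 2 * ‖x - y‖ ^ 2) := by
  have e : spaceChar x ξ - spaceChar y ξ = spaceChar y ξ *
      (Complex.exp (Complex.I * ((inner ℝ (x - y) ξ : ℝ) : ℂ)) - 1) := by
    rw [spaceChar, spaceChar, mul_sub, ← Complex.exp_add, mul_one, inner_sub_left]
    congr 2
    push_cast
    ring
  refine le_min ?_ ?_
  · have := norm_sub_le (spaceChar x ξ) (spaceChar y ξ)
    rw [norm_spaceChar, norm_spaceChar] at this
    nlinarith [norm_nonneg (spaceChar x ξ - spaceChar y ξ)]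
  · rw [e, norm_mul, norm_spaceChar, one_mul, ← mul_pow]
    gcongr
    refine Real.norm_exp_I_mul_ofReal_sub_one_le.trans ?_
    rw [mul_comm]
    exact norm_inner_le_norm _ _

theorem solHat_zero (τ ρ : ℝ) : solHat 0 τ ρ = 0 := by simp [solHat]

theorem measurable_solHat (t : ℝ) : Measurable fun q : ℝ × ℝ => solHat t q.1 q.2 := by
  unfold solHat; fun_prop

/-- Separates the two increments: first the time changes at the point x, then the point changes at
the later of the two arguments, and (p+q)² ≤ 2p² + 2q². -/
theorem enorm_spaceChar_mul_sub_sq_le (x y ξ : Space d) (a b : ℂ) :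
    ‖spaceChar x ξ * a - spaceChar y ξ * b‖ₑ ^ 2 ≤ 2 * ‖a - b‖ₑ ^ 2 +
      2 * ENNReal.ofReal (min 4 (‖ξ‖ ^ 2 * ‖x - y‖ ^ 2)) * ‖b‖ₑ ^ 2 := by
  have h2 : ‖spaceChar x ξ * a - spaceChar y ξ * b‖ ≤
      ‖a - b‖ + ‖spaceChar x ξ - spaceChar y ξ‖ * ‖b‖ := by
    have e : spaceChar x ξ * a - spaceChar y ξ * b =
      spaceChar x ξ * (a - b) + (spaceChar x ξ - spaceChar y ξ) * b := by ring
    rw [e]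
    refine (norm_add_le _ _).trans ?_
    rw [norm_mul, norm_mul, norm_spaceChar, one_mul]
  have h3 := norm_spaceChar_sub_sq_le x y ξ
  set m := min 4 (‖ξ‖ ^ 2 * ‖x - y‖ ^ 2)
  have hm : 0 ≤ m := (sq_nonneg _).trans h3
  have h4 : ‖spaceChar x ξ * a - spaceChar y ξ * b‖ ^ 2 ≤
      2 * ‖a - b‖ ^ 2 + 2 * m * ‖b‖ ^ 2 := by
    calc _ ≤ (‖a - b‖ + ‖spaceChar x ξ - spaceChar y ξ‖ * ‖b‖) ^ 2 := by gcongr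
      _ ≤ 2 * ‖a - b‖ ^ 2 + 2 * ‖spaceChar x ξ - spaceChar y ξ‖ ^ 2 * ‖b‖ ^ 2 := by
        nlinarith [sq_nonneg (‖a - b‖ - ‖spaceChar x ξ - spaceChar y ξ‖ * ‖b‖)]
      _ ≤ _ := by gcongr
  have e2 : (2 : ℝ≥0∞) = ENNReal.ofReal 2 := by norm_num
  rw [enorm_sq_eq_ofReal, enorm_sq_eq_ofReal, enorm_sq_eq_ofReal, e2,
    ← ENNReal.ofReal_mul (by norm_num), ← ENNReal.ofReal_mul (by norm_num),
    ← ENNReal.ofReal_mul (by positivity), ← ENNReal.ofReal_add (by positivity) (by positivity)]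
  exact ENNReal.ofReal_le_ofReal h4

theorem spectralDensity_le {H : ℝ} (hH : 1 / 2 < H) (hH' : H < 1) {t s : ℝ} (ht : 0 ≤ t)
    (hs : 0 ≤ s) (x y : Space d) {ξ : Space d} (hξ : ξ ≠ 0) :
    spectralDensity H t x s y ξ ≤
      2 * ENNReal.ofReal (timeConst H * min |t - s| (‖ξ‖ ^ 2)⁻¹ ^ (2 * H)) +
      2 * ENNReal.ofReal (min 4 (‖ξ‖ ^ 2 * ‖x - y‖ ^ 2)) *
        ENNReal.ofReal (timeConst H * min s (‖ξ‖ ^ 2)⁻¹ ^ (2 * H)) := by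
  have hρ : 0 < ‖ξ‖ ^ 2 := by have := norm_pos_iff.2 hξ; positivity
  have hA := lintegral_solHat_sub_le hH hH' ht hs hρ
  -- A single transform is the difference from the one at time 0, which vanishes.
  have hB := lintegral_solHat_sub_le hH hH' hs le_rfl hρ
  simp only [solHat_zero, sub_zero, abs_of_nonneg hs] at hB
  have hm : ∀ t, Measurable fun τ => ENNReal.ofReal (|τ| ^ (1 - 2 * H)) *
      ‖solHat t τ (‖ξ‖ ^ 2) - solHat s τ (‖ξ‖ ^ 2)‖ₑ ^ 2 := fun t => by
    have h1 := (measurable_solHat t).comp (measurable_id.prodMk (measurable_const (a := ‖ξ‖ ^ 2)))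
    have h2 := (measurable_solHat s).comp (measurable_id.prodMk (measurable_const (a := ‖ξ‖ ^ 2)))
    exact Measurable.mul (by fun_prop) ((h1.sub h2).enorm.pow_const 2)
  set m := ENNReal.ofReal (min 4 (‖ξ‖ ^ 2 * ‖x - y‖ ^ 2)) with hmd
  have hmt : 2 * m ≠ ∞ := ENNReal.mul_ne_top (by norm_num) ENNReal.ofReal_ne_top
  have key : spectralDensity H t x s y ξ ≤
      ∫⁻ τ, (2 * (ENNReal.ofReal (|τ| ^ (1 - 2 * H)) *
          ‖solHat t τ (‖ξ‖ ^ 2) - solHat s τ (‖ξ‖ ^ 2)‖ₑ ^ 2) +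
        2 * m * (ENNReal.ofReal (|τ| ^ (1 - 2 * H)) * ‖solHat s τ (‖ξ‖ ^ 2)‖ₑ ^ 2)) := by
    unfold spectralDensity
    refine lintegral_mono fun τ => ?_
    have h1 := mul_le_mul_right (enorm_spaceChar_mul_sub_sq_le x y ξ (solHat t τ (‖ξ‖ ^ 2))
      (solHat s τ (‖ξ‖ ^ 2))) (ENNReal.ofReal (|τ| ^ (1 - 2 * H)))
    rwa [mul_add, mul_left_comm, mul_left_comm _ (2 * _)] at h1
  rw [lintegral_add_left ((hm t).const_mul 2), lintegral_const_mul' _ _ (by norm_num),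
    lintegral_const_mul' _ _ hmt] at key
  exact key.trans (add_le_add (mul_le_mul_right hA _) (mul_le_mul_right hB _))

end

/-! ### The upper bound for the variance. -/

section

open scoped ENNReal

variable {d : ℕ} {α H : ℝ}

theorem inv_sq_rpow_two_mul {ρ : ℝ} (hρ : 0 < ρ) (H : ℝ) :
    (ρ ^ 2)⁻¹ ^ (2 * H) = ρ ^ (-(4 * H)) := by
  rw [← Real.rpow_natCast, ← Real.rpow_neg hρ.le, ← Real.rpow_mul hρ.le]
  congr 1
  push_cast
  ring

/-- The minimum changes branch at |ξ| = h^{-1/2}. Convergence at 0 uses d - α > 0 and at infinity d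
- α < 4H; the power of h is then forced by scaling. -/
theorem exists_lintegral_min_rpow_le (hαd : α < d) (hα : 0 ≤ α) (hH : 1 / 2 < H)
    (hdα : (d : ℝ) - α < 4 * H) :
    ∃ C : ℝ, 0 < C ∧ ∀ h, 0 ≤ h →
      ∫⁻ ξ : Space d, ENNReal.ofReal (min h (‖ξ‖ ^ 2)⁻¹ ^ (2 * H)) * ENNReal.ofReal (‖ξ‖ ^ (-α)) ≤
        ENNReal.ofReal (C * h ^ (2 * H - (d - α) / 2)) := by
  have hd : 0 < d := by
    have : (0 : ℝ) < d := hα.trans_lt hαd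
    exact_mod_cast this
  obtain ⟨ω, hω, hpolar⟩ := exists_lintegral_norm_mul_rpow hd
  have hp1 : 0 < (d : ℝ) - 1 + -α + 1 := by linarith
  have hp2 : 0 < 4 * H - ((d : ℝ) - 1 + -α) - 1 := by linarith
  refine ⟨ω * (1 / ((d : ℝ) - 1 + -α + 1) + 1 / (4 * H - ((d : ℝ) - 1 + -α) - 1)), by positivity,
    fun h hh => ?_⟩
  rcases hh.eq_or_lt with rfl | hh
  · have : ∀ ξ : Space d, min 0 (‖ξ‖ ^ 2)⁻¹ = 0 := fun ξ => min_eq_left (by positivity)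
    simp_rw [this]
    rw [Real.zero_rpow (by linarith)]
    simp
  rw [hpolar (-α) (fun ρ => ENNReal.ofReal (min h (ρ ^ 2)⁻¹ ^ (2 * H))) (by fun_prop), mul_assoc,
    ENNReal.ofReal_mul hω.le]
  refine mul_le_mul_right ?_ _
  set b := h ^ (-(1 / 2) : ℝ) with hb
  have hb0 : 0 < b := by positivity
  have e1 : b ^ (-(4 * H)) = h ^ (2 * H) := by
    rw [hb, ← Real.rpow_mul hh.le]; congr 1; ring
  have e2 : b ^ ((d : ℝ) - 1 + -α + 1 - 4 * H) = h ^ (2 * H - (d - α) / 2) := by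
    rw [hb, ← Real.rpow_mul hh.le]; congr 1; ring
  rw [← e2]
  refine setLIntegral_Ioi_zero_le (by linarith) (by linarith) hb0 ?_ ?_
  · intro x hx _
    rw [← ENNReal.ofReal_mul (by positivity), e1]
    apply ENNReal.ofReal_le_ofReal
    gcongr
    exact min_le_left _ _
  · intro x hx
    have hx0 : 0 < x := hb0.trans hx
    rw [← ENNReal.ofReal_mul (by positivity)]
    apply ENNReal.ofReal_le_ofReal
    rw [sub_eq_add_neg ((d : ℝ) - 1 + -α), add_comm _ (-(4 * H)), Real.rpow_add hx0 (-(4 * H)),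
      ← inv_sq_rpow_two_mul hx0]
    gcongr
    exact min_le_right _ _

theorem one_le_log_pow {L r : ℝ} (hr : 0 < r) (h : Real.exp 1 * r ≤ L) (n : ℕ) :
    1 ≤ Real.log (L / r) ^ n := by
  refine one_le_pow₀ ?_
  have hle : Real.exp 1 ≤ L / r := (le_div_iff₀ hr).2 h
  exact (Real.le_log_iff_exp_le ((Real.exp_pos 1).trans_le hle)).2 hle

theorem rpow_le_mul_rpow {L r a m : ℝ} (hr : 0 < r) (h : r ≤ L) (hm : m ≤ a) :
    r ^ a ≤ L ^ (a - m) * r ^ m := by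
  calc r ^ a = r ^ (a - m) * r ^ m := by rw [← Real.rpow_add hr, sub_add_cancel]
    _ ≤ _ := by
      gcongr

/-- Three ranges of |ξ|. Below 1/L the term T is used and the result is of order r²; between 1/L and
1/r the integrand is r²ρ^{1-θ}, which produces the stated rate and the logarithm; above 1/r the
constant 4 is used and the result is of order r^θ. The outer contributions are absorbed since r ≤ L
and the logarithmic factor is at least 1. -/
theorem exists_lintegral_min_mul_min_rpow_le (hαd : α < d) (hα : 0 ≤ α) (hH : 1 / 2 < H)
    (hdα : (d : ℝ) - α < 4 * H) {T L : ℝ} (hT : 0 < T) (hL : 0 < L) (n : ℕ)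
    (hn : n = open Classical in if 4 * H - (d - α) = 2 then 1 else 0) :
    ∃ C : ℝ, 0 < C ∧ ∀ r, 0 < r → Real.exp 1 * r ≤ L →
      ∫⁻ ξ : Space d, ENNReal.ofReal (min 4 (‖ξ‖ ^ 2 * r ^ 2)) *
        ENNReal.ofReal (min T (‖ξ‖ ^ 2)⁻¹ ^ (2 * H)) * ENNReal.ofReal (‖ξ‖ ^ (-α)) ≤
        ENNReal.ofReal (C * (Real.log (L / r) ^ n * r ^ min 2 (4 * H - (d - α)))) := by
  have hd : 0 < d := by
    have : (0 : ℝ) < d := hα.trans_lt hαd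
    exact_mod_cast this
  obtain ⟨ω, hω, hpolar⟩ := exists_lintegral_norm_mul_rpow hd
  set θ := 4 * H - (d - α) with hθ
  have hθ0 : 0 < θ := by linarith
  obtain ⟨_, C', _, hC', hmid⟩ := exists_setLIntegral_rpow_bounds θ hL n hn
  set m := min 2 θ with hm
  set p : ℝ := (d : ℝ) - 1 + -α + 2 with hp
  have hp1 : 0 < p + 1 := by linarith
  refine ⟨ω * (T ^ (2 * H) * ((1 / L) ^ (p + 1) / (p + 1)) * L ^ ((2 : ℝ) - m) + C' +
    4 / θ * L ^ (θ - m)), by positivity, fun r hr h => ?_⟩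
  have hrL : r ≤ L := by nlinarith [Real.add_one_le_exp 1]
  have hlr : 1 / L ≤ 1 / r := one_div_le_one_div_of_le hr hrL
  set f : ℝ → ℝ≥0∞ := fun ρ => ENNReal.ofReal (min 4 (ρ ^ 2 * r ^ 2)) *
    ENNReal.ofReal (min T (ρ ^ 2)⁻¹ ^ (2 * H)) with hf
  have hfm : Measurable f := by fun_prop
  have hpol := hpolar (-α) f hfm
  simp only [hf] at hpol
  rw [hpol, mul_assoc ω, ENNReal.ofReal_mul hω.le]
  refine mul_le_mul_right ?_ _
  set E : ℝ := (d : ℝ) - 1 + -α with hE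
  have hpE : p = E + 2 := hp
  clear_value E
  rw [setLIntegral_Ioi_eq_add (show (0 : ℝ) ≤ 1 / L by positivity), setLIntegral_Ioi_eq_add hlr]
  set g := Real.log (L / r) ^ n
  have hg : 1 ≤ g := one_le_log_pow hr h n
  have I1 : ∫⁻ ρ in Set.Ioc 0 (1 / L), ENNReal.ofReal (min 4 (ρ ^ 2 * r ^ 2)) *
      ENNReal.ofReal (min T (ρ ^ 2)⁻¹ ^ (2 * H)) * ENNReal.ofReal (ρ ^ E) ≤
      ENNReal.ofReal (T ^ (2 * H) * ((1 / L) ^ (p + 1) / (p + 1)) * L ^ ((2 : ℝ) - m) *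
        (g * r ^ m)) := by
    calc _ ≤ ∫⁻ ρ in Set.Ioc 0 (1 / L), ENNReal.ofReal (r ^ 2 * T ^ (2 * H)) *
          ENNReal.ofReal (ρ ^ p) := by
          refine setLIntegral_mono' measurableSet_Ioc fun ρ hρ => ?_
          have hρ0 : 0 < ρ := hρ.1
          rw [← ENNReal.ofReal_mul (by positivity), ← ENNReal.ofReal_mul (by positivity),
            ← ENNReal.ofReal_mul (by positivity)]
          apply ENNReal.ofReal_le_ofReal
          calc _ ≤ (ρ ^ 2 * r ^ 2) * T ^ (2 * H) * ρ ^ E := by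
                gcongr
                · exact min_le_right _ _
                · exact min_le_left _ _
            _ = _ := by
                rw [hpE, Real.rpow_add hρ0, Real.rpow_two]
                ring
      _ = ENNReal.ofReal (r ^ 2 * T ^ (2 * H) * ((1 / L) ^ (p + 1) / (p + 1))) := by
          rw [lintegral_const_mul' _ _ ENNReal.ofReal_ne_top,
            setLIntegral_Ioc_zero_rpow (by linarith) (by positivity),
            ← ENNReal.ofReal_mul (by positivity)]
      _ ≤ _ := by
          apply ENNReal.ofReal_le_ofReal
          have h2 := rpow_le_mul_rpow hr hrL (min_le_left 2 θ)
          rw [Real.rpow_two] at h2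
          calc r ^ 2 * T ^ (2 * H) * ((1 / L) ^ (p + 1) / (p + 1))
              ≤ (L ^ ((2 : ℝ) - m) * (g * r ^ m)) * T ^ (2 * H) *
                ((1 / L) ^ (p + 1) / (p + 1)) := by
                gcongr
                refine h2.trans ?_
                gcongr
                exact le_mul_of_one_le_left (by positivity) hg
            _ = _ := by ring
  have I2 : ∫⁻ ρ in Set.Ioc (1 / L) (1 / r), ENNReal.ofReal (min 4 (ρ ^ 2 * r ^ 2)) *
      ENNReal.ofReal (min T (ρ ^ 2)⁻¹ ^ (2 * H)) * ENNReal.ofReal (ρ ^ E) ≤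
      ENNReal.ofReal (C' * (g * r ^ m)) := by
    calc _ ≤ ∫⁻ ρ in Set.Ioc (1 / L) (1 / r), ENNReal.ofReal (r ^ 2) *
          ENNReal.ofReal (ρ ^ (1 - θ)) := by
          refine setLIntegral_mono' measurableSet_Ioc fun ρ hρ => ?_
          have hρ0 : 0 < ρ := lt_trans (by positivity) hρ.1
          rw [← ENNReal.ofReal_mul (by positivity), ← ENNReal.ofReal_mul (by positivity),
            ← ENNReal.ofReal_mul (by positivity)]
          apply ENNReal.ofReal_le_ofReal
          calc _ ≤ (ρ ^ 2 * r ^ 2) * (ρ ^ 2)⁻¹ ^ (2 * H) * ρ ^ E := by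
                gcongr
                · exact min_le_right _ _
                · exact min_le_right _ _
            _ = _ := by
                rw [inv_sq_rpow_two_mul hρ0,
                  show 1 - θ = 2 + -(4 * H) + E by rw [hθ, hE]; ring,
                  Real.rpow_add hρ0, Real.rpow_add hρ0, Real.rpow_two]
                ring
      _ ≤ ENNReal.ofReal (r ^ 2) * ENNReal.ofReal (C' * (g * r ^ (m - 2))) := by
          rw [lintegral_const_mul' _ _ ENNReal.ofReal_ne_top]
          exact mul_le_mul_right (hmid r hr h).2 _
      _ = _ := by
          rw [← ENNReal.ofReal_mul (by positivity)]
          congr 1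
          rw [Real.rpow_sub hr, Real.rpow_two]
          field_simp
  have I3 : ∫⁻ ρ in Set.Ioi (1 / r), ENNReal.ofReal (min 4 (ρ ^ 2 * r ^ 2)) *
      ENNReal.ofReal (min T (ρ ^ 2)⁻¹ ^ (2 * H)) * ENNReal.ofReal (ρ ^ E) ≤
      ENNReal.ofReal (4 / θ * L ^ (θ - m) * (g * r ^ m)) := by
    calc _ ≤ ∫⁻ ρ in Set.Ioi (1 / r), ENNReal.ofReal 4 * ENNReal.ofReal (ρ ^ (-θ - 1)) := by
          refine setLIntegral_mono' measurableSet_Ioi fun ρ hρ => ?_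
          have hρ0 : 0 < ρ := lt_trans (by positivity) hρ
          rw [← ENNReal.ofReal_mul (by positivity), ← ENNReal.ofReal_mul (by positivity),
            ← ENNReal.ofReal_mul (by positivity)]
          apply ENNReal.ofReal_le_ofReal
          calc _ ≤ 4 * (ρ ^ 2)⁻¹ ^ (2 * H) * ρ ^ E := by
                gcongr
                · exact min_le_left _ _
                · exact min_le_right _ _
            _ = _ := by
                rw [inv_sq_rpow_two_mul hρ0,
                  show -θ - 1 = -(4 * H) + E by rw [hθ, hE]; ring,
                  Real.rpow_add hρ0]
                ring
      _ = ENNReal.ofReal (4 * (r ^ θ / θ)) := by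
          rw [lintegral_const_mul' _ _ ENNReal.ofReal_ne_top,
            setLIntegral_Ioi_rpow (by linarith) (by positivity),
            ← ENNReal.ofReal_mul (by positivity)]
          congr 2
          rw [show -θ - 1 + 1 = -θ by ring, neg_div_neg_eq, one_div, Real.inv_rpow hr.le,
            Real.rpow_neg hr.le, inv_inv]
      _ ≤ _ := by
          apply ENNReal.ofReal_le_ofReal
          have h2 := rpow_le_mul_rpow hr hrL (min_le_right 2 θ)
          calc 4 * (r ^ θ / θ) = 4 / θ * r ^ θ := by ring
            _ ≤ 4 / θ * (L ^ (θ - m) * (g * r ^ m)) := by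
                gcongr
                refine h2.trans ?_
                gcongr
                exact le_mul_of_one_le_left (by positivity) hg
            _ = _ := by ring
  refine (add_le_add I1 (add_le_add I2 I3)).trans (le_of_eq ?_)
  rw [← ENNReal.ofReal_add (by positivity) (by positivity),
    ← ENNReal.ofReal_add (by positivity) (by positivity)]
  congr 1
  ring

theorem norm_sub_le_of_mem_cube {M : ℝ} {x y : Space d} (hx : x ∈ cube d M) (hy : y ∈ cube d M) :
    ‖x - y‖ ≤ 2 * √d * M := by
  rcases isEmpty_or_nonempty (Fin d) with he | ⟨⟨i₀⟩⟩
  · have : d = 0 := by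
      by_contra h
      exact he.elim ⟨0, Nat.pos_of_ne_zero h⟩
    subst this
    simp [Subsingleton.elim x y]
  have hM : 0 ≤ M := by
    have h1 := (hx i₀).1
    have h2 := (hx i₀).2
    linarith
  rw [EuclideanSpace.norm_eq]
  refine Real.sqrt_le_iff.2 ⟨by positivity, ?_⟩
  calc ∑ i, ‖(x - y) i‖ ^ 2 ≤ ∑ _i : Fin d, (2 * M) ^ 2 := by
        refine Finset.sum_le_sum fun i _ => ?_
        have : |x i - y i| ≤ 2 * M := by
          have h1 := hx i
          have h2 := hy i
          exact abs_le.2 ⟨by linarith [h1.1, h2.2], by linarith [h1.2, h2.1]⟩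
        simp only [PiLp.sub_apply, Real.norm_eq_abs]
        gcongr
    _ = (2 * √d * M) ^ 2 := by
        rw [mul_pow, mul_pow, mul_pow, Real.sq_sqrt (Nat.cast_nonneg d)]
        simp
        ring

/-- The diameter of the cube is 2√d·M; the additional e in the gauge keeps its logarithm at least 1.
-/
theorem exp_one_mul_norm_sub_le {M : ℝ} {x y : Space d} (hx : x ∈ cube d M) (hy : y ∈ cube d M) :
    Real.exp 1 * ‖x - y‖ ≤ 2 * Real.exp 1 * √d * M := by
  have := mul_le_mul_of_nonneg_left (norm_sub_le_of_mem_cube hx hy) (Real.exp_pos 1).le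
  linarith

theorem log_pow_mul_rpow_nonneg {M : ℝ} {x y : Space d} (hx : x ∈ cube d M) (hy : y ∈ cube d M)
    (n : ℕ) (p : ℝ) :
    0 ≤ Real.log (2 * Real.exp 1 * √d * M / ‖x - y‖) ^ n * ‖x - y‖ ^ p := by
  rcases (norm_nonneg (x - y)).eq_or_lt with h | h
  · rw [← h, div_zero, Real.log_zero]
    positivity
  · exact mul_nonneg (zero_le_one.trans (one_le_log_pow h (exp_one_mul_norm_sub_le hx hy) n))
      (by positivity)

theorem gauge_nonneg (d : ℕ) (α H : ℝ) {M : ℝ} (t s : ℝ) {x y : Space d} (hx : x ∈ cube d M)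
    (hy : y ∈ cube d M) : 0 ≤ gauge d α H M t s x y :=
  add_nonneg (by positivity) (log_pow_mul_rpow_nonneg hx hy _ _)

/-- The pointwise bound splits into the time and space terms just integrated; in the latter s is
enlarged to T. When x = y the spatial term vanishes, as its exponent is positive. -/
theorem exists_rieszVariance_le (hαd : α < d) (hα : 0 ≤ α) (hH : 1 / 2 < H) (hH' : H < 1)
    (hdα : (d : ℝ) - α < 4 * H) {T M : ℝ} (hT : 0 < T) (hM : 0 < M) :
    ∃ C : ℝ, 0 < C ∧ ∀ t ∈ Set.Icc 0 T, ∀ s ∈ Set.Icc 0 T, ∀ x ∈ cube d M, ∀ y ∈ cube d M,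
      rieszVariance α H t x s y ≤ ENNReal.ofReal (C * gauge d α H M t s x y) := by
  have hd : (0 : ℝ) < d := hα.trans_lt hαd
  have hd' : 0 < d := by exact_mod_cast hd
  have : Nonempty (Fin d) := ⟨⟨0, hd'⟩⟩
  have : Nontrivial (Space d) := inferInstance
  obtain ⟨C₁, hC₁, h1⟩ := exists_lintegral_min_rpow_le hαd hα hH hdα
  set L : ℝ := 2 * Real.exp 1 * √d * M with hLd
  have hL : 0 < L := by positivity
  obtain ⟨C₂, hC₂, h2⟩ := exists_lintegral_min_mul_min_rpow_le hαd hα hH hdα hT hL _ rfl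
  have hK := timeConst_pos hH hH'
  set K := timeConst H
  refine ⟨2 * K * (C₁ + C₂), by positivity, fun t ht s hs x hx y hy => ?_⟩
  set n : ℕ := open Classical in if 4 * H - (d - α) = 2 then 1 else 0 with hn
  set r := ‖x - y‖ with hr
  have hg : gauge d α H M t s x y = |t - s| ^ (2 * H - (d - α) / 2) +
      Real.log (L / r) ^ n * r ^ min 2 (4 * H - (d - α)) := rfl
  set S := Real.log (L / r) ^ n * r ^ min 2 (4 * H - (d - α)) with hS
  have hsp : ∫⁻ ξ : Space d, ENNReal.ofReal (min 4 (‖ξ‖ ^ 2 * r ^ 2)) *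
        ENNReal.ofReal (min T (‖ξ‖ ^ 2)⁻¹ ^ (2 * H)) * ENNReal.ofReal (‖ξ‖ ^ (-α)) ≤
        ENNReal.ofReal (C₂ * S) := by
    rcases (norm_nonneg (x - y)).eq_or_lt with h0 | h0
    · rw [← hr] at h0
      rw [hS, ← h0, Real.zero_rpow (lt_min two_pos (by linarith)).ne']
      simp
    · exact h2 r h0 (exp_one_mul_norm_sub_le hx hy)
  calc rieszVariance α H t x s y
      ≤ ∫⁻ ξ : Space d, (ENNReal.ofReal (2 * K) * (ENNReal.ofReal (min |t - s| (‖ξ‖ ^ 2)⁻¹ ^ (2 * H)) *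
          ENNReal.ofReal (‖ξ‖ ^ (-α))) + ENNReal.ofReal (2 * K) *
          (ENNReal.ofReal (min 4 (‖ξ‖ ^ 2 * r ^ 2)) *
        ENNReal.ofReal (min T (‖ξ‖ ^ 2)⁻¹ ^ (2 * H)) * ENNReal.ofReal (‖ξ‖ ^ (-α)))) := by
        refine lintegral_mono_ae ?_
        filter_upwards [Measure.ae_ne volume (0 : Space d)] with ξ hξ
        have h3 := spectralDensity_le hH hH' ht.1 hs.1 x y hξ
        have h4 : ENNReal.ofReal (timeConst H * min s (‖ξ‖ ^ 2)⁻¹ ^ (2 * H)) ≤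
            ENNReal.ofReal (timeConst H * min T (‖ξ‖ ^ 2)⁻¹ ^ (2 * H)) := by
          apply ENNReal.ofReal_le_ofReal
          have := le_min hs.1 (show 0 ≤ (‖ξ‖ ^ 2)⁻¹ by positivity)
          have := min_le_min_right (‖ξ‖ ^ 2)⁻¹ hs.2
          gcongr
        have h5 := mul_le_mul_left (h3.trans (add_le_add le_rfl (mul_le_mul_right h4 _)))
          (ENNReal.ofReal (‖ξ‖ ^ (-α)))
        refine h5.trans (le_of_eq ?_)
        rw [ENNReal.ofReal_mul hK.le, ENNReal.ofReal_mul hK.le, ENNReal.ofReal_mul two_pos.le,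
          show ENNReal.ofReal 2 = 2 by norm_num]
        ring
    _ ≤ ENNReal.ofReal (2 * K) * ENNReal.ofReal (C₁ * |t - s| ^ (2 * H - (d - α) / 2)) +
          ENNReal.ofReal (2 * K) * ENNReal.ofReal (C₂ * S) := by
        rw [lintegral_add_left (by fun_prop), lintegral_const_mul' _ _ ENNReal.ofReal_ne_top,
          lintegral_const_mul' _ _ ENNReal.ofReal_ne_top]
        exact add_le_add (mul_le_mul_right (h1 _ (abs_nonneg _)) _) (mul_le_mul_right hsp _)
    _ ≤ _ := by
        have hS0 : 0 ≤ S := log_pow_mul_rpow_nonneg hx hy _ _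
        rw [hg, ← ENNReal.ofReal_mul (by positivity), ← ENNReal.ofReal_mul (by positivity),
          ← ENNReal.ofReal_add (by positivity) (by positivity)]
        apply ENNReal.ofReal_le_ofReal
        have h0 : 0 ≤ |t - s| ^ (2 * H - (d - α) / 2) := by positivity
        have e : 2 * K * (C₁ + C₂) * (|t - s| ^ (2 * H - (d - α) / 2) + S) =
          2 * K * (C₁ * |t - s| ^ (2 * H - (d - α) / 2)) + 2 * K * (C₂ * S) +
          2 * K * (C₂ * |t - s| ^ (2 * H - (d - α) / 2) + C₁ * S) := by ring
        rw [e]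
        have : 0 ≤ 2 * K * (C₂ * |t - s| ^ (2 * H - (d - α) / 2) + C₁ * S) := by positivity
        linarith

end

/-! ### The lower bound in the space variable. -/

section

open scoped ENNReal

variable {d : ℕ} {α H : ℝ}

theorem measurable_solHat_left (t ρ : ℝ) : Measurable fun τ => solHat t τ ρ := by
  unfold solHat; fun_prop

theorem norm_sq_ofReal_add_mul_I (ρ τ : ℝ) :
    ‖(ρ + τ * Complex.I : ℂ)‖ ^ 2 = ρ ^ 2 + τ ^ 2 := by
  rw [← Complex.normSq_eq_norm_sq, Complex.normSq_add_mul_I]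

/-- Keep only τ in (ρ, 2ρ]: the numerator is at least 1 - e^{-tρ}, the denominator squared at most
5ρ², the weight at least (2ρ)^{1-2H}, and the interval has length ρ. -/
theorem le_lintegral_solHat_sq (hH : 1 / 2 < H) {t₀ ρ₀ : ℝ} (ht₀ : 0 < t₀)
    (hρ₀ : 0 < ρ₀) {t ρ : ℝ} (ht : t₀ ≤ t) (hρ : ρ₀ ≤ ρ) :
    ENNReal.ofReal ((1 - Real.exp (-t₀ * ρ₀)) ^ 2 * 2 ^ (1 - 2 * H) / 5 * ρ ^ (-(2 * H))) ≤
      ∫⁻ τ, ENNReal.ofReal (|τ| ^ (1 - 2 * H)) * ‖solHat t τ ρ‖ₑ ^ 2 := by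
  have hρ0 : 0 < ρ := hρ₀.trans_le hρ
  set e := 1 - Real.exp (-t₀ * ρ₀) with he
  have he0 : 0 < e := by
    have : Real.exp (-t₀ * ρ₀) < 1 := Real.exp_lt_one_iff.2 (by nlinarith)
    linarith
  have hsol : ∀ τ ∈ Set.Ioc ρ (2 * ρ), e ^ 2 / (5 * ρ ^ 2) ≤ ‖solHat t τ ρ‖ ^ 2 := by
    intro τ hτ
    rw [solHat, norm_div, div_pow, norm_sq_ofReal_add_mul_I]
    have h1 : e ≤ ‖Complex.exp ((t * τ : ℝ) * Complex.I) - (Real.exp (-t * ρ) : ℂ)‖ := by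
      refine le_trans ?_ (norm_sub_norm_le _ _)
      rw [Complex.norm_exp_ofReal_mul_I, Complex.norm_real, Real.norm_eq_abs, Real.abs_exp, he]
      have : t₀ * ρ₀ ≤ t * ρ := mul_le_mul ht hρ hρ₀.le (ht₀.le.trans ht)
      gcongr 1 - Real.exp ?_
      linarith
    have hτ1 := hτ.1
    have hτ2 := hτ.2
    gcongr
    nlinarith
  calc _ = ENNReal.ofReal ((2 * ρ) ^ (1 - 2 * H)) * ENNReal.ofReal (e ^ 2 / (5 * ρ ^ 2)) *
        volume (Set.Ioc ρ (2 * ρ)) := by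
        rw [Real.volume_Ioc, ← ENNReal.ofReal_mul (by positivity),
          ← ENNReal.ofReal_mul (by positivity)]
        congr 1
        rw [Real.mul_rpow (by norm_num) hρ0.le, show -(2 * H) = 1 - 2 * H + (-1 : ℝ) by ring,
          Real.rpow_add hρ0, Real.rpow_neg_one]
        field_simp
        ring
    _ = ∫⁻ τ in Set.Ioc ρ (2 * ρ), ENNReal.ofReal ((2 * ρ) ^ (1 - 2 * H)) *
          ENNReal.ofReal (e ^ 2 / (5 * ρ ^ 2)) := by
        rw [setLIntegral_const]
    _ ≤ ∫⁻ τ in Set.Ioc ρ (2 * ρ), ENNReal.ofReal (|τ| ^ (1 - 2 * H)) *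
          ‖solHat t τ ρ‖ₑ ^ 2 := by
        refine setLIntegral_mono' measurableSet_Ioc fun τ hτ => ?_
        have hτ0 : 0 < τ := hρ0.trans hτ.1
        rw [enorm_sq_eq_ofReal, abs_of_pos hτ0]
        refine mul_le_mul' (ENNReal.ofReal_le_ofReal ?_) (ENNReal.ofReal_le_ofReal (hsol τ hτ))
        exact Real.rpow_le_rpow_of_nonpos hτ0 hτ.2 (by linarith)
    _ ≤ _ := setLIntegral_le_lintegral _ _

theorem norm_spaceChar_mul_sub (x y ξ : Space d) (a b : ℂ) :
    ‖spaceChar x ξ * a - spaceChar y ξ * b‖ =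
      ‖Complex.exp ((inner ℝ (x - y) ξ : ℝ) * Complex.I) * a - b‖ := by
  have e : spaceChar x ξ * a - spaceChar y ξ * b = spaceChar y ξ *
      (Complex.exp ((inner ℝ (x - y) ξ : ℝ) * Complex.I) * a - b) := by
    rw [spaceChar, spaceChar, mul_sub, ← mul_assoc, ← Complex.exp_add, inner_sub_left]
    congr 3
    push_cast
    ring
  rw [e, norm_mul, norm_spaceChar, one_mul]

/-- Averaging over `ξ` and `-ξ`. -/
theorem sin_sq_mul_le (x y ξ : Space d) (a b : ℂ) :
    2 * Real.sin (inner ℝ (x - y) ξ) ^ 2 * ‖a‖ ^ 2 ≤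
      ‖spaceChar x ξ * a - spaceChar y ξ * b‖ ^ 2 +
        ‖spaceChar x (-ξ) * a - spaceChar y (-ξ) * b‖ ^ 2 := by
  rw [norm_spaceChar_mul_sub, norm_spaceChar_mul_sub, inner_neg_right]
  set ψ := inner ℝ (x - y) ξ
  set p := Complex.exp ((ψ : ℝ) * Complex.I) * a - b
  set q := Complex.exp ((-ψ : ℝ) * Complex.I) * a - b
  -- The term b is common to p and q and drops out; this is how the second point of the increment
  -- disappears.
  have h1 : p - q = 2 * Complex.I * Complex.sin ψ * a := by
    have := Complex.two_sin (ψ : ℂ)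
    calc p - q = (Complex.exp (ψ * Complex.I) - Complex.exp (-ψ * Complex.I)) * a := by
          simp only [p, q]; push_cast; ring
      _ = Complex.I * ((Complex.exp (-ψ * Complex.I) - Complex.exp (ψ * Complex.I)) *
          Complex.I) * a := by
          linear_combination (-(Complex.exp (-ψ * Complex.I) - Complex.exp (ψ * Complex.I)) * a) *
            Complex.I_sq
      _ = _ := by rw [← this]; ring
  have h2 : ‖p - q‖ = 2 * |Real.sin ψ| * ‖a‖ := by
    rw [h1, norm_mul, norm_mul, norm_mul, Complex.norm_I, ← Complex.ofReal_sin, Complex.norm_real]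
    simp
  have h3 := norm_sub_le p q
  rw [h2] at h3
  have h4 : (2 * |Real.sin ψ| * ‖a‖) ^ 2 ≤ (‖p‖ + ‖q‖) ^ 2 := by gcongr
  rw [mul_pow, mul_pow, sq_abs] at h4
  nlinarith [sq_nonneg (‖p‖ - ‖q‖)]

theorem measurable_spectralDensity (H t : ℝ) (x : Space d) (s : ℝ) (y : Space d) :
    Measurable (spectralDensity H t x s y) := by
  have h1 : ∀ t (x : Space d), Measurable fun p : ℝ × Space d =>
      spaceChar x p.2 * solHat t p.1 (‖p.2‖ ^ 2) := fun t x => by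
    have h2 := (measurable_solHat t).comp (f := fun p : ℝ × Space d => (p.1, ‖p.2‖ ^ 2))
      (by fun_prop)
    have h3 := continuous_spaceChar.measurable.comp (f := fun p : ℝ × Space d => (x, p.2))
      (by fun_prop)
    exact h3.mul h2
  have h0 : Measurable fun p : ℝ × Space d => ENNReal.ofReal (|p.1| ^ (1 - 2 * H)) := by fun_prop
  exact (h0.mul (((h1 t x).sub (h1 s y)).enorm.pow_const 2)).lintegral_prod_left'

theorem sin_sq_mul_le_spectralDensity (H t : ℝ) (x : Space d) (s : ℝ) (y ξ : Space d) :
    ENNReal.ofReal (2 * Real.sin (inner ℝ (x - y) ξ) ^ 2) *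
        ∫⁻ τ, ENNReal.ofReal (|τ| ^ (1 - 2 * H)) * ‖solHat t τ (‖ξ‖ ^ 2)‖ₑ ^ 2 ≤
      spectralDensity H t x s y ξ + spectralDensity H t x s y (-ξ) := by
  have h1 : ∀ t, Measurable fun τ => solHat t τ (‖ξ‖ ^ 2) := fun t =>
    measurable_solHat_left t _
  have h2 : Measurable fun τ => ENNReal.ofReal (|τ| ^ (1 - 2 * H)) *
      ‖spaceChar x ξ * solHat t τ (‖ξ‖ ^ 2) - spaceChar y ξ * solHat s τ (‖ξ‖ ^ 2)‖ₑ ^ 2 :=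
    Measurable.mul (by fun_prop)
      ((((h1 t).const_mul _).sub ((h1 s).const_mul _)).enorm.pow_const 2)
  unfold spectralDensity
  rw [← lintegral_add_left h2, ← lintegral_const_mul' _ _ ENNReal.ofReal_ne_top]
  refine lintegral_mono fun τ => ?_
  rw [norm_neg, ← mul_add, mul_left_comm, enorm_sq_eq_ofReal, enorm_sq_eq_ofReal,
    enorm_sq_eq_ofReal, ← ENNReal.ofReal_mul (by positivity),
    ← ENNReal.ofReal_add (by positivity) (by positivity)]
  exact mul_le_mul_right (ENNReal.ofReal_le_ofReal (sin_sq_mul_le x y ξ _ _)) _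

/-- The transform in time depends on ξ only through its norm and the weight is even, so ξ and -ξ
contribute equally. -/
theorem lintegral_sin_sq_mul_le_rieszVariance (α H t : ℝ) (x : Space d) (s : ℝ) (y : Space d) :
    ∫⁻ ξ, ENNReal.ofReal (Real.sin (inner ℝ (x - y) ξ) ^ 2) *
        (∫⁻ τ, ENNReal.ofReal (|τ| ^ (1 - 2 * H)) * ‖solHat t τ (‖ξ‖ ^ 2)‖ₑ ^ 2) *
        ENNReal.ofReal (‖ξ‖ ^ (-α)) ≤ rieszVariance α H t x s y := by
  set A : Space d → ℝ≥0∞ := fun ξ =>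
    ∫⁻ τ, ENNReal.ofReal (|τ| ^ (1 - 2 * H)) * ‖solHat t τ (‖ξ‖ ^ 2)‖ₑ ^ 2 with hA
  have hm := measurable_spectralDensity H t x s y
  have hneg : rieszVariance α H t x s y =
      ∫⁻ ξ, spectralDensity H t x s y (-ξ) * ENNReal.ofReal (‖ξ‖ ^ (-α)) := by
    rw [rieszVariance, ← lintegral_neg_eq_self]
    simp_rw [norm_neg]
  have key : 2 * ∫⁻ ξ, ENNReal.ofReal (Real.sin (inner ℝ (x - y) ξ) ^ 2) * A ξ *
      ENNReal.ofReal (‖ξ‖ ^ (-α)) ≤ 2 * rieszVariance α H t x s y := by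
    rw [two_mul (rieszVariance α H t x s y)]
    conv_rhs => enter [2]; rw [hneg]
    unfold rieszVariance
    rw [← lintegral_add_left (by fun_prop), ← lintegral_const_mul' _ _ (by norm_num)]
    refine lintegral_mono fun ξ => ?_
    have h := sin_sq_mul_le_spectralDensity H t x s y ξ
    rw [ENNReal.ofReal_mul two_pos.le, show ENNReal.ofReal 2 = 2 by norm_num] at h
    rw [← add_mul, ← mul_assoc, ← mul_assoc]
    exact mul_le_mul_left h _
  exact (ENNReal.mul_le_mul_iff_right (by norm_num) (by norm_num)).1 key

theorem sq_div_four_le_sin_sq {ψ : ℝ} (h : |ψ| ≤ 1) : ψ ^ 2 / 4 ≤ Real.sin ψ ^ 2 := by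
  have h1 := Real.mul_abs_le_abs_sin (h.trans (by linarith [Real.pi_gt_three]))
  have h2 : 1 / 2 ≤ 2 / Real.pi := by
    rw [div_le_div_iff₀ two_pos Real.pi_pos]
    linarith [Real.pi_le_four]
  have h3 : |ψ| / 2 ≤ |Real.sin ψ| := by nlinarith [abs_nonneg ψ]
  rw [← sq_abs ψ, ← sq_abs (Real.sin ψ)]
  have := abs_nonneg ψ
  calc |ψ| ^ 2 / 4 = (|ψ| / 2) ^ 2 := by ring
    _ ≤ _ := by gcongr

/-- On 1/L < |ξ| ≤ 1/r the phase is at most 1, so sin² is comparable to ((x-y)·ξ)², whose average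
over directions is r²|ξ|²/d. What is left is r² times the same integral of ρ^{1-θ} as in the upper
bound. -/
theorem exists_space_le_rieszVariance (hαd : α < d) (hα : 0 ≤ α) (hH : 1 / 2 < H)
    {t₀ L : ℝ} (ht₀ : 0 < t₀) (hL : 0 < L) (n : ℕ)
    (hn : n = open Classical in if 4 * H - (d - α) = 2 then 1 else 0) :
    ∃ c : ℝ, 0 < c ∧ ∀ t, t₀ ≤ t → ∀ s, ∀ x y : Space d, 0 < ‖x - y‖ →
      Real.exp 1 * ‖x - y‖ ≤ L →
      ENNReal.ofReal (c * (Real.log (L / ‖x - y‖) ^ n * ‖x - y‖ ^ min 2 (4 * H - (d - α)))) ≤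
        rieszVariance α H t x s y := by
  have hd : 0 < d := by
    have : (0 : ℝ) < d := hα.trans_lt hαd
    exact_mod_cast this
  have hdR : (0 : ℝ) < d := by exact_mod_cast hd
  obtain ⟨ω, hω, hpolar⟩ := exists_lintegral_norm_mul_rpow hd
  set θ := 4 * H - (d - α) with hθ
  obtain ⟨c', _, hc', _, hmid⟩ := exists_setLIntegral_rpow_bounds θ hL n hn
  -- The least value of |ξ|² on the shell; with t ≥ t₀ it keeps 1 - e^{-t|ξ|²} away from 0.
  set ρ₀ := (1 / L) ^ 2 with hρ₀
  have hρ₀0 : 0 < ρ₀ := by positivity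
  set k : ℝ := (1 - Real.exp (-t₀ * ρ₀)) ^ 2 * 2 ^ (1 - 2 * H) / 5 with hk
  have hk0 : 0 < k := by
    have : Real.exp (-t₀ * ρ₀) < 1 := Real.exp_lt_one_iff.2 (by nlinarith)
    have : 0 < 1 - Real.exp (-t₀ * ρ₀) := by linarith
    positivity
  refine ⟨k / 4 * (ω * c' / d), by positivity, fun t ht s x y hxy h => ?_⟩
  set r := ‖x - y‖ with hr
  set f : ℝ → ℝ≥0∞ := (Set.Ioc (1 / L) (1 / r)).indicator fun ρ =>
    ENNReal.ofReal (ρ ^ (-(4 * H))) with hf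
  have hfm : Measurable f := by
    refine Measurable.indicator ?_ measurableSet_Ioc
    fun_prop
  have hpt : ∀ ξ : Space d, ENNReal.ofReal (k / 4) * (ENNReal.ofReal (inner ℝ (x - y) ξ ^ 2) *
      (f ‖ξ‖ * ENNReal.ofReal (‖ξ‖ ^ (-α)))) ≤
      ENNReal.ofReal (Real.sin (inner ℝ (x - y) ξ) ^ 2) *
        (∫⁻ τ, ENNReal.ofReal (|τ| ^ (1 - 2 * H)) * ‖solHat t τ (‖ξ‖ ^ 2)‖ₑ ^ 2) *
        ENNReal.ofReal (‖ξ‖ ^ (-α)) := by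
    intro ξ
    by_cases hξ : ‖ξ‖ ∈ Set.Ioc (1 / L) (1 / r)
    · rw [hf, Set.indicator_of_mem hξ, ← mul_assoc, ← mul_assoc]
      refine mul_le_mul_left ?_ _
      have hξ0 : 0 < ‖ξ‖ := lt_trans (by positivity) hξ.1
      have h1 := le_lintegral_solHat_sq hH ht₀ hρ₀0 ht (ρ := ‖ξ‖ ^ 2)
        (pow_le_pow_left₀ (by positivity) hξ.1.le 2)
      have h2 : |inner ℝ (x - y) ξ| ≤ 1 := by
        refine (abs_real_inner_le_norm _ _).trans ?_
        have := hξ.2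
        rw [le_div_iff₀ hxy] at this
        linarith
      refine le_trans ?_ (mul_le_mul' (ENNReal.ofReal_le_ofReal (sq_div_four_le_sin_sq h2)) h1)
      rw [← ENNReal.ofReal_mul (by positivity), ← ENNReal.ofReal_mul (by positivity),
        ← ENNReal.ofReal_mul (by positivity)]
      apply ENNReal.ofReal_le_ofReal
      rw [Real.rpow_neg (by positivity) (2 * H), ← Real.inv_rpow (by positivity),
        inv_sq_rpow_two_mul hξ0, ← hk]
      apply le_of_eq
      ring
    · rw [hf, Set.indicator_of_notMem hξ]
      simp
  refine le_trans ?_ ((lintegral_mono hpt).trans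
    (lintegral_sin_sq_mul_le_rieszVariance α H t x s y))
  have hmom := lintegral_inner_sq_mul (fun ρ => f ρ * ENNReal.ofReal (ρ ^ (-α))) (by fun_prop)
    (x - y)
  have hpol := hpolar (-α) (fun ρ => ENNReal.ofReal (ρ ^ 2) * f ρ) (by fun_prop)
  have hint : ∫⁻ ρ in Set.Ioi 0, ENNReal.ofReal (ρ ^ 2) * f ρ *
      ENNReal.ofReal (ρ ^ ((d : ℝ) - 1 + -α)) =
      ∫⁻ ρ in Set.Ioc (1 / L) (1 / r), ENNReal.ofReal (ρ ^ (1 - θ)) := by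
    have hsub : Set.Ioc (1 / L) (1 / r) ⊆ Set.Ioi 0 := fun ρ hρ => lt_trans (by positivity) hρ.1
    rw [← lintegral_indicator measurableSet_Ioi, ← lintegral_indicator measurableSet_Ioc]
    refine lintegral_congr fun ρ => ?_
    by_cases hρ : ρ ∈ Set.Ioc (1 / L) (1 / r)
    · have hρ0 : 0 < ρ := hsub hρ
      rw [Set.indicator_of_mem hρ, Set.indicator_of_mem (hsub hρ), hf, Set.indicator_of_mem hρ,
        ← ENNReal.ofReal_mul (by positivity), ← ENNReal.ofReal_mul (by positivity),
        ← Real.rpow_two, ← Real.rpow_add hρ0, ← Real.rpow_add hρ0]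
      congr 2
      rw [hθ]
      ring
    · rw [Set.indicator_of_notMem hρ]
      by_cases h0 : ρ ∈ Set.Ioi 0
      · rw [Set.indicator_of_mem h0, hf, Set.indicator_of_notMem hρ]
        simp
      · rw [Set.indicator_of_notMem h0]
  rw [lintegral_const_mul' _ _ ENNReal.ofReal_ne_top, mul_assoc (k / 4),
    ENNReal.ofReal_mul (by positivity)]
  refine mul_le_mul_right ?_ _
  rw [hint] at hpol
  simp only [mul_assoc] at hpol hmom
  rw [hpol] at hmom
  have hlow := (hmid r hxy h).1
  set m := min 2 θ
  set g := Real.log (L / r) ^ n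
  have hd0 : (d : ℝ≥0∞) ≠ 0 := by exact_mod_cast hd.ne'
  rw [← ENNReal.mul_le_mul_iff_right hd0 (ENNReal.natCast_ne_top d), hmom]
  refine le_trans ?_ (mul_le_mul_right (mul_le_mul_right hlow _) _)
  rw [← ENNReal.ofReal_natCast, ← ENNReal.ofReal_mul hdR.le, ← ENNReal.ofReal_mul hω.le,
    ← ENNReal.ofReal_mul (by positivity)]
  apply ENNReal.ofReal_le_ofReal
  rw [← hr, Real.rpow_sub hxy, Real.rpow_two]
  apply le_of_eq
  field_simp

end

/-! ### The lower bound in the time variable. -/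

section

open scoped ENNReal

variable {d : ℕ} {α H : ℝ}

/-- The oscillating parts of the numerators at two frequencies with opposite phases cannot both be
small. -/
theorem half_le_norm_sq_add_norm_sq {X Y : ℂ} (hX : ‖X‖ = 1) (hY : ‖Y‖ = 1) {a b : ℝ}
    (ha : |a| ≤ 1 / 4) (hb : |b| ≤ 1 / 4) {t s δ : ℝ} (hδ : (t - s) * δ = Real.pi) (τ : ℝ) :
    1 / 2 ≤ ‖X * (Complex.exp ((t * τ : ℝ) * Complex.I) - a) -
        Y * (Complex.exp ((s * τ : ℝ) * Complex.I) - b)‖ ^ 2 +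
      ‖X * (Complex.exp ((t * (τ + δ) : ℝ) * Complex.I) - a) -
        Y * (Complex.exp ((s * (τ + δ) : ℝ) * Complex.I) - b)‖ ^ 2 := by
  set p := X * Complex.exp ((t * τ : ℝ) * Complex.I) with hp
  set q := Y * Complex.exp ((s * τ : ℝ) * Complex.I) with hq
  set w := Complex.exp ((s * δ : ℝ) * Complex.I) with hw
  have hpn : ‖p‖ = 1 := by rw [hp, norm_mul, hX, Complex.norm_exp_ofReal_mul_I, one_mul]
  have hwn : ‖w‖ = 1 := Complex.norm_exp_ofReal_mul_I _
  -- Shifting τ by δ multiplies q by w and p by -w: the phase π coming from (t-s)δ makes the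
  -- difference.
  have e1 : X * Complex.exp ((t * (τ + δ) : ℝ) * Complex.I) = -(w * p) := by
    have : t * (τ + δ) = t * τ + s * δ + Real.pi := by linarith
    rw [this, hp, hw]
    push_cast
    rw [add_mul, add_mul, Complex.exp_add, Complex.exp_add, Complex.exp_pi_mul_I]
    ring
  have e2 : Y * Complex.exp ((s * (τ + δ) : ℝ) * Complex.I) = w * q := by
    rw [hq, hw, mul_add]
    push_cast
    rw [add_mul, Complex.exp_add]
    ring
  set m := X * a - Y * b with hm
  have hmn : ‖m‖ ≤ 1 / 2 := by
    refine (norm_sub_le _ _).trans ?_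
    rw [norm_mul, norm_mul, hX, hY, Complex.norm_real, Complex.norm_real, Real.norm_eq_abs,
      Real.norm_eq_abs]
    linarith
  have f1 : X * (Complex.exp ((t * τ : ℝ) * Complex.I) - a) -
      Y * (Complex.exp ((s * τ : ℝ) * Complex.I) - b) = p - q - m := by
    rw [hp, hq, hm]; ring
  have f2 : X * (Complex.exp ((t * (τ + δ) : ℝ) * Complex.I) - a) -
      Y * (Complex.exp ((s * (τ + δ) : ℝ) * Complex.I) - b) = -(w * (p + q)) - m := by
    rw [mul_sub, mul_sub, e1, e2, hm]; ring
  rw [f1, f2]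
  have g1 := norm_sub_norm_le (p - q) m
  have g2 := norm_sub_norm_le (-(w * (p + q))) m
  rw [norm_neg, norm_mul, hwn, one_mul] at g2
  have g3 : 2 ≤ ‖p - q‖ + ‖p + q‖ := by
    have := norm_add_le (p - q) (p + q)
    rw [show p - q + (p + q) = 2 * p by ring, norm_mul, hpn] at this
    simpa using this
  -- Each norm loses at most 1/2 to m, so the two norms add up to at least 2 - 1 = 1 and their
  -- squares to at least 1/2.
  nlinarith [sq_nonneg (‖p - q - m‖ - ‖-(w * (p + q)) - m‖)]

theorem norm_spaceChar_mul_solHat_sub_sq (x y ξ : Space d) (t s τ ρ : ℝ) :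
    ‖spaceChar x ξ * solHat t τ ρ - spaceChar y ξ * solHat s τ ρ‖ ^ 2 =
      ‖spaceChar x ξ * (Complex.exp ((t * τ : ℝ) * Complex.I) - (Real.exp (-t * ρ) : ℝ)) -
        spaceChar y ξ * (Complex.exp ((s * τ : ℝ) * Complex.I) - (Real.exp (-s * ρ) : ℝ))‖ ^ 2 /
        (ρ ^ 2 + τ ^ 2) := by
  rw [solHat, solHat, mul_div_assoc', mul_div_assoc', ← sub_div, norm_div, div_pow,
    norm_sq_ofReal_add_mul_I]

/-- The condition s|ξ|² ≥ 2 makes both real exponentials at most e^{-2} ≤ 1/4, as the phase argument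
requires. The frequencies involved are at most 3π/h and |ξ|² ≤ B/h, so both terms of the denominator
are of order h^{-2}. -/
theorem le_spectralDensity (hH : 1 / 2 < H) {t s h B : ℝ} (hts : t - s = h) (hh : 0 < h)
    (x y : Space d) {ξ : Space d} (hB : ‖ξ‖ ^ 2 ≤ B / h) (hs : 2 ≤ s * ‖ξ‖ ^ 2) :
    ENNReal.ofReal ((3 * Real.pi) ^ (1 - 2 * H) * Real.pi / (4 * (B ^ 2 + 9 * Real.pi ^ 2)) *
      h ^ (2 * H)) ≤ spectralDensity H t x s y ξ := by
  have hpi := Real.pi_pos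
  set ρ := ‖ξ‖ ^ 2 with hρ
  have hρ0 : 0 ≤ ρ := by positivity
  set δ := Real.pi / h with hδ
  have hδ0 : 0 < δ := by positivity
  have hδ' : (t - s) * δ = Real.pi := by rw [hts, hδ]; field_simp
  set n : ℝ → ℝ := fun τ =>
    ‖spaceChar x ξ * (Complex.exp ((t * τ : ℝ) * Complex.I) - (Real.exp (-t * ρ) : ℝ)) -
      spaceChar y ξ * (Complex.exp ((s * τ : ℝ) * Complex.I) - (Real.exp (-s * ρ) : ℝ))‖ with hn
  set F : ℝ → ℝ≥0∞ := fun τ => ENNReal.ofReal (|τ| ^ (1 - 2 * H)) *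
    ‖spaceChar x ξ * solHat t τ ρ - spaceChar y ξ * solHat s τ ρ‖ₑ ^ 2 with hF
  have hFm : Measurable F := by
    have h0 : Measurable fun τ : ℝ => ENNReal.ofReal (|τ| ^ (1 - 2 * H)) := by fun_prop
    exact h0.mul ((((measurable_solHat_left t ρ).const_mul _).sub
      ((measurable_solHat_left s ρ).const_mul _)).enorm.pow_const 2)
  have hexp : ∀ v, s ≤ v → |Real.exp (-v * ρ)| ≤ 1 / 4 := by
    intro v hv
    rw [Real.abs_exp]
    have h1 : Real.exp (-v * ρ) ≤ Real.exp (-2) := by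
      apply Real.exp_le_exp.2
      nlinarith
    have h2 : Real.exp (-2) * Real.exp 2 = 1 := by rw [← Real.exp_add]; simp
    have h3 : (4 : ℝ) ≤ Real.exp 2 := by
      have h4 := Real.add_one_le_exp (1 : ℝ)
      rw [show (2 : ℝ) = 1 + 1 by norm_num, Real.exp_add]
      nlinarith
    nlinarith [Real.exp_pos (-2)]
  have hnn : ∀ τ, 1 / 2 ≤ n τ ^ 2 + n (τ + δ) ^ 2 := fun τ =>
    half_le_norm_sq_add_norm_sq (norm_spaceChar x ξ) (norm_spaceChar y ξ)
      (hexp t (by linarith)) (hexp s le_rfl) hδ' τ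
  -- Lower bound on (0, 3δ] for the weight divided by the denominator; it is of order h^{2H+1}, and
  -- a window of length δ = π/h reduces this to h^{2H}.
  set K := (3 * δ) ^ (1 - 2 * H) * (h ^ 2 / (B ^ 2 + 9 * Real.pi ^ 2)) with hK
  have hK0 : 0 ≤ K := by positivity
  have hFle : ∀ τ, 0 < τ → τ ≤ 3 * δ → ENNReal.ofReal (K * n τ ^ 2) ≤ F τ := by
    intro τ hτ0 hτ
    simp only [hF]
    rw [enorm_sq_eq_ofReal, norm_spaceChar_mul_solHat_sub_sq, abs_of_pos hτ0,
      ← ENNReal.ofReal_mul (by positivity)]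
    apply ENNReal.ofReal_le_ofReal
    rw [hK, mul_assoc]
    refine mul_le_mul (Real.rpow_le_rpow_of_nonpos hτ0 hτ (by linarith)) ?_ (by positivity)
      (by positivity)
    rw [div_mul_eq_mul_div, mul_comm, mul_div_assoc, div_eq_mul_inv (n τ ^ 2)]
    refine mul_le_mul_of_nonneg_left ?_ (sq_nonneg _)
    rw [div_le_iff₀ (by positivity), inv_mul_eq_div, le_div_iff₀ (by positivity)]
    have h1 : ρ ^ 2 ≤ (B / h) ^ 2 := by gcongr
    have h2 : τ ^ 2 ≤ (3 * δ) ^ 2 := by gcongr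
    have h3 : h ^ 2 * ((B / h) ^ 2 + (3 * δ) ^ 2) = B ^ 2 + 9 * Real.pi ^ 2 := by
      rw [hδ]; field_simp; ring
    rw [← h3]
    gcongr
  -- For τ in (δ, 2δ] both τ and τ + δ lie in (0, 3δ], and by translation invariance the two
  -- integrals of F agree.
  have key : 2 * ENNReal.ofReal (K / 4 * δ) ≤ 2 * spectralDensity H t x s y ξ := by
    calc 2 * ENNReal.ofReal (K / 4 * δ) = ENNReal.ofReal (K * (1 / 2)) * volume (Set.Ioc δ (2 * δ)) := by
          rw [Real.volume_Ioc, ← ENNReal.ofReal_mul (by positivity),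
            show (2 : ℝ≥0∞) = ENNReal.ofReal 2 by norm_num, ← ENNReal.ofReal_mul (by norm_num)]
          congr 1
          ring
      _ = ∫⁻ τ in Set.Ioc δ (2 * δ), ENNReal.ofReal (K * (1 / 2)) := by rw [setLIntegral_const]
      _ ≤ ∫⁻ τ in Set.Ioc δ (2 * δ), (F τ + F (τ + δ)) := by
          refine setLIntegral_mono' measurableSet_Ioc fun τ hτ => ?_
          have hτ1 := hτ.1
          have hτ2 := hτ.2
          refine le_trans ?_ (add_le_add (hFle τ (by linarith) (by linarith))
            (hFle (τ + δ) (by linarith) (by linarith)))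
          rw [← ENNReal.ofReal_add (by positivity) (by positivity), ← mul_add]
          exact ENNReal.ofReal_le_ofReal (mul_le_mul_of_nonneg_left (hnn τ) hK0)
      _ ≤ ∫⁻ τ, (F τ + F (τ + δ)) := setLIntegral_le_lintegral _ _
      _ = 2 * spectralDensity H t x s y ξ := by
          rw [lintegral_add_left hFm, lintegral_add_right_eq_self F δ, ← two_mul]
          rfl
  refine le_trans (le_of_eq ?_) ((ENNReal.mul_le_mul_iff_right (by norm_num) (by norm_num)).1 key)
  congr 1
  have e : (3 * δ) ^ (1 - 2 * H) = (3 * Real.pi) ^ (1 - 2 * H) * (h ^ (2 * H) / h) := by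
    rw [hδ, mul_div_assoc', Real.div_rpow (by positivity) hh.le, Real.rpow_sub hh, Real.rpow_one]
    field_simp
  rw [hK, e, hδ]
  field_simp

theorem spectralDensity_comm (H t : ℝ) (x : Space d) (s : ℝ) (y ξ : Space d) :
    spectralDensity H t x s y ξ = spectralDensity H s y t x ξ := by
  unfold spectralDensity
  refine lintegral_congr fun τ => ?_
  rw [← ofReal_norm, norm_sub_rev, ofReal_norm]

theorem rieszVariance_comm (α H t : ℝ) (x : Space d) (s : ℝ) (y : Space d) :
    rieszVariance α H t x s y = rieszVariance α H s y t x := by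
  unfold rieszVariance
  simp_rw [spectralDensity_comm H t x s y]

/-- On the shell b < |ξ| ≤ 2b with b² = A/h the density is at least a multiple of h^{2H}, while the
|ξ|^{-α} mass of the shell is a multiple of b^{d-α}, that is, of h^{-(d-α)/2}. -/
theorem exists_time_le_rieszVariance_of_lt (hαd : α < d) (hα : 0 ≤ α) (hH : 1 / 2 < H)
    {t₀ T : ℝ} (ht₀ : 0 < t₀) (hT : 0 < T) :
    ∃ c : ℝ, 0 < c ∧ ∀ t s, t₀ ≤ s → s < t → t ≤ T → ∀ x y : Space d,
      ENNReal.ofReal (c * (t - s) ^ (2 * H - (d - α) / 2)) ≤ rieszVariance α H t x s y := by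
  have hdR : (0 : ℝ) < d := hα.trans_lt hαd
  have hd : 0 < d := by exact_mod_cast hdR
  have hD : 0 < (d : ℝ) - α := by linarith
  obtain ⟨ω, hω, hpolar⟩ := exists_lintegral_norm_mul_rpow hd
  have hpi := Real.pi_pos
  -- Chosen so that s ≥ t₀ and |ξ|² ≥ A/h give s|ξ|² ≥ 2T/h ≥ 2; on the shell |ξ|² ≤ 4A/h, hence B =
  -- 4A in `k`.
  set A := 2 * T / t₀ with hA
  have hA0 : 0 < A := by positivity
  set k := (3 * Real.pi) ^ (1 - 2 * H) * Real.pi / (4 * ((4 * A) ^ 2 + 9 * Real.pi ^ 2)) with hk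
  have hk0 : 0 < k := by positivity
  have h2D : 0 < (2 : ℝ) ^ ((d : ℝ) - α) - 1 := by
    have := Real.one_lt_rpow one_lt_two hD
    linarith
  refine ⟨k * (ω * (A ^ (((d : ℝ) - α) / 2) * ((2 ^ ((d : ℝ) - α) - 1) / (d - α)))), by positivity,
    fun t s hs hst ht x y => ?_⟩
  set h := t - s with hh
  have hh0 : 0 < h := by linarith
  set b := √(A / h) with hb
  have hb0 : 0 < b := by positivity
  have hb2 : b ^ 2 = A / h := Real.sq_sqrt (by positivity)
  set f : ℝ → ℝ≥0∞ := (Set.Ioc b (2 * b)).indicator 1 with hf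
  have hfm : Measurable f := measurable_one.indicator measurableSet_Ioc
  have hpt : ∀ ξ : Space d, ENNReal.ofReal (k * h ^ (2 * H)) *
      (f ‖ξ‖ * ENNReal.ofReal (‖ξ‖ ^ (-α))) ≤
      spectralDensity H t x s y ξ * ENNReal.ofReal (‖ξ‖ ^ (-α)) := by
    intro ξ
    by_cases hξ : ‖ξ‖ ∈ Set.Ioc b (2 * b)
    · rw [hf, Set.indicator_of_mem hξ, Pi.one_apply, one_mul]
      refine mul_le_mul_left (le_spectralDensity hH hh.symm hh0 x y ?_ ?_) _
      · calc ‖ξ‖ ^ 2 ≤ (2 * b) ^ 2 := pow_le_pow_left₀ (norm_nonneg _) hξ.2 2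
          _ = _ := by rw [mul_pow, hb2]; ring
      · have h1 : A / h ≤ ‖ξ‖ ^ 2 := hb2 ▸ pow_le_pow_left₀ hb0.le hξ.1.le 2
        have h2 : t₀ * (A / h) = 2 * (T / h) := by rw [hA]; field_simp
        have h3 : 1 ≤ T / h := (one_le_div hh0).2 (by linarith)
        have h4 : t₀ * (A / h) ≤ s * ‖ξ‖ ^ 2 := mul_le_mul hs h1 (by positivity) (by linarith)
        linarith
    · rw [hf, Set.indicator_of_notMem hξ]
      simp
  refine le_trans (le_of_eq ?_) (lintegral_mono hpt)
  have hint : ∫⁻ ρ in Set.Ioi 0, f ρ * ENNReal.ofReal (ρ ^ ((d : ℝ) - 1 + -α)) =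
      ENNReal.ofReal (((2 * b) ^ ((d : ℝ) - α) - b ^ ((d : ℝ) - α)) / (d - α)) := by
    have e : ∀ ρ : ℝ, f ρ * ENNReal.ofReal (ρ ^ ((d : ℝ) - 1 + -α)) =
        (Set.Ioc b (2 * b)).indicator (fun ρ => ENNReal.ofReal (ρ ^ ((d : ℝ) - 1 + -α))) ρ := by
      intro ρ
      by_cases hρ : ρ ∈ Set.Ioc b (2 * b) <;> simp [hf, hρ]
    have hsub : Set.Ioc b (2 * b) ⊆ Set.Ioi 0 := fun ρ hρ => hb0.trans hρ.1
    simp_rw [e]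
    rw [setLIntegral_indicator measurableSet_Ioc, Set.inter_eq_left.2 hsub,
      setLIntegral_Ioc_rpow hb0 (by linarith), integral_rpow (Or.inl (by linarith)),
      show (d : ℝ) - 1 + -α + 1 = d - α by ring]
  rw [lintegral_const_mul' _ _ ENNReal.ofReal_ne_top, hpolar (-α) f hfm, hint,
    ← ENNReal.ofReal_mul hω.le, ← ENNReal.ofReal_mul (by positivity)]
  congr 1
  have e1 : b ^ ((d : ℝ) - α) = A ^ (((d : ℝ) - α) / 2) / h ^ (((d : ℝ) - α) / 2) := by
    rw [← Real.div_rpow hA0.le hh0.le, hb, Real.sqrt_eq_rpow, ← Real.rpow_mul (by positivity)]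
    congr 1
    ring
  rw [Real.mul_rpow two_pos.le hb0.le, e1, Real.rpow_sub hh0]
  field_simp

theorem exists_time_le_rieszVariance (hαd : α < d) (hα : 0 ≤ α) (hH : 1 / 2 < H)
    (hdα : (d : ℝ) - α < 4 * H) {t₀ T : ℝ} (ht₀ : 0 < t₀) (hT : 0 < T) :
    ∃ c : ℝ, 0 < c ∧ ∀ t ∈ Set.Icc t₀ T, ∀ s ∈ Set.Icc t₀ T, ∀ x y : Space d,
      ENNReal.ofReal (c * |t - s| ^ (2 * H - (d - α) / 2)) ≤ rieszVariance α H t x s y := by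
  obtain ⟨c, hc, hle⟩ := exists_time_le_rieszVariance_of_lt hαd hα hH ht₀ hT
  refine ⟨c, hc, fun t ht s hs x y => ?_⟩
  rcases lt_trichotomy s t with h | rfl | h
  · rw [abs_of_pos (sub_pos.2 h)]
    exact hle t s hs.1 h ht.2 x y
  · rw [sub_self, abs_zero, Real.zero_rpow (by linarith)]
    simp
  · rw [abs_of_neg (sub_neg.2 h), neg_sub, rieszVariance_comm]
    exact hle s t ht.1 h hs.2 y x

theorem exists_le_rieszVariance (hαd : α < d) (hα : 0 ≤ α) (hH : 1 / 2 < H)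
    (hdα : (d : ℝ) - α < 4 * H) {t₀ T M : ℝ} (ht₀ : 0 < t₀) (hT : 0 < T) (hM : 0 < M) :
    ∃ c : ℝ, 0 < c ∧ ∀ t ∈ Set.Icc t₀ T, ∀ s ∈ Set.Icc t₀ T, ∀ x ∈ cube d M, ∀ y ∈ cube d M,
      ENNReal.ofReal (c * gauge d α H M t s x y) ≤ rieszVariance α H t x s y := by
  have hdR : (0 : ℝ) < d := hα.trans_lt hαd
  obtain ⟨c₁, hc₁, h1⟩ := exists_time_le_rieszVariance hαd hα hH hdα ht₀ hT
  obtain ⟨c₂, hc₂, h2⟩ := exists_space_le_rieszVariance hαd hα hH ht₀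
    (show 0 < 2 * Real.exp 1 * √d * M by positivity) _ rfl
  -- The variance dominates each summand of the gauge, so twice the variance dominates their sum.
  refine ⟨min c₁ c₂ / 2, by positivity, fun t ht s hs x hx y hy => ?_⟩
  set n : ℕ := open Classical in if 4 * H - (d - α) = 2 then 1 else 0
  set r := ‖x - y‖ with hr
  set S := Real.log (2 * Real.exp 1 * √d * M / r) ^ n * r ^ min 2 (4 * H - (d - α)) with hS
  have hg : gauge d α H M t s x y = |t - s| ^ (2 * H - (d - α) / 2) + S := rfl
  have hS2 : ENNReal.ofReal (c₂ * S) ≤ rieszVariance α H t x s y := by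
    rcases (norm_nonneg (x - y)).eq_or_lt with h0 | h0
    · rw [← hr] at h0
      rw [hS, ← h0, Real.zero_rpow (lt_min two_pos (by linarith)).ne']
      simp
    · exact h2 t ht.1 s x y h0 (exp_one_mul_norm_sub_le hx hy)
  have hS0 : 0 ≤ S := log_pow_mul_rpow_nonneg hx hy _ _
  have hS1 := h1 t ht s hs x y
  have hτ0 : 0 ≤ |t - s| ^ (2 * H - (d - α) / 2) := by positivity
  have key : 2 * ENNReal.ofReal (min c₁ c₂ / 2 * gauge d α H M t s x y) ≤
      2 * rieszVariance α H t x s y := by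
    rw [two_mul (rieszVariance α H t x s y)]
    refine le_trans ?_ (add_le_add hS1 hS2)
    rw [← ENNReal.ofReal_add (by positivity) (by positivity),
      show (2 : ℝ≥0∞) = ENNReal.ofReal 2 by norm_num, ← ENNReal.ofReal_mul (by norm_num)]
    apply ENNReal.ofReal_le_ofReal
    rw [hg]
    nlinarith [mul_le_mul_of_nonneg_right (min_le_left c₁ c₂) hτ0,
      mul_le_mul_of_nonneg_right (min_le_right c₁ c₂) hS0]
  exact (ENNReal.mul_le_mul_iff_right (by norm_num) (by norm_num)).1 key

end

end FractionalHeat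

end

/-! ### Conclusion: transfer of the bounds from the Riesz weight to the solution. -/

theorem theoremt3p1
    (d : ℕ) (α H T t₀ M k₁ k₂ : ℝ)
    (hα : 0 ≤ α) (hαd : α < d)
    (hH : 1 / 2 < H) (hH' : H < 1)
    (hdα : (d : ℝ) - α < 4 * H)
    (ht₀ : 0 < t₀) (ht₀T : t₀ ≤ T) (hM : 0 < M)
    (hk₁ : 0 < k₁) (hk₂ : 0 < k₂) :
    ∃ c₅ c₆ : ℝ, 0 < c₅ ∧ 0 < c₆ ∧
      ∀ (Λ μ : MeasureTheory.Measure (FractionalHeat.Space d)),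
        FractionalHeat.IsSpectralMeasure Λ μ →
        FractionalHeat.RieszComparable α k₁ k₂ μ →
      ∀ (Ω : Type*) [MeasurableSpace Ω] (P : MeasureTheory.Measure Ω)
        [MeasureTheory.IsProbabilityMeasure P]
        (W : FractionalHeat.NoiseIndex d T → Ω → ℝ)
        (u : ℝ → FractionalHeat.Space d → Ω → ℝ),
        FractionalHeat.IsFractionalNoise P T H Λ W →
        FractionalHeat.IsHeatSolution P H Λ W u →
        (∀ t ∈ Set.Icc t₀ T, ∀ s ∈ Set.Icc t₀ T,
          ∀ x ∈ FractionalHeat.cube d M, ∀ y ∈ FractionalHeat.cube d M,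
            c₅ * FractionalHeat.gauge d α H M t s x y ≤
              ∫ ω, (u t x ω - u s y ω) ^ 2 ∂P) ∧
        (∀ t ∈ Set.Icc 0 T, ∀ s ∈ Set.Icc 0 T,
          ∀ x ∈ FractionalHeat.cube d M, ∀ y ∈ FractionalHeat.cube d M,
            ∫ ω, (u t x ω - u s y ω) ^ 2 ∂P ≤
              c₆ * FractionalHeat.gauge d α H M t s x y) := by
  have hdR : (0 : ℝ) < d := hα.trans_lt hαd
  have hd : 0 < d := by exact_mod_cast hdR
  have : Nonempty (Fin d) := ⟨⟨0, hd⟩⟩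
  have : Nontrivial (FractionalHeat.Space d) := inferInstance
  have hT : 0 < T := ht₀.trans_le ht₀T
  have hκ := FractionalHeat.specConst_pos (d := d) hH hH'
  set κ := FractionalHeat.specConst d H
  obtain ⟨c, hc, hlow⟩ := FractionalHeat.exists_le_rieszVariance hαd hα hH hdα ht₀ hT hM
  obtain ⟨C, hC, hup⟩ := FractionalHeat.exists_rieszVariance_le hαd hα hH hH' hdα hT hM
  -- The constants are fixed before Λ, μ and the probability space are introduced: `c` and `C` bound
  -- `rieszVariance`, which involves none of them.
  refine ⟨κ * (k₁ * c), κ * (k₂ * C), by positivity, by positivity, ?_⟩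
  intro Λ μ h hR Ω _ P _ W u hW hu
  have hsub : Set.Icc t₀ T ⊆ Set.Icc 0 T := Set.Icc_subset_Icc_left ht₀.le
  refine ⟨fun t ht s hs x hx y hy => ?_, fun t ht s hs x hx y hy => ?_⟩
  · have hv := (hu.variance_bounds hW h hR hH hH' (hsub ht) (hsub hs) x y).1
    have hv' := (mul_le_mul_right (mul_le_mul_right (hlow t ht s hs x hx y hy) _) _).trans hv
    rw [← ENNReal.ofReal_mul hk₁.le, ← ENNReal.ofReal_mul hκ.le] at hv'
    have hnn : 0 ≤ ∫ ω, (u t x ω - u s y ω) ^ 2 ∂P :=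
      MeasureTheory.integral_nonneg fun ω => sq_nonneg _
    have := (ENNReal.ofReal_le_ofReal_iff hnn).1 hv'
    linarith
  · have hv := (hu.variance_bounds hW h hR hH hH' ht hs x y).2
    have hv' := hv.trans (mul_le_mul_right (mul_le_mul_right (hup t ht s hs x hx y hy) _) _)
    rw [← ENNReal.ofReal_mul hk₂.le, ← ENNReal.ofReal_mul hκ.le] at hv'
    have hg := FractionalHeat.gauge_nonneg d α H t s hx hy
    have := (ENNReal.ofReal_le_ofReal_iff (by positivity)).1 hv'
    linarith
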